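/- A finite metric space is a finite set $X$ with a symmetric function $d:X\times X\to\mathbb R_{\ge 0}$ that satisfies the triangle inequality and $d(u,u)=0$ for all $u\in X$. Its doubling dimension is the smallest $D\in\mathbb R_{\ge 0}$ such that for each $u\in X$ and $r>0$ the ball $B(u,r)=\{v: d(u,v)\le r\}$ is covered by at most $2^D$ balls of radius $r/2$. For a real $q\ge 1$ and a finite set $T\subseteq X$ let $$\mathrm{cl}^q(T)=\tfrac12\sum_{u,v\in T} d(u,v)^q,\qquad \mathrm{st}^q(T)=\min_{z\in T}\sum_{u\in T\setminus\{z\}} d(z,u)^q,\qquad \mathrm{bp}^q(T)=\min_{L\subseteq T,\ |L|=\lfloor |T|/2\rfloor}\ \sum_{\ell\in L,\ r\in T\setminus L} d(\ell,r)^q .$$ The $q$-th power version of remote-clique, remote-star or remote-bipartition asks, given an $n$-point metric space $X$ and an integer $k$ with $2\le k\le n$, for a $k$-set $T\subseteq X$ that maximizes $\mathrm{div}^q(T)$, where $\mathrm{div}^q$ is $\mathrm{cl}^q$, $\mathrm{st}^q$ or $\mathrm{bp}^q$, respectively. **Theorem.** For every constant $q\in\mathbb R_{\ge 1}$, the $q$-th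 power versions of remote-clique, remote-star and remote-bipartition admit polynomial-time approximation schemes over doubling metric spaces. That is, for each of the three problems there is an algorithm that, given $n$, $k$, the $n\times n$ distance matrix of $X$ and $\epsilon>0$, returns a $k$-set $T\subseteq X$ with $\mathrm{div}^q(T)\ge(1-\epsilon)\max_{S\subseteq X,\,|S|=k}\mathrm{div}^q(S)$, and whose number of steps, for all fixed $\epsilon>0$ and $D$, is bounded by a polynomial in $n$ on all instances in which $X$ has doubling dimension at most $D$. The algorithm is not given $D$. Here an algorithm is a program for a real RAM: it computes at unit cost with natural numbers (addition, subtraction truncated at zero, comparison; also used as array indices) and with real numbers (conversion from natural numbers, addition, subtraction, multiplication, division, the power $x\mapsto x^q$ for $x\ge 0$, comparison), has no rounding operation, and has only natural numbers as constants. -/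

import Mathlib

noncomputable section

namespace Dispersion

/-! ## The three diversity functions -/

/-- The three diversification problems. -/
inductive Problem
  | remoteClique
  | remoteStar
  | remoteBipartition

open Classical in
/-- The diversity of a finite set `T` of points with respect to the `q`-th powers of the distances.
For `remoteStar` the minimum is over the centers `z ∈ T`; for `remoteBipartition` it is over the
subsets `L ⊆ T` with `⌊|T| / 2⌋` elements. -/
def diversity {X : Type} [PseudoMetricSpace X] (q : ℝ) : Problem → Finset X → ℝ
  | .remoteClique, T => (1 / 2) * ∑ u ∈ T, ∑ v ∈ T, dist u v ^ q
  | .remoteStar, T => ⨅ z : {z : X // z ∈ T}, ∑ u ∈ T.erase z.1, dist z.1 u ^ q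
  | .remoteBipartition, T =>
      ⨅ L : {L : Finset X // L ⊆ T ∧ L.card = T.card / 2},
        ∑ l ∈ L.1, ∑ r ∈ T \ L.1, dist l r ^ q

/-- `T` is a feasible solution (a `k`-set) whose diversity is at least `1 - ε` times the largest
diversity of a `k`-set. -/
def IsApproxSolution {X : Type} [PseudoMetricSpace X] (q : ℝ) (P : Problem) (k : ℕ) (ε : ℝ)
    (T : Finset X) : Prop :=
  T.card = k ∧ ∀ S : Finset X, S.card = k → (1 - ε) * diversity q P S ≤ diversity q P T

/-! ## Doubling dimension -/

/-- The doubling dimension: the smallest `D ≥ 0` such that every ball of positive radius can be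
covered by at most `2 ^ D` balls of half its radius. -/
def doublingDim (X : Type) [PseudoMetricSpace X] : ℝ :=
  sInf {D : ℝ | 0 ≤ D ∧ ∀ (u : X) (r : ℝ), 0 < r →
    ∃ s : Finset X, (s.card : ℝ) ≤ 2 ^ D ∧
      Metric.closedBall u r ⊆ ⋃ v ∈ s, Metric.closedBall v (r / 2)}

/-! ## The machine model: a real RAM

The memory consists of arrays of natural numbers and arrays of real numbers, all of unbounded
length. The names of the arrays are fixed in the program, the positions in them are computed. On
natural numbers the machine can add, subtract (truncated at zero) and compare. On real numbers it
can add, subtract, multiply, divide, raise to the power `q`, and compare; there is no rounding, and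
the only constants in a program are natural numbers. Every operation and every memory access has
unit cost. -/

/-- The contents of the memory: `s.nats a i` and `s.reals a i` are the entries at position `i` of
the arrays with the name `a`. -/
structure Memory where
  nats : ℕ → ℕ → ℕ
  reals : ℕ → ℕ → ℝ

/-- Expressions for natural numbers. -/
inductive NatExpr
  | lit (c : ℕ)
  | get (a : ℕ) (i : NatExpr)
  | add (e₁ e₂ : NatExpr)
  | sub (e₁ e₂ : NatExpr)

/-- Expressions for real numbers. -/
inductive RealExpr
  | ofNat (e : NatExpr)
  | get (a : ℕ) (i : NatExpr)
  | add (e₁ e₂ : RealExpr)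
  | sub (e₁ e₂ : RealExpr)
  | mul (e₁ e₂ : RealExpr)
  | div (e₁ e₂ : RealExpr)
  | pow (e : RealExpr)

/-- Tests. -/
inductive Test
  | natLe (e₁ e₂ : NatExpr)
  | realLe (e₁ e₂ : RealExpr)
  | neg (b : Test)
  | conj (b₁ b₂ : Test)

/-- Programs. -/
inductive Program
  | skip
  | setNat (a : ℕ) (i e : NatExpr)
  | setReal (a : ℕ) (i : NatExpr) (e : RealExpr)
  | seq (c₁ c₂ : Program)
  | branch (b : Test) (c₁ c₂ : Program)
  | loop (b : Test) (c : Program)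

/-- The value of an expression. -/
def NatExpr.eval (s : Memory) : NatExpr → ℕ
  | .lit c => c
  | .get a i => s.nats a (i.eval s)
  | .add e₁ e₂ => e₁.eval s + e₂.eval s
  | .sub e₁ e₂ => e₁.eval s - e₂.eval s

/-- The number of steps that the evaluation of an expression takes. -/
def NatExpr.cost : NatExpr → ℕ
  | .lit _ => 1
  | .get _ i => i.cost + 1
  | .add e₁ e₂ => e₁.cost + e₂.cost + 1
  | .sub e₁ e₂ => e₁.cost + e₂.cost + 1

/-- The value of an expression. The power is taken of the positive part, so that it is the ordinary
power of a nonnegative number; a quotient by zero is zero. -/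
def RealExpr.eval (q : ℝ) (s : Memory) : RealExpr → ℝ
  | .ofNat e => (e.eval s : ℝ)
  | .get a i => s.reals a (i.eval s)
  | .add e₁ e₂ => e₁.eval q s + e₂.eval q s
  | .sub e₁ e₂ => e₁.eval q s - e₂.eval q s
  | .mul e₁ e₂ => e₁.eval q s * e₂.eval q s
  | .div e₁ e₂ => e₁.eval q s / e₂.eval q s
  | .pow e => (max (e.eval q s) 0) ^ q

/-- The number of steps that the evaluation of an expression takes. -/
def RealExpr.cost : RealExpr → ℕ
  | .ofNat e => e.cost + 1
  | .get _ i => i.cost + 1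
  | .add e₁ e₂ => e₁.cost + e₂.cost + 1
  | .sub e₁ e₂ => e₁.cost + e₂.cost + 1
  | .mul e₁ e₂ => e₁.cost + e₂.cost + 1
  | .div e₁ e₂ => e₁.cost + e₂.cost + 1
  | .pow e => e.cost + 1

/-- The truth value of a test. -/
def Test.Holds (q : ℝ) (s : Memory) : Test → Prop
  | .natLe e₁ e₂ => e₁.eval s ≤ e₂.eval s
  | .realLe e₁ e₂ => e₁.eval q s ≤ e₂.eval q s
  | .neg b => ¬ b.Holds q s
  | .conj b₁ b₂ => b₁.Holds q s ∧ b₂.Holds q s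

/-- The number of steps that a test takes. -/
def Test.cost : Test → ℕ
  | .natLe e₁ e₂ => e₁.cost + e₂.cost + 1
  | .realLe e₁ e₂ => e₁.cost + e₂.cost + 1
  | .neg b => b.cost + 1
  | .conj b₁ b₂ => b₁.cost + b₂.cost + 1

/-- The memory after the assignment of `x` to position `i` of the array `a`. -/
def Memory.setNat (s : Memory) (a i x : ℕ) : Memory :=
  { s with nats := Function.update s.nats a (Function.update (s.nats a) i x) }

/-- The memory after the assignment of `x` to position `i` of the array `a`. -/
def Memory.setReal (s : Memory) (a i : ℕ) (x : ℝ) : Memory :=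
  { s with reals := Function.update s.reals a (Function.update (s.reals a) i x) }

/-- `Runs q c s t s'`: the program `c`, started with memory `s`, halts after exactly `t` steps, with
memory `s'`. -/
inductive Runs (q : ℝ) : Program → Memory → ℕ → Memory → Prop
  | skip (s : Memory) : Runs q .skip s 1 s
  | setNat (a : ℕ) (i e : NatExpr) (s : Memory) :
      Runs q (.setNat a i e) s (i.cost + e.cost + 1) (s.setNat a (i.eval s) (e.eval s))
  | setReal (a : ℕ) (i : NatExpr) (e : RealExpr) (s : Memory) :
      Runs q (.setReal a i e) s (i.cost + e.cost + 1) (s.setReal a (i.eval s) (e.eval q s))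
  | seq {c₁ c₂ : Program} {s s₁ s₂ : Memory} {t₁ t₂ : ℕ} :
      Runs q c₁ s t₁ s₁ → Runs q c₂ s₁ t₂ s₂ → Runs q (.seq c₁ c₂) s (t₁ + t₂) s₂
  | branch_true {b : Test} {c₁ c₂ : Program} {s s' : Memory} {t : ℕ} :
      b.Holds q s → Runs q c₁ s t s' → Runs q (.branch b c₁ c₂) s (b.cost + t + 1) s'
  | branch_false {b : Test} {c₁ c₂ : Program} {s s' : Memory} {t : ℕ} :
      ¬ b.Holds q s → Runs q c₂ s t s' → Runs q (.branch b c₁ c₂) s (b.cost + t + 1) s'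
  | loop_true {b : Test} {c : Program} {s s₁ s₂ : Memory} {t₁ t₂ : ℕ} :
      b.Holds q s → Runs q c s t₁ s₁ → Runs q (.loop b c) s₁ t₂ s₂ →
        Runs q (.loop b c) s (b.cost + t₁ + t₂ + 1) s₂
  | loop_false {b : Test} {c : Program} {s : Memory} :
      ¬ b.Holds q s → Runs q (.loop b c) s (b.cost + 1) s

/-! ## Polynomial-time approximation schemes -/

/-- The memory at the start. The natural number arrays `0` and `1` hold `n` and `k` at position `0`;
the real array `0` holds `ε` at position `0`; the real array `1` holds the matrix of the distances
between the points `e 0, …, e (n - 1)`, row by row. All other entries are zero. -/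
def inputMemory {X : Type} [PseudoMetricSpace X] {n : ℕ} (e : Fin n ≃ X) (k : ℕ) (ε : ℝ) :
    Memory where
  nats a i := if a = 0 ∧ i = 0 then n else if a = 1 ∧ i = 0 then k else 0
  reals a i :=
    if a = 0 ∧ i = 0 then ε
    else if a = 1 then
      if h : i / n < n ∧ i % n < n then dist (e ⟨i / n, h.1⟩) (e ⟨i % n, h.2⟩) else 0
    else 0

open Classical in
/-- The set of points that a memory describes at the end: `e i` belongs to it if and only if
position `i` of the natural number array `2` holds a nonzero number. -/
def outputSet {X : Type} {n : ℕ} (e : Fin n ≃ X) (s : Memory) : Finset X :=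
  (Finset.univ.filter fun i : Fin n => s.nats 2 i ≠ 0).map e.toEmbedding

/-- The problem `P`, with `q`-th powers of distances, admits a polynomial-time approximation scheme
over doubling metric spaces: a single program, given an `n`-point metric space, the number `k` and
`ε`, returns a `(1 - ε)`-approximate solution, in a number of steps that is bounded by a polynomial
in `n` for every fixed `ε` and every fixed bound `D` on the doubling dimension. The program is not
told `D`. -/
def AdmitsPTAS (q : ℝ) (P : Problem) : Prop :=
  ∃ A : Program, ∀ ε : ℝ, 0 < ε → ∀ D : ℝ, ∃ p : Polynomial ℕ,
    ∀ (X : Type) [PseudoMetricSpace X] (n k : ℕ) (e : Fin n ≃ X),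
      2 ≤ k → k ≤ n → doublingDim X ≤ D →
        ∃ (t : ℕ) (s : Memory), Runs q A (inputMemory e k ε) t s ∧ t ≤ p.eval n ∧
          IsApproxSolution q P k ε (outputSet e s)

end Dispersion

end

/-!
The program implements one algorithm for all three problems. Write `w u v = dist u v ^ q`, and let
`K` be a natural number with `2 ^ q ≤ K`, so that `w u v ≤ K * (w u x + w x v)`. The finer
estimate `(x + y) ^ q ≤ (1 + K * θ) * x ^ q + (1 + 1 / θ) ^ q * y ^ q` (`add_rpow_le_blowup`)
plays the role of the triangle inequality with a small relative loss.

*The algorithm.* For a point `z`, let `M` be the sum of the `k` largest values `w z u`, and choose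
the point `z` with the smallest `M`. An exchange argument for a `k`-set of largest total distance
shows that `M` is at most a constant times the optimum, in the appropriate normalization
(`exists_center`, `scale_le_of_isMinCut`). Points with `w z u > C * M / k` are far; the others are
divided greedily into clusters of radius, to the power `q`, `ξ * M / k`, where `C` and `ξ` depend
only on `q` and `ε`. The far points form one more cluster. In a space of bounded doubling
dimension, the number `m` of clusters is bounded (`exists_clustering_bound`). In each cluster, the
points are ordered by decreasing distance from `z`. The program tries all sets that consist of the
first `f i` points of each cluster `i`, for all `f` with values at most `n`. For
remote-bipartition, the value of such a set is computed approximately as the smallest cut among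
those that separate, in each cluster, the first points from the others. Each of the two searches,
of which the second is nested in the first, visits `(n + 1) ^ m` possibilities.

*Why it is accurate.* If `a` or `u` is far, then `w a u` may be replaced by the distance of one of
them from `z` (`model`): in the sum over at least half of the points `u` of a `k`-set, the error
is small compared with the sum and `M` (`IsScale.sum_modelError_le`). After that replacement,
moving a point inside its cluster, and a far point away from `z`, does not decrease sums of
distances by much (`IsScale.sum_dist_le_of_canMove`). Hence every `k`-set `S` has a counterpart
among the candidates whose diversity is almost as large. In the same way, cuts of the same set
with the same numbers of points in each cluster are almost equal (`IsScale.cut_swap_le`): although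
two far points of the same cluster may be at different distances from `z`, in a balanced cut such
a point contributes its distance from `z` about as often on the left as on the right. Both losses
together are at most `ε` times the optimum (`approx_of_estimates`).

*The machine.* Programs are written in a language `Cmd` whose loops are bounded in advance: loops
over all points, and loops (`odometer`) over all sequences of `m` numbers at most `n`. Each
command has a syntactic bound for its cost, which is a polynomial in `n` if `m` is bounded
(`Cmd.exists_polynomial`), and `Does` expresses total correctness within that cost, together with
the fact that only the arrays that the command mentions as written are changed.
-/

noncomputable section

namespace Dispersion

/-! ### A structured programming language and its compilation -/

/-- The content of position `0` of the array `a`, which serves as a register. -/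
abbrev reg (a : ℕ) : NatExpr := .get a (.lit 0)

/-- The name of the array whose position `0` holds the number of digits of an odometer. -/
notation "aDigits" => (12 : ℕ)

/-- Commands of a structured language whose loops are bounded in advance. The command
`forEach i c` runs `c` for the values `0, …, n - 1` of the register `i`, where `n` is in the
register `0`. The command `odometer a p d c` runs `c` for all values in `{0, …, n}` of the first `m`
entries of the array `a`, where `m` is in the register `aDigits`; `p` and `d` are auxiliary
registers. -/
inductive Cmd
  | skip
  | setNat (a : ℕ) (i e : NatExpr)
  | setReal (a : ℕ) (i : NatExpr) (e : RealExpr)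
  | seq (c₁ c₂ : Cmd)
  | branch (b : Test) (c₁ c₂ : Cmd)
  | forEach (i : ℕ) (c : Cmd)
  | odometer (a p d : ℕ) (c : Cmd)

/-- Increase the number with the `m` digits `a 0, a 1, …` in base `n + 1` by one; if it has the
largest value, set the register `d` to one instead. -/
def incrementProgram (a p d : ℕ) : Program :=
  .seq (.setNat p (.lit 0) (.lit 0)) <|
  .seq (.loop (.conj (.neg (.natLe (reg aDigits) (reg p))) (.natLe (reg 0) (.get a (reg p))))
    (.seq (.setNat a (reg p) (.lit 0)) (.setNat p (.lit 0) (.add (reg p) (.lit 1))))) <|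
  .branch (.neg (.natLe (reg aDigits) (reg p)))
    (.setNat a (reg p) (.add (.get a (reg p)) (.lit 1)))
    (.setNat d (.lit 0) (.lit 1))

/-- Set the first `m` entries of the array `a` and the register `d` to zero. -/
def clearProgram (a p d : ℕ) : Program :=
  .seq (.setNat p (.lit 0) (.lit 0)) <|
  .seq (.loop (.neg (.natLe (reg aDigits) (reg p)))
    (.seq (.setNat a (reg p) (.lit 0)) (.setNat p (.lit 0) (.add (reg p) (.lit 1))))) <|
  .setNat d (.lit 0) (.lit 0)

/-- The program of the machine that carries out a command. -/
def Cmd.compile : Cmd → Program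
  | .skip => .skip
  | .setNat a i e => .setNat a i e
  | .setReal a i e => .setReal a i e
  | .seq c₁ c₂ => .seq c₁.compile c₂.compile
  | .branch b c₁ c₂ => .branch b c₁.compile c₂.compile
  | .forEach i c =>
      .seq (.setNat i (.lit 0) (.lit 0)) <|
      .loop (.neg (.natLe (reg 0) (reg i)))
        (.seq c.compile (.setNat i (.lit 0) (.add (reg i) (.lit 1))))
  | .odometer a p d c =>
      .seq (clearProgram a p d) <|
      .loop (.natLe (reg d) (.lit 0)) (.seq c.compile (incrementProgram a p d))

/-- The natural number arrays that a command may change. -/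
def Cmd.natWrites : Cmd → List ℕ
  | .skip => []
  | .setNat a _ _ => [a]
  | .setReal _ _ _ => []
  | .seq c₁ c₂ => c₁.natWrites ++ c₂.natWrites
  | .branch _ c₁ c₂ => c₁.natWrites ++ c₂.natWrites
  | .forEach i c => i :: c.natWrites
  | .odometer a p d c => a :: p :: d :: c.natWrites

/-- The real number arrays that a command may change. -/
def Cmd.realWrites : Cmd → List ℕ
  | .skip => []
  | .setNat _ _ _ => []
  | .setReal a _ _ => [a]
  | .seq c₁ c₂ => c₁.realWrites ++ c₂.realWrites
  | .branch _ c₁ c₂ => c₁.realWrites ++ c₂.realWrites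
  | .forEach _ c => c.realWrites
  | .odometer _ _ _ c => c.realWrites

/-- A bound on the number of steps of a command, for inputs with `n` points and odometers with `m`
digits. The constants account for the control of the loops; a step of an odometer may have to change
all digits. -/
def Cmd.cost (n m : ℕ) : Cmd → ℕ
  | .skip => 1
  | .setNat _ i e => i.cost + e.cost + 1
  | .setReal _ i e => i.cost + e.cost + 1
  | .seq c₁ c₂ => c₁.cost n m + c₂.cost n m
  | .branch b c₁ c₂ => b.cost + (c₁.cost n m + c₂.cost n m) + 1
  | .forEach _ c => n * (c.cost n m + 14) + 10
  | .odometer _ _ _ c => (n + 1) ^ m * (c.cost n m + (m * 40 + 40)) + (m * 40 + 40)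

/-- The cost of a command is polynomial in `n` as long as the number of digits is bounded. -/
theorem Cmd.exists_polynomial (m₀ : ℕ) (c : Cmd) :
    ∃ p : Polynomial ℕ, ∀ n m, m ≤ m₀ → c.cost n m ≤ p.eval n := by
  induction c with
  | skip => exact ⟨1, fun n m _ => by simp [Cmd.cost]⟩
  | setNat a i e => exact ⟨Polynomial.C (i.cost + e.cost + 1), fun n m _ => by simp [Cmd.cost]⟩
  | setReal a i e => exact ⟨Polynomial.C (i.cost + e.cost + 1), fun n m _ => by simp [Cmd.cost]⟩
  | seq c₁ c₂ h₁ h₂ =>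
    obtain ⟨p₁, h₁⟩ := h₁
    obtain ⟨p₂, h₂⟩ := h₂
    exact ⟨p₁ + p₂, fun n m hm => by
      simpa [Cmd.cost] using add_le_add (h₁ n m hm) (h₂ n m hm)⟩
  | branch b c₁ c₂ h₁ h₂ =>
    obtain ⟨p₁, h₁⟩ := h₁
    obtain ⟨p₂, h₂⟩ := h₂
    exact ⟨Polynomial.C b.cost + (p₁ + p₂) + 1, fun n m hm => by
      simpa [Cmd.cost] using add_le_add (h₁ n m hm) (h₂ n m hm)⟩
  | forEach i c h =>
    obtain ⟨p, h⟩ := h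
    refine ⟨Polynomial.X * (p + Polynomial.C 14) + Polynomial.C 10, fun n m hm => ?_⟩
    simpa only [Cmd.cost, Polynomial.eval_add, Polynomial.eval_mul, Polynomial.eval_X,
      Polynomial.eval_C] using
      Nat.add_le_add_right (Nat.mul_le_mul_left n (Nat.add_le_add_right (h n m hm) 14)) 10
  | odometer a p d c h =>
    obtain ⟨p, h⟩ := h
    refine ⟨(Polynomial.X + Polynomial.C 1) ^ m₀ * (p + Polynomial.C (m₀ * 40 + 40))
      + Polynomial.C (m₀ * 40 + 40), fun n m hm => ?_⟩
    simp only [Cmd.cost, Polynomial.eval_add, Polynomial.eval_mul, Polynomial.eval_X,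
      Polynomial.eval_C, Polynomial.eval_pow]
    have := h n m hm
    gcongr
    omega

/-! ### Total correctness with time bounds -/

@[simp] theorem Memory.setNat_nats_same (s : Memory) (a i x : ℕ) :
    (s.setNat a i x).nats a = Function.update (s.nats a) i x := by simp [Memory.setNat]

theorem Memory.setNat_nats_ne (s : Memory) {a b : ℕ} (i x : ℕ) (h : b ≠ a) :
    (s.setNat a i x).nats b = s.nats b := by simp [Memory.setNat, h]

@[simp] theorem Memory.setNat_reals (s : Memory) (a i x : ℕ) :
    (s.setNat a i x).reals = s.reals := rfl

@[simp] theorem Memory.setReal_reals_same (s : Memory) (a i : ℕ) (x : ℝ) :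
    (s.setReal a i x).reals a = Function.update (s.reals a) i x := by simp [Memory.setReal]

theorem Memory.setReal_reals_ne (s : Memory) {a b : ℕ} (i : ℕ) (x : ℝ) (h : b ≠ a) :
    (s.setReal a i x).reals b = s.reals b := by simp [Memory.setReal, h]

@[simp] theorem Memory.setReal_nats (s : Memory) (a i : ℕ) (x : ℝ) :
    (s.setReal a i x).nats = s.nats := rfl

/-- The program `c`, started in `s`, halts after at most `B` steps in a memory that satisfies
`Q`. -/
def Halts (q : ℝ) (c : Program) (s : Memory) (B : ℕ) (Q : Memory → Prop) : Prop :=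
  ∃ t s', Runs q c s t s' ∧ t ≤ B ∧ Q s'

section Halts

variable {q : ℝ} {s : Memory} {Q : Memory → Prop}

theorem Halts.mono {c : Program} {B B' : ℕ} {Q' : Memory → Prop} (h : Halts q c s B Q)
    (hB : B ≤ B') (hQ : ∀ s', Q s' → Q' s') : Halts q c s B' Q' := by
  obtain ⟨t, s', hr, ht, hq⟩ := h
  exact ⟨t, s', hr, ht.trans hB, hQ _ hq⟩

theorem Halts.setNat {a : ℕ} {i e : NatExpr} (h : Q (s.setNat a (i.eval s) (e.eval s))) :
    Halts q (.setNat a i e) s (i.cost + e.cost + 1) Q :=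
  ⟨_, _, .setNat a i e s, le_rfl, h⟩

theorem Halts.seq {c₁ c₂ : Program} {B₁ B₂ : ℕ} {R : Memory → Prop} (h₁ : Halts q c₁ s B₁ R)
    (h₂ : ∀ s', R s' → Halts q c₂ s' B₂ Q) : Halts q (.seq c₁ c₂) s (B₁ + B₂) Q := by
  obtain ⟨t₁, s₁, hr₁, ht₁, hq₁⟩ := h₁
  obtain ⟨t₂, s₂, hr₂, ht₂, hq₂⟩ := h₂ _ hq₁
  exact ⟨_, _, hr₁.seq hr₂, add_le_add ht₁ ht₂, hq₂⟩

theorem Halts.branch {b : Test} {c₁ c₂ : Program} {B : ℕ} (h₁ : b.Holds q s → Halts q c₁ s B Q)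
    (h₂ : ¬ b.Holds q s → Halts q c₂ s B Q) :
    Halts q (.branch b c₁ c₂) s (b.cost + B + 1) Q := by
  by_cases hb : b.Holds q s
  · obtain ⟨t, s', hr, ht, hq⟩ := h₁ hb
    exact ⟨_, _, .branch_true hb hr, by omega, hq⟩
  · obtain ⟨t, s', hr, ht, hq⟩ := h₂ hb
    exact ⟨_, _, .branch_false hb hr, by omega, hq⟩

/-- The rule for loops: `I` is an invariant, and `μ` decreases in each iteration. -/
theorem Halts.loop {b : Test} {c : Program} {B : ℕ} (I : Memory → Prop) (μ : Memory → ℕ)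
    (step : ∀ s, I s → b.Holds q s → Halts q c s B fun s' => I s' ∧ μ s' < μ s) (hs : I s) :
    Halts q (.loop b c) s (μ s * (b.cost + B + 1) + (b.cost + 1))
      fun s' => I s' ∧ ¬ b.Holds q s' := by
  induction hμ : μ s using Nat.strong_induction_on generalizing s with
  | _ N ih =>
    by_cases hb : b.Holds q s
    · obtain ⟨t, s', hr, ht, hq, hlt⟩ := step s hs hb
      obtain ⟨t', s'', hr', ht', hq'⟩ := ih (μ s') (hμ ▸ hlt) hq rfl
      refine ⟨_, _, .loop_true hb hr hr', ?_, hq'⟩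
      have h : (μ s' + 1) * (b.cost + B + 1) ≤ N * (b.cost + B + 1) :=
        Nat.mul_le_mul_right _ (by omega)
      rw [Nat.add_mul, Nat.one_mul] at h
      omega
    · exact ⟨_, _, .loop_false hb, by omega, hs, hb⟩

end Halts

/-- The command `c`, started in `s`, halts within its cost, changes only the arrays that it names
as written, and leads to a memory that satisfies `Q`. -/
def Does (q : ℝ) (n m : ℕ) (c : Cmd) (s : Memory) (Q : Memory → Prop) : Prop :=
  Halts q c.compile s (c.cost n m) fun s' =>
    ((∀ a, a ∉ c.natWrites → s'.nats a = s.nats a) ∧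
      ∀ a, a ∉ c.realWrites → s'.reals a = s.reals a) ∧ Q s'

section Does

variable {q : ℝ} {n m : ℕ} {s : Memory} {Q : Memory → Prop}

theorem Does.mono {c : Cmd} {Q' : Memory → Prop} (h : Does q n m c s Q)
    (hQ : ∀ s', (∀ a, a ∉ c.natWrites → s'.nats a = s.nats a) →
      (∀ a, a ∉ c.realWrites → s'.reals a = s.reals a) → Q s' → Q' s') : Does q n m c s Q' :=
  Halts.mono h le_rfl fun s' hs' => ⟨hs'.1, hQ s' hs'.1.1 hs'.1.2 hs'.2⟩

theorem Does.skip (h : Q s) : Does q n m .skip s Q :=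
  ⟨_, _, .skip s, le_rfl, ⟨fun _ _ => rfl, fun _ _ => rfl⟩, h⟩

theorem Does.setNat {a : ℕ} {i e : NatExpr} (h : Q (s.setNat a (i.eval s) (e.eval s))) :
    Does q n m (.setNat a i e) s Q := by
  refine Halts.setNat ⟨⟨fun b hb => ?_, fun _ _ => rfl⟩, h⟩
  exact Memory.setNat_nats_ne _ _ _ (by simpa [Cmd.natWrites] using hb)

theorem Does.setReal {a : ℕ} {i : NatExpr} {e : RealExpr}
    (h : Q (s.setReal a (i.eval s) (e.eval q s))) : Does q n m (.setReal a i e) s Q := by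
  refine ⟨_, _, .setReal a i e s, le_rfl, ⟨fun _ _ => rfl, fun b hb => ?_⟩, h⟩
  exact Memory.setReal_reals_ne _ _ _ (by simpa [Cmd.realWrites] using hb)

theorem Does.seq {c₁ c₂ : Cmd} (h : Does q n m c₁ s fun s' => Does q n m c₂ s' Q) :
    Does q n m (.seq c₁ c₂) s Q := by
  refine Halts.seq h fun s₁ hs₁ => Halts.mono hs₁.2 le_rfl fun s₂ hs₂ => ⟨⟨?_, ?_⟩, hs₂.2⟩
  · intro a ha
    simp only [Cmd.natWrites, List.mem_append, not_or] at ha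
    rw [hs₂.1.1 a ha.2, hs₁.1.1 a ha.1]
  · intro a ha
    simp only [Cmd.realWrites, List.mem_append, not_or] at ha
    rw [hs₂.1.2 a ha.2, hs₁.1.2 a ha.1]

theorem Does.branch {b : Test} {c₁ c₂ : Cmd} (h₁ : b.Holds q s → Does q n m c₁ s Q)
    (h₂ : ¬ b.Holds q s → Does q n m c₂ s Q) : Does q n m (.branch b c₁ c₂) s Q := by
  refine Halts.branch (fun hb => Halts.mono (h₁ hb) (by omega) fun s' hs' => ⟨⟨?_, ?_⟩, hs'.2⟩)
    fun hb => Halts.mono (h₂ hb) (by omega) fun s' hs' => ⟨⟨?_, ?_⟩, hs'.2⟩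
  all_goals
    intro a ha
    simp only [Cmd.natWrites, Cmd.realWrites, List.mem_append, not_or] at ha
  · exact hs'.1.1 a ha.1
  · exact hs'.1.2 a ha.1
  · exact hs'.1.1 a ha.2
  · exact hs'.1.2 a ha.2

/-- The rule for `forEach`: the invariant `I j` describes the memory before the run of the body
for the value `j`. -/
theorem Does.forEach {i : ℕ} {c : Cmd} (I : ℕ → Memory → Prop) (hn : s.nats 0 0 = n)
    (hi : i ∉ c.natWrites) (h0 : 0 ∉ i :: c.natWrites) (init : I 0 (s.setNat i 0 0))
    (step : ∀ j < n, ∀ s', (∀ a, a ∉ i :: c.natWrites → s'.nats a = s.nats a) →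
      (∀ a, a ∉ c.realWrites → s'.reals a = s.reals a) → s'.nats i 0 = j → I j s' →
      Does q n m c s' fun s'' => I (j + 1) (s''.setNat i 0 (j + 1))) :
    Does q n m (.forEach i c) s (I n) := by
  have hi0 : (0 : ℕ) ≠ i := fun h => h0 (by simp [← h])
  let J : Memory → Prop := fun s' =>
    ((∀ a, a ∉ i :: c.natWrites → s'.nats a = s.nats a) ∧
      ∀ a, a ∉ c.realWrites → s'.reals a = s.reals a) ∧ s'.nats i 0 ≤ n ∧ I (s'.nats i 0) s'
  have hJ : ∀ s', J s' → s'.nats 0 0 = n := fun s' h => by rw [h.1.1 0 h0, hn]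
  have main := Halts.loop (q := q) (s := s.setNat i 0 0)
    (b := .neg (.natLe (reg 0) (reg i)))
    (c := .seq c.compile (.setNat i (.lit 0) (.add (reg i) (.lit 1))))
    (B := c.cost n m + 6) J (fun s' => n - s'.nats i 0) ?_ ?_
  · refine Halts.mono (Halts.seq (B₂ := n * (c.cost n m + 14) + 7)
      (Halts.setNat (Q := fun s' => s' = s.setNat i 0 0) rfl) fun s' hs' => ?_) ?_ fun _ h => h
    · subst hs'
      refine Halts.mono main ?_ fun s' hs' => ?_
      · simp only [Memory.setNat_nats_same, Function.update_self, Nat.sub_zero, Test.cost,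
          NatExpr.cost]
        ring_nf
        omega
      · obtain ⟨⟨h1, h2, h3⟩, h4⟩ := hs'
        simp only [Test.Holds, NatExpr.eval, not_not, hJ s' ⟨h1, h2, h3⟩] at h4
        rw [le_antisymm h2 h4] at h3
        exact ⟨h1, h3⟩
    · simp only [Cmd.cost, NatExpr.cost]
      omega
  · intro s' hs' hb
    simp only [Test.Holds, NatExpr.eval, hJ s' hs', not_le] at hb
    obtain ⟨⟨h1, h1'⟩, h2, h3⟩ := hs'
    refine Halts.mono (Halts.seq (step _ hb s' h1 h1' rfl h3) fun s₁ hs₁ =>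
      Halts.setNat (Q := fun s₂ => J s₂ ∧ n - s₂.nats i 0 < n - s'.nats i 0) ?_) ?_ fun _ h => h
    · have e : NatExpr.eval s₁ (.add (reg i) (.lit 1)) = s'.nats i 0 + 1 := by
        simp [NatExpr.eval, hs₁.1.1 i hi]
      rw [e]
      simp only [NatExpr.eval]
      refine ⟨⟨⟨fun a ha => ?_, fun a ha => ?_⟩, ?_, ?_⟩, ?_⟩
      · have ha' := ha
        rw [List.mem_cons, not_or] at ha'
        rw [Memory.setNat_nats_ne _ _ _ ha'.1, hs₁.1.1 a ha'.2, h1 a ha]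
      · rw [Memory.setNat_reals, hs₁.1.2 a ha, h1' a ha]
      · simpa using hb
      · simpa using hs₁.2
      · simp only [Memory.setNat_nats_same, Function.update_self]
        omega
    · simp only [NatExpr.cost]
      omega
  · refine ⟨⟨fun a ha => ?_, fun a _ => rfl⟩, by simp, by simpa using init⟩
    rw [List.mem_cons, not_or] at ha
    rw [Memory.setNat_nats_ne _ _ _ ha.1]

end Does

/-! ### Counting in base `n + 1` -/

section

/-- If adding one to `t` carries over the lowest `j` digits in base `b` and the next digit is the
largest one, it carries over that digit, too. -/
theorem dvd_succ_of_digit_eq {b t j : ℕ} (hb : 0 < b) (h : b ^ j ∣ t + 1)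
    (hd : b ≤ t / b ^ j % b + 1) : b ^ (j + 1) ∣ t + 1 := by
  obtain ⟨w, hw⟩ := h
  obtain ⟨v, rfl⟩ : ∃ v, w = v + 1 := ⟨w - 1, by
    rcases w with _ | w
    · simp at hw
    · rfl⟩
  have hpos : 0 < b ^ j := pow_pos hb j
  have hv : t / b ^ j = v := by
    apply Nat.div_eq_of_lt_le <;> · have : b ^ j * (v + 1) = b ^ j * v + b ^ j := by ring
                                    nlinarith
  rw [hv] at hd
  have h1 : v % b < b := Nat.mod_lt _ hb
  have h2 := Nat.div_add_mod v b
  rw [hw, pow_succ]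
  refine mul_dvd_mul_left _ ⟨v / b + 1, ?_⟩
  rw [mul_add, mul_one]
  omega

/-- If adding one to `t` carries over the lowest `j` digits in base `b` and the next digit is not
the largest one, that digit increases and the higher digits stay. -/
theorem digits_succ_of_lt {b t j : ℕ} (hb : 0 < b) (h : b ^ j ∣ t + 1)
    (hd : t / b ^ j % b + 1 < b) :
    (t + 1) / b ^ j % b = t / b ^ j % b + 1 ∧
      ∀ i, j < i → (t + 1) / b ^ i % b = t / b ^ i % b := by
  obtain ⟨w, hw⟩ := h
  obtain ⟨v, rfl⟩ : ∃ v, w = v + 1 := ⟨w - 1, by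
    rcases w with _ | w
    · simp at hw
    · rfl⟩
  have hpos : 0 < b ^ j := pow_pos hb j
  have hv : t / b ^ j = v := by
    apply Nat.div_eq_of_lt_le <;> · have : b ^ j * (v + 1) = b ^ j * v + b ^ j := by ring
                                    nlinarith
  have hv' : (t + 1) / b ^ j = v + 1 := by rw [hw]; exact Nat.mul_div_cancel_left _ hpos
  rw [hv] at hd
  have h2 := Nat.div_add_mod v b
  have key : (v + 1) / b = v / b ∧ (v + 1) % b = v % b + 1 :=
    (Nat.div_mod_unique hb).2 ⟨by omega, hd⟩
  refine ⟨by rw [hv, hv', key.2], fun i hi => ?_⟩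
  obtain ⟨l, rfl⟩ : ∃ l, i = j + 1 + l := ⟨i - (j + 1), by omega⟩
  rw [pow_add, pow_succ, ← Nat.div_div_eq_div_mul, ← Nat.div_div_eq_div_mul, hv', key.1,
    ← Nat.div_div_eq_div_mul, ← Nat.div_div_eq_div_mul, hv]

theorem digit_eq_zero_of_dvd {b t i j : ℕ} (hb : 0 < b) (h : b ^ j ∣ t) (hi : i < j) :
    t / b ^ i % b = 0 := by
  obtain ⟨w, rfl⟩ := h
  obtain ⟨l, rfl⟩ : ∃ l, j = i + 1 + l := ⟨j - (i + 1), by omega⟩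
  rw [pow_add, pow_succ, mul_assoc, mul_assoc, Nat.mul_div_cancel_left _ (pow_pos hb i)]
  exact Nat.mul_mod_right _ _

/-- Every sequence of digits is the expansion of a number. -/
theorem exists_digits (b m : ℕ) (f : ℕ → ℕ) (hf : ∀ i < m, f i < b) :
    ∃ t < b ^ m, ∀ i < m, t / b ^ i % b = f i := by
  induction m generalizing f with
  | zero => exact ⟨0, by simp, by simp⟩
  | succ m ih =>
    obtain ⟨t, ht, h⟩ := ih (fun i => f (i + 1)) fun i hi => hf _ (by omega)
    have h0 := hf 0 (by omega)
    refine ⟨b * t + f 0, ?_, fun i hi => ?_⟩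
    · rw [pow_succ]
      nlinarith
    · rcases i with _ | i
      · simp [Nat.mod_eq_of_lt h0]
      · rw [pow_succ', ← Nat.div_div_eq_div_mul, Nat.mul_add_div (by omega),
          Nat.div_eq_of_lt h0, add_zero, h i (by omega)]

variable {q : ℝ} {n m : ℕ} {s : Memory}

/-- The memories `s` and `s'` differ only in the natural number arrays `a`, `p` and `d`. -/
def AgreeOff (a p d : ℕ) (s s' : Memory) : Prop :=
  (∀ b, b ∉ [a, p, d] → s'.nats b = s.nats b) ∧ s'.reals = s.reals

theorem AgreeOff.refl (a p d : ℕ) (s : Memory) : AgreeOff a p d s s := ⟨fun _ _ => rfl, rfl⟩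

theorem AgreeOff.setNat {a p d : ℕ} {s₁ s₂ : Memory} (h : AgreeOff a p d s₁ s₂) {b : ℕ}
    (hb : b ∈ [a, p, d]) (i x : ℕ) : AgreeOff a p d s₁ (s₂.setNat b i x) :=
  ⟨fun b' hb' => by
    have hne : b' ≠ b := fun e => hb' (by rw [e]; exact hb)
    rw [Memory.setNat_nats_ne _ _ _ hne, h.1 b' hb'], h.2⟩

theorem halts_clearProgram {a p d : ℕ} (hm : s.nats aDigits 0 = m)
    (hnd : [0, aDigits, a, p, d].Nodup) :
    Halts q (clearProgram a p d) s (m * 17 + 13) fun s' =>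
      AgreeOff a p d s s' ∧ s'.nats d 0 = 0 ∧ ∀ i < m, s'.nats a i = 0 := by
  simp only [List.nodup_cons, List.mem_cons, List.not_mem_nil, or_false, not_or,
    List.nodup_nil, not_false_eq_true, and_true] at hnd
  obtain ⟨⟨-, h0a, h0p, h0d⟩, ⟨hma, hmp, hmd⟩, ⟨hap, had⟩, hpd⟩ := hnd
  have hM : ∀ s', AgreeOff a p d s s' → s'.nats aDigits 0 = m := fun s' h => by
    rw [h.1 _ (by simp [hma, hmp, hmd]), hm]
  let I : Memory → Prop := fun s' =>
    AgreeOff a p d s s' ∧ s'.nats p 0 ≤ m ∧ ∀ i < s'.nats p 0, s'.nats a i = 0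
  refine Halts.mono (B := 3 + (m * 17 + 7 + 3)) (Halts.seq (Halts.setNat (Q := fun s' =>
    I s' ∧ s'.nats p 0 = 0) ?_) fun s₁ hs₁ => Halts.seq (R := fun s' => I s' ∧ m ≤ s'.nats p 0)
      ?_ fun s₂ hs₂ => Halts.setNat ?_) (by omega) fun _ h => h
  · simp only [NatExpr.eval, I]
    exact ⟨⟨(AgreeOff.refl a p d s).setNat (by simp) _ _, by simp, by simp⟩, by simp⟩
  · have main := Halts.loop (q := q) (s := s₁) (b := .neg (.natLe (reg aDigits) (reg p)))
      (c := .seq (.setNat a (reg p) (.lit 0)) (.setNat p (.lit 0) (.add (reg p) (.lit 1))))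
      (B := 10) I (fun s' => m - s'.nats p 0) ?_ hs₁.1
    · refine Halts.mono main ?_ fun s' hs' => ?_
      · simp only [Test.cost, NatExpr.cost, hs₁.2]
        omega
      · refine ⟨hs'.1, ?_⟩
        simpa [Test.Holds, NatExpr.eval, hM s' hs'.1.1] using hs'.2
    · intro s' hs' hb
      simp only [Test.Holds, NatExpr.eval, hM s' hs'.1, not_le] at hb
      refine Halts.seq (B₁ := 4) (B₂ := 6) (Halts.setNat (Q := fun s'' =>
        s'' = s'.setNat a (s'.nats p 0) 0) rfl) fun s'' hs'' => Halts.setNat ?_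
      subst hs''
      simp only [NatExpr.eval, Memory.setNat_nats_ne _ _ _ (Ne.symm hap), I]
      refine ⟨⟨(hs'.1.setNat (by simp) _ _).setNat (by simp) _ _, by simpa using hb,
        fun i hi => ?_⟩, by simp; omega⟩
      simp only [Memory.setNat_nats_same, Function.update_self] at hi
      rw [Memory.setNat_nats_ne _ _ _ hap, Memory.setNat_nats_same]
      by_cases hip : i = s'.nats p 0
      · simp [hip]
      · rw [Function.update_of_ne hip]
        exact hs'.2.2 i (by omega)
  · obtain ⟨⟨h1, h2, h3⟩, h4⟩ := hs₂
    simp only [NatExpr.eval]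
    refine ⟨h1.setNat (by simp) _ _, by simp, fun i hi => ?_⟩
    rw [Memory.setNat_nats_ne _ _ _ had]
    exact h3 i (by omega)

theorem halts_incrementProgram {a p d t : ℕ} (hn : s.nats 0 0 = n) (hm : s.nats aDigits 0 = m)
    (hnd : [0, aDigits, a, p, d].Nodup) (ht : t < (n + 1) ^ m)
    (hdig : ∀ i < m, s.nats a i = t / (n + 1) ^ i % (n + 1)) :
    Halts q (incrementProgram a p d) s (m * 24 + 32) fun s' => AgreeOff a p d s s' ∧
      ((t + 1 < (n + 1) ^ m ∧ s'.nats d 0 = s.nats d 0 ∧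
          ∀ i < m, s'.nats a i = (t + 1) / (n + 1) ^ i % (n + 1)) ∨
        (t + 1 = (n + 1) ^ m ∧ s'.nats d 0 = 1)) := by
  simp only [List.nodup_cons, List.mem_cons, List.not_mem_nil, or_false, not_or,
    List.nodup_nil, not_false_eq_true, and_true] at hnd
  obtain ⟨⟨-, h0a, h0p, h0d⟩, ⟨hma, hmp, hmd⟩, ⟨hap, had⟩, hpd⟩ := hnd
  have hM : ∀ s', AgreeOff a p d s s' → s'.nats aDigits 0 = m := fun s' h => by
    rw [h.1 _ (by simp [hma, hmp, hmd]), hm]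
  have hN : ∀ s', AgreeOff a p d s s' → s'.nats 0 0 = n := fun s' h => by
    rw [h.1 _ (by simp [h0a, h0p, h0d]), hn]
  -- the digits below position `p` have been set to zero, and the carry has reached position `p`
  let I : Memory → Prop := fun s' =>
    AgreeOff a p d s s' ∧ s'.nats d 0 = s.nats d 0 ∧ s'.nats p 0 ≤ m ∧
      (n + 1) ^ s'.nats p 0 ∣ t + 1 ∧ (∀ i < s'.nats p 0, s'.nats a i = 0) ∧
      ∀ i, s'.nats p 0 ≤ i → i < m → s'.nats a i = t / (n + 1) ^ i % (n + 1)
  refine Halts.mono (B := 3 + (m * 24 + 14 + (6 + 8 + 1))) (Halts.seq (Halts.setNat (Q := fun s' =>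
    I s' ∧ s'.nats p 0 = 0) ?_) fun s₁ hs₁ => Halts.seq (R := fun s' => I s' ∧
      (s'.nats p 0 < m → s'.nats a (s'.nats p 0) < n))
      ?_ fun s₂ hs₂ => Halts.branch (B := 8) (fun hb => Halts.setNat ?_)
        fun hb => Halts.mono (Halts.setNat (Q := fun s' => AgreeOff a p d s s' ∧
          t + 1 = (n + 1) ^ m ∧ s'.nats d 0 = 1) ?_) ?_ ?_) (by omega) fun _ h => h
  · simp only [NatExpr.eval, I]
    refine ⟨⟨(AgreeOff.refl a p d s).setNat (by simp) _ _, ?_, by simp, by simp, by simp, ?_⟩,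
      by simp⟩
    · rw [Memory.setNat_nats_ne _ _ _ (Ne.symm hpd)]
    · intro i _ hi
      rw [Memory.setNat_nats_ne _ _ _ hap, hdig i hi]
  · have main := Halts.loop (q := q) (s := s₁)
      (b := .conj (.neg (.natLe (reg aDigits) (reg p))) (.natLe (reg 0) (.get a (reg p))))
      (c := .seq (.setNat a (reg p) (.lit 0)) (.setNat p (.lit 0) (.add (reg p) (.lit 1))))
      (B := 10) I (fun s' => m - s'.nats p 0) ?_ hs₁.1
    · refine Halts.mono main ?_ fun s' hs' => ?_
      · simp only [Test.cost, NatExpr.cost, hs₁.2]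
        omega
      · refine ⟨hs'.1, ?_⟩
        simpa [Test.Holds, NatExpr.eval, hM s' hs'.1.1, hN s' hs'.1.1] using hs'.2
    · intro s' hs' hb
      simp only [Test.Holds, NatExpr.eval, hM s' hs'.1, hN s' hs'.1, not_le] at hb
      obtain ⟨h1, h2, h3, h4, h5, h6⟩ := hs'
      refine Halts.seq (B₁ := 4) (B₂ := 6) (Halts.setNat (Q := fun s'' =>
        s'' = s'.setNat a (s'.nats p 0) 0) rfl) fun s'' hs'' => Halts.setNat ?_
      subst hs''
      simp only [NatExpr.eval, Memory.setNat_nats_ne _ _ _ (Ne.symm hap), I]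
      refine ⟨⟨(h1.setNat (by simp) _ _).setNat (by simp) _ _, ?_, by simpa using hb.1, ?_,
        fun i hi => ?_, fun i hi him => ?_⟩, by simp; omega⟩
      · rw [Memory.setNat_nats_ne _ _ _ (Ne.symm hpd), Memory.setNat_nats_ne _ _ _ (Ne.symm had),
          h2]
      · simp only [Memory.setNat_nats_same, Function.update_self]
        refine dvd_succ_of_digit_eq (Nat.succ_pos n) h4 ?_
        rw [← h6 _ le_rfl hb.1]
        omega
      · simp only [Memory.setNat_nats_same, Function.update_self] at hi
        rw [Memory.setNat_nats_ne _ _ _ hap, Memory.setNat_nats_same]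
        by_cases hip : i = s'.nats p 0
        · simp [hip]
        · rw [Function.update_of_ne hip]
          exact h5 i (by omega)
      · simp only [Memory.setNat_nats_same, Function.update_self] at hi
        rw [Memory.setNat_nats_ne _ _ _ hap, Memory.setNat_nats_same,
          Function.update_of_ne (by omega), h6 i (by omega) him]
  · obtain ⟨⟨h1, h2, h3, h4, h5, h6⟩, h7⟩ := hs₂
    simp only [Test.Holds, NatExpr.eval, hM s₂ h1, not_le] at hb
    simp only [NatExpr.eval]
    have h8 := h7 hb
    have h9 := h6 _ le_rfl hb
    have hlt : t / (n + 1) ^ s₂.nats p 0 % (n + 1) + 1 < n + 1 := by omega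
    obtain ⟨h10, h11⟩ := digits_succ_of_lt (Nat.succ_pos n) h4 hlt
    refine ⟨h1.setNat (by simp) _ _, Or.inl ⟨?_, ?_, fun i hi => ?_⟩⟩
    · refine lt_of_le_of_ne ht fun e => ?_
      rw [e, digit_eq_zero_of_dvd (Nat.succ_pos n) dvd_rfl hb] at h10
      omega
    · rw [Memory.setNat_nats_ne _ _ _ (Ne.symm had), h2]
    · rw [Memory.setNat_nats_same]
      rcases lt_trichotomy i (s₂.nats p 0) with h | h | h
      · rw [Function.update_of_ne (by omega), h5 i h,
          digit_eq_zero_of_dvd (Nat.succ_pos n) h4 h]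
      · rw [h, Function.update_self, h9, h10]
      · rw [Function.update_of_ne (by omega), h6 i h.le hi, h11 i h]
  · obtain ⟨⟨h1, h2, h3, h4, h5, h6⟩, h7⟩ := hs₂
    simp only [Test.Holds, NatExpr.eval, hM s₂ h1, not_not] at hb
    simp only [NatExpr.eval]
    rw [le_antisymm h3 hb] at h4
    exact ⟨h1.setNat (by simp) _ _, le_antisymm ht (Nat.le_of_dvd (Nat.succ_pos t) h4), by simp⟩
  · simp [NatExpr.cost]
  · exact fun s' h => ⟨h.1, Or.inr h.2⟩

/-- The rule for odometers: the body is run for every `t < (n + 1) ^ m`, with the digits of `t` in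
base `n + 1` in the array `a`. The invariant must not depend on the arrays `a`, `p` and `d`, which
change between the runs of the body. -/
theorem Does.odometer {a p d : ℕ} {c : Cmd} (I : ℕ → Memory → Prop) (hn : s.nats 0 0 = n)
    (hm : s.nats aDigits 0 = m) (hnd : [0, aDigits, a, p, d].Nodup)
    (hw : ∀ b ∈ [0, aDigits, a, p, d], b ∉ c.natWrites)
    (stable : ∀ t s₁ s₂, AgreeOff a p d s₁ s₂ → I t s₁ → I t s₂) (init : I 0 s)
    (step : ∀ t < (n + 1) ^ m, ∀ s',
      (∀ b, b ∉ a :: p :: d :: c.natWrites → s'.nats b = s.nats b) →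
      (∀ b, b ∉ c.realWrites → s'.reals b = s.reals b) →
      (∀ i < m, s'.nats a i = t / (n + 1) ^ i % (n + 1)) → I t s' →
      Does q n m c s' (I (t + 1))) :
    Does q n m (.odometer a p d c) s (I ((n + 1) ^ m)) := by
  have hnd' := hnd
  simp only [List.nodup_cons, List.mem_cons, List.not_mem_nil, or_false, not_or,
    List.nodup_nil, not_false_eq_true, and_true] at hnd'
  obtain ⟨⟨-, h0a, h0p, h0d⟩, ⟨hma, hmp, hmd⟩, ⟨hap, had⟩, hpd⟩ := hnd'
  let F : Memory → Prop := fun s' =>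
    (∀ b, b ∉ a :: p :: d :: c.natWrites → s'.nats b = s.nats b) ∧
      ∀ b, b ∉ c.realWrites → s'.reals b = s.reals b
  have hF : ∀ s₁ s₂, F s₁ → AgreeOff a p d s₁ s₂ → F s₂ := fun s₁ s₂ h h' =>
    ⟨fun b hb => by
      rw [h'.1 b (fun e => hb (by
        simp only [List.mem_cons, List.not_mem_nil, or_false] at e ⊢; tauto)), h.1 b hb],
      fun b hb => by rw [h'.2, h.2 b hb]⟩
  have hM : ∀ s', F s' → s'.nats aDigits 0 = m := fun s' h => by
    rw [h.1 _ (by simp [hma, hmp, hmd, hw aDigits (by simp)]), hm]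
  have hN : ∀ s', F s' → s'.nats 0 0 = n := fun s' h => by
    rw [h.1 _ (by simp [h0a, h0p, h0d, hw 0 (by simp)]), hn]
  let J : ℕ → Memory → Prop := fun t s' => F s' ∧ I t s' ∧
    ((t < (n + 1) ^ m ∧ s'.nats d 0 = 0 ∧ ∀ i < m, s'.nats a i = t / (n + 1) ^ i % (n + 1)) ∨
      (t = (n + 1) ^ m ∧ s'.nats d 0 = 1))
  have main : ∀ l t s₁, t + l = (n + 1) ^ m → J t s₁ →
      Halts q (.loop (.natLe (reg d) (.lit 0)) (.seq c.compile (incrementProgram a p d))) s₁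
        (l * (c.cost n m + (m * 40 + 40)) + 5) (J ((n + 1) ^ m)) := by
    intro l
    induction l with
    | zero =>
      intro t s₁ htl hJ
      rw [add_zero] at htl
      subst htl
      have hd : s₁.nats d 0 = 1 := by
        rcases hJ.2.2 with h | h
        · exact absurd h.1 (lt_irrefl _)
        · exact h.2
      exact ⟨_, _, .loop_false (by simp [Test.Holds, NatExpr.eval, hd]),
        by simp [Test.cost, NatExpr.cost], hJ⟩
    | succ l ih =>
      intro t s₁ htl hJ
      have hlt : t < (n + 1) ^ m := by omega
      obtain ⟨hf, hI, h | h⟩ := hJ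
      swap
      · omega
      obtain ⟨-, hd, hdig⟩ := h
      have body : Halts q (.seq c.compile (incrementProgram a p d)) s₁
          (c.cost n m + (m * 24 + 32)) (J (t + 1)) := by
        refine Halts.seq (step t hlt s₁ hf.1 hf.2 hdig hI) fun s₂ hs₂ => ?_
        have hF₂ : F s₂ := ⟨fun b hb => by
          rw [hs₂.1.1 b (fun e => hb (by simp [e])), hf.1 b hb],
          fun b hb => by rw [hs₂.1.2 b hb, hf.2 b hb]⟩
        refine Halts.mono (halts_incrementProgram (hN s₂ hF₂) (hM s₂ hF₂) hnd hlt
          (fun i hi => by rw [hs₂.1.1 a (hw a (by simp)), hdig i hi])) le_rfl fun s₃ hs₃ => ?_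
        refine ⟨hF _ _ hF₂ hs₃.1, stable _ _ _ hs₃.1 hs₂.2, ?_⟩
        rw [hs₂.1.1 d (hw d (by simp)), hd] at hs₃
        exact hs₃.2
      obtain ⟨t₁, s₂, hr, ht, hq⟩ := body
      obtain ⟨t₂, s₃, hr', ht', hq'⟩ := ih (t + 1) s₂ (by omega) hq
      refine ⟨_, _, .loop_true (by simp [Test.Holds, NatExpr.eval, hd]) hr hr', ?_, hq'⟩
      simp only [Test.cost, NatExpr.cost, Nat.add_mul, Nat.one_mul] at ht' ⊢
      omega
  refine Halts.mono (B := m * 17 + 13 + ((n + 1) ^ m * (c.cost n m + (m * 40 + 40)) + 5))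
    (Halts.seq (halts_clearProgram hm hnd) fun s₁ hs₁ => main _ 0 s₁ (by simp)
      ⟨hF s _ ⟨fun _ _ => rfl, fun _ _ => rfl⟩ hs₁.1, stable _ _ _ hs₁.1 init,
        Or.inl ⟨by positivity, hs₁.2.1, fun i hi => by simp [hs₁.2.2 i hi]⟩⟩)
    (by simp only [Cmd.cost]; omega) fun s' hs' => ⟨hs'.1, hs'.2.1⟩

end

/-! ### Loops that accumulate sums and fill arrays -/

section

/-- Add up, in the natural number register `a`, what `c` contributes for each value of `i`. -/
def sumNatCmd (i a : ℕ) (c : Cmd) : Cmd := .seq (.setNat a (.lit 0) (.lit 0)) (.forEach i c)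

/-- Add up, in the real number register `a`, what `c` contributes for each value of `i`. -/
def sumRealCmd (i a : ℕ) (c : Cmd) : Cmd :=
  .seq (.setReal a (.lit 0) (.ofNat (.lit 0))) (.forEach i c)

section Loops

variable {q : ℝ} {n m : ℕ} {s : Memory}

/-! In the rules for these loops, the body may use what the arrays outside its list of written
arrays held at the start of the loop. -/

theorem sum_ite_lt_succ {M : Type*} [AddCommMonoid M] (f : Fin n → M) {j : ℕ} (hj : j < n) :
    (∑ v : Fin n, if (v : ℕ) < j + 1 then f v else 0) =
      (∑ v : Fin n, if (v : ℕ) < j then f v else 0) + f ⟨j, hj⟩ := by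
  have : f ⟨j, hj⟩ = ∑ v : Fin n, if v = ⟨j, hj⟩ then f v else 0 := by simp
  rw [this, ← Finset.sum_add_distrib]
  refine Finset.sum_congr rfl fun v _ => ?_
  simp only [Fin.ext_iff]
  rcases lt_trichotomy (v : ℕ) j with h | h | h
  · simp [h, h.ne, h.trans (Nat.lt_succ_self j)]
  · simp [h]
  · simp [h.ne', not_lt.2 h.le, show ¬ (v : ℕ) < j + 1 by omega]

theorem Does.sumNat {i a : ℕ} {c : Cmd} (f : Fin n → ℕ) (hn : s.nats 0 0 = n)
    (hi : i ∉ c.natWrites) (h0 : 0 ∉ i :: a :: c.natWrites) (hai : a ≠ i)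
    (step : ∀ j : Fin n, ∀ s', (∀ b, b ∉ i :: a :: c.natWrites → s'.nats b = s.nats b) →
      (∀ b, b ∉ c.realWrites → s'.reals b = s.reals b) → s'.nats i 0 = (j : ℕ) →
      Does q n m c s' fun s'' => s''.nats a 0 = s'.nats a 0 + f j) :
    Does q n m (sumNatCmd i a c) s fun s' => s'.nats a 0 = ∑ j, f j := by
  simp only [List.mem_cons, not_or] at h0
  refine Does.seq (Does.setNat ?_)
  refine (Does.forEach (fun j s' => s'.nats a 0 = ∑ v : Fin n, if (v : ℕ) < j then f v else 0)
    ?_ hi (by simp [h0]) ?_ ?_).mono fun s' _ _ h => ?_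
  · rw [Memory.setNat_nats_ne _ _ _ h0.2.1, hn]
  · rw [Memory.setNat_nats_ne _ _ _ hai]
    simp [NatExpr.eval]
  · intro j hj s' h1 h2 h3 h4
    refine (step ⟨j, hj⟩ s' (fun b hb => ?_) h2 h3).mono fun s'' _ _ h => ?_
    · simp only [List.mem_cons, not_or] at hb
      rw [h1 b (by simp [hb]), Memory.setNat_nats_ne _ _ _ hb.2.1]
    · rw [Memory.setNat_nats_ne _ _ _ hai, h, h4, sum_ite_lt_succ f hj]
  · simp [h]

theorem Does.addReal {i a : ℕ} {c : Cmd} (f : Fin n → ℝ) (hn : s.nats 0 0 = n)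
    (hi : i ∉ c.natWrites) (h0 : 0 ∉ i :: c.natWrites)
    (step : ∀ j : Fin n, ∀ s', (∀ b, b ∉ i :: c.natWrites → s'.nats b = s.nats b) →
      (∀ b, b ∉ c.realWrites → s'.reals b = s.reals b) → s'.nats i 0 = (j : ℕ) →
      Does q n m c s' fun s'' => s''.reals a 0 = s'.reals a 0 + f j) :
    Does q n m (.forEach i c) s fun s' => s'.reals a 0 = s.reals a 0 + ∑ j, f j := by
  refine (Does.forEach (fun j s' => s'.reals a 0 = s.reals a 0 +
    ∑ v : Fin n, if (v : ℕ) < j then f v else 0) hn hi h0 (by simp) ?_).mono fun s' _ _ h => ?_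
  · intro j hj s' h1 h2 h3 h4
    refine (step ⟨j, hj⟩ s' h1 h2 h3).mono fun s'' _ _ h => ?_
    rw [Memory.setNat_reals, h, h4, sum_ite_lt_succ f hj, add_assoc]
  · simp [h]

theorem Does.sumReal {i a : ℕ} {c : Cmd} (f : Fin n → ℝ) (hn : s.nats 0 0 = n)
    (hi : i ∉ c.natWrites) (h0 : 0 ∉ i :: c.natWrites)
    (step : ∀ j : Fin n, ∀ s', (∀ b, b ∉ i :: c.natWrites → s'.nats b = s.nats b) →
      (∀ b, b ∉ a :: c.realWrites → s'.reals b = s.reals b) → s'.nats i 0 = (j : ℕ) →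
      Does q n m c s' fun s'' => s''.reals a 0 = s'.reals a 0 + f j) :
    Does q n m (sumRealCmd i a c) s fun s' => s'.reals a 0 = ∑ j, f j := by
  refine Does.seq (Does.setReal ?_)
  refine (Does.addReal (s := s.setReal a 0 ((0 : ℕ) : ℝ)) f hn hi h0 fun j s' h1 h2 h3 =>
    step j s' h1 (fun b hb => ?_) h3).mono fun s' _ _ h => ?_
  · simp only [List.mem_cons, not_or] at hb
    rw [h2 b hb.2, Memory.setReal_reals_ne _ _ _ hb.1]
  · simpa [RealExpr.eval, NatExpr.eval] using h

theorem Does.fill {i a : ℕ} {c : Cmd} (f : Fin n → ℕ) (hn : s.nats 0 0 = n)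
    (hi : i ∉ c.natWrites) (h0 : 0 ∉ i :: c.natWrites) (hai : a ≠ i)
    (step : ∀ j : Fin n, ∀ s', (∀ b, b ∉ i :: c.natWrites → s'.nats b = s.nats b) →
      (∀ b, b ∉ c.realWrites → s'.reals b = s.reals b) → s'.nats i 0 = (j : ℕ) →
      Does q n m c s' fun s'' => s''.nats a = Function.update (s'.nats a) j (f j)) :
    Does q n m (.forEach i c) s fun s' => ∀ j : Fin n, s'.nats a j = f j := by
  refine (Does.forEach (fun j s' => ∀ v : Fin n, (v : ℕ) < j → s'.nats a v = f v) hn hi h0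
    (by simp) ?_).mono fun s' _ _ h v => h v v.2
  intro j hj s' h1 h2 h3 h4
  refine (step ⟨j, hj⟩ s' h1 h2 h3).mono fun s'' _ _ h v hv => ?_
  rw [Memory.setNat_nats_ne _ _ _ hai, h]
  by_cases hvj : (v : ℕ) = j
  · obtain rfl : v = ⟨j, hj⟩ := Fin.ext hvj
    simp
  · simp only
    rw [Function.update_of_ne hvj]
    exact h4 v (by omega)

end Loops

/-! ### Access to the input

The memory is laid out as follows. The names that begin with `i` are registers for points, those
that begin with `a` are other arrays of natural numbers, and those that begin with `r` are arrays
of real numbers. The arrays of natural numbers `0`, `1` and `2` and the arrays of real numbers `0`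
and `1` are those of the input and the output; `19`, `20`, `21` and `22` are auxiliary registers
of odometers. Facts about which arrays a command leaves unchanged are instantiated with the
numbers. -/

notation "aRow" => (3 : ℕ)
notation "iU" => (4 : ℕ)
notation "iV" => (5 : ℕ)
notation "iZ" => (6 : ℕ)
notation "aCenter" => (7 : ℕ)
notation "aCluster" => (8 : ℕ)
notation "aRank" => (9 : ℕ)
notation "aClusters" => (10 : ℕ)
notation "aLeader" => (11 : ℕ)
notation "aQuota" => (13 : ℕ)
notation "aSubquota" => (14 : ℕ)
notation "aChosen" => (15 : ℕ)
notation "aLeft" => (16 : ℕ)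
notation "aRight" => (17 : ℕ)
notation "aCounter" => (18 : ℕ)
notation "rScale" => (2 : ℕ)
notation "rAcc" => (3 : ℕ)
notation "rConst" => (4 : ℕ)
notation "rValue" => (5 : ℕ)
notation "rBest" => (6 : ℕ)

/-- The distance between the points in the registers `i` and `j`. -/
def distExpr (i j : ℕ) : RealExpr := .get 1 (.add (.get aRow (reg i)) (reg j))

variable {X : Type} [PseudoMetricSpace X] {n k m : ℕ} {e : Fin n ≃ X} {q ε : ℝ} {s : Memory}

/-- The memory holds the input, together with the positions of the rows of the matrix. -/
structure HoldsInput (e : Fin n ≃ X) (k : ℕ) (ε : ℝ) (s : Memory) : Prop where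
  points : s.nats 0 0 = n
  size : s.nats 1 0 = k
  eps : s.reals 0 0 = ε
  row : ∀ i : Fin n, s.nats aRow i = i * n
  entry : ∀ i j : Fin n, s.reals 1 (i * n + j) = dist (e i) (e j)

theorem HoldsInput.of_eq {s' : Memory} (h : HoldsInput e k ε s) (h0 : s'.nats 0 = s.nats 0)
    (h1 : s'.nats 1 = s.nats 1) (h3 : s'.nats aRow = s.nats aRow) (r0 : s'.reals 0 = s.reals 0)
    (r1 : s'.reals 1 = s.reals 1) : HoldsInput e k ε s' :=
  ⟨by rw [h0, h.points], by rw [h1, h.size], by rw [r0, h.eps], fun i => by rw [h3, h.row],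
    fun i j => by rw [r1, h.entry]⟩

theorem HoldsInput.eval_dist (h : HoldsInput e k ε s) {a b : ℕ} {i j : Fin n}
    (hi : s.nats a 0 = i) (hj : s.nats b 0 = j) :
    (distExpr a b).eval q s = dist (e i) (e j) := by
  simp [distExpr, RealExpr.eval, NatExpr.eval, hi, hj, h.row, h.entry]

theorem HoldsInput.eval_pow (h : HoldsInput e k ε s) {a b : ℕ} {i j : Fin n}
    (hi : s.nats a 0 = i) (hj : s.nats b 0 = j) :
    (RealExpr.pow (distExpr a b)).eval q s = dist (e i) (e j) ^ q := by
  rw [RealExpr.eval, h.eval_dist hi hj, max_eq_left dist_nonneg]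

/-- Compute the positions of the rows of the distance matrix. -/
def rowsCmd : Cmd :=
  .forEach iU (.setNat aRow (.add (reg iU) (.lit 1)) (.add (.get aRow (reg iU)) (reg 0)))

theorem does_rowsCmd (ε : ℝ) : Does q n m rowsCmd (inputMemory e k ε) (HoldsInput e k ε) := by
  refine (Does.forEach (fun j s' => ∀ i ≤ j, s'.nats aRow i = i * n) (by simp [inputMemory])
    (by decide) (by decide) ?_ ?_).mono fun s' h1 h2 h3 => ?_
  · intro i hi
    simp [Nat.le_zero.1 hi, Memory.setNat, inputMemory]
  · intro j hj s' h1 h2 h3 h4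
    refine Does.setNat fun i hi => ?_
    rw [Memory.setNat_nats_ne _ _ _ (by decide), Memory.setNat_nats_same]
    have h0 : s'.nats 0 0 = n := by rw [h1 0 (by decide)]; simp [inputMemory]
    simp only [NatExpr.eval, h3, h0, h4 j le_rfl]
    by_cases hij : i = j + 1
    · simp [hij, Nat.add_mul]
    · rw [Function.update_of_ne hij]
      exact h4 i (by omega)
  · refine ⟨?_, ?_, ?_, fun i => h3 i i.2.le, fun i j => ?_⟩
    · rw [h1 0 (by decide)]; simp [inputMemory]
    · rw [h1 1 (by decide)]; simp [inputMemory]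
    · rw [h2 0 (by decide)]; simp [inputMemory]
    · rw [h2 1 (by decide)]
      have hd : ((i : ℕ) * n + j) / n = i := by
        rw [mul_comm, Nat.mul_add_div (i.pos), Nat.div_eq_of_lt j.2, add_zero]
      have hm : ((i : ℕ) * n + j) % n = j := by
        rw [mul_comm, Nat.mul_add_mod, Nat.mod_eq_of_lt j.2]
      simp [inputMemory, hd, hm]

/-! ### Ranks and the center -/

/-- The point `y` comes before `x` if it is farther from `z`, or equally far and has the smaller
index. The definition has the form in which the machine tests it. -/
def Before (e : Fin n ≃ X) (z y x : X) : Prop :=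
  dist z x ≤ dist z y ∧ ¬ (dist z y ≤ dist z x ∧ e.symm x ≤ e.symm y)

open scoped Classical in
/-- The number of points of the cluster of `x` that come before `x`. -/
def rank [Fintype X] (e : Fin n ≃ X) (z : X) (cl : X → ℕ) (x : X) : ℕ :=
  (Finset.univ.filter fun y => cl y = cl x ∧ Before e z y x).card

/-- Compute the ranks with respect to the point in the register `iZ`. -/
def rankCmd : Cmd :=
  .forEach iU <|
    .seq (sumNatCmd iV aCounter
      (.branch
        (.conj (.conj (.natLe (.get aCluster (reg iV)) (.get aCluster (reg iU)))
            (.natLe (.get aCluster (reg iU)) (.get aCluster (reg iV))))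
          (.conj (.realLe (distExpr iZ iU) (distExpr iZ iV))
            (.neg (.conj (.realLe (distExpr iZ iV) (distExpr iZ iU)) (.natLe (reg iU) (reg iV))))))
        (.setNat aCounter (.lit 0) (.add (reg aCounter) (.lit 1))) .skip))
    (.setNat aRank (reg iU) (reg aCounter))

theorem does_rankCmd [Fintype X] (hs : HoldsInput e k ε s) {z : Fin n} (hz : s.nats iZ 0 = z)
    {cl : X → ℕ} (hcl : ∀ u, s.nats aCluster (e.symm u) = cl u) :
    Does q n m rankCmd s fun s' => ∀ u, s'.nats aRank (e.symm u) = rank e (e z) cl u := by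
  classical
  have hcl' : ∀ u : Fin n, s.nats aCluster u = cl (e u) := fun u => by rw [← hcl]; simp
  refine (Does.fill (a := aRank) (fun u => rank e (e z) cl (e u)) hs.points (by decide)
    (by decide) (by decide) fun u s₁ h1 r1 hu => ?_).mono fun s' _ _ h u => ?_
  · have hs₁ : HoldsInput e k ε s₁ := hs.of_eq (h1 0 (by decide)) (h1 1 (by decide))
      (h1 3 (by decide)) (r1 0 (by decide)) (r1 1 (by decide))
    refine Does.seq ((Does.sumNat (fun v => if cl (e v) = cl (e u) ∧ Before e (e z) (e v) (e u)
      then 1 else 0) hs₁.points (by decide) (by decide) (by decide) fun v s₂ h2 r2 hv => ?_).mono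
        fun s₂ h2 r2 h => Does.setNat ?_)
    · have hs₂ : HoldsInput e k ε s₂ := hs₁.of_eq (h2 0 (by decide)) (h2 1 (by decide))
        (h2 3 (by decide)) (r2 0 (by decide)) (r2 1 (by decide))
      have hu₂ : s₂.nats iU 0 = u := by rw [h2 4 (by decide), hu]
      have hz₂ : s₂.nats iZ 0 = z := by rw [h2 6 (by decide), h1 6 (by decide), hz]
      have hc₂ : ∀ u : Fin n, s₂.nats aCluster u = cl (e u) := fun u => by
        rw [h2 8 (by decide), h1 8 (by decide), hcl']
      refine Does.branch (fun hb => Does.setNat ?_) (fun hb => Does.skip ?_) <;>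
      simp only [Test.Holds, hs₂.eval_dist hz₂ hu₂, hs₂.eval_dist hz₂ hv, NatExpr.eval, hu₂, hv,
        hc₂, ← le_antisymm_iff] at hb
      · rw [if_pos]
        · simp [NatExpr.eval]
        · simpa [Before] using hb
      · rw [if_neg, add_zero]
        simpa [Before] using hb
    · simp only [NatExpr.eval, h2 4 (by decide), h2 9 (by decide), hu, h,
        Memory.setNat_nats_same]
      congr 1
      rw [Equiv.sum_comp e fun v => if cl v = cl (e u) ∧ Before e (e z) v (e u) then 1 else 0]
      simp [rank]
  · simpa using h (e.symm u)

/-- The sum of the `q`-th powers of the distances from `z` to the `k` points farthest from `z`. -/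
def topSum [Fintype X] (q : ℝ) (e : Fin n ≃ X) (k : ℕ) (z : X) : ℝ :=
  ∑ u, if rank e z (fun _ => 0) u < k then dist z u ^ q else 0

/-- Compute `topSum` for the point in the register `iZ` from the ranks. -/
def topSumCmd : Cmd :=
  sumRealCmd iU rAcc <|
    .branch (.natLe (.add (.get aRank (reg iU)) (.lit 1)) (reg 1))
      (.setReal rAcc (.lit 0) (.add (.get rAcc (.lit 0)) (.pow (distExpr iZ iU)))) .skip

theorem does_topSumCmd [Fintype X] (hs : HoldsInput e k ε s) {z : Fin n} (hz : s.nats iZ 0 = z)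
    (hr : ∀ u, s.nats aRank (e.symm u) = rank e (e z) (fun _ => 0) u) :
    Does q n m topSumCmd s fun s' => s'.reals rAcc 0 = topSum q e k (e z) := by
  have hr' : ∀ u : Fin n, s.nats aRank u = rank e (e z) (fun _ => 0) (e u) :=
    fun u => by rw [← hr]; simp
  refine (Does.sumReal (fun u => if rank e (e z) (fun _ => 0) (e u) < k then
    dist (e z) (e u) ^ q else 0) hs.points (by decide) (by decide)
    fun u s₁ h1 r1 hu => ?_).mono fun s' _ _ h => ?_
  · have hs₁ : HoldsInput e k ε s₁ := hs.of_eq (h1 0 (by decide)) (h1 1 (by decide))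
      (h1 3 (by decide)) (r1 0 (by decide)) (r1 1 (by decide))
    have hz₁ : s₁.nats iZ 0 = z := by rw [h1 6 (by decide), hz]
    refine Does.branch (fun hb => Does.setReal ?_) (fun hb => Does.skip ?_) <;>
    simp only [Test.Holds, NatExpr.eval, hu, hs₁.size, h1 9 (by decide), hr',
      Nat.add_one_le_iff] at hb
    · rw [if_pos hb, Memory.setReal_reals_same]
      simp only [NatExpr.eval, Function.update_self]
      rw [RealExpr.eval, hs₁.eval_pow hz₁ hu]
      simp [RealExpr.eval, NatExpr.eval]
    · rw [if_neg hb, add_zero]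
  · rw [h, Equiv.sum_comp e fun u => if rank e (e z) (fun _ => 0) u < k then
      dist (e z) u ^ q else 0, topSum]

/-- Find the point `z` with the smallest value of `topSum`. The first point is accepted without a
comparison. -/
def centerCmd : Cmd :=
  .forEach iZ <| .seq rankCmd <| .seq topSumCmd <|
    .branch (.neg (.conj (.neg (.natLe (reg iZ) (.lit 0)))
        (.realLe (.get rScale (.lit 0)) (.get rAcc (.lit 0)))))
      (.seq (.setReal rScale (.lit 0) (.get rAcc (.lit 0)))
        (.setNat aCenter (.lit 0) (reg iZ))) .skip

theorem does_centerCmd [Fintype X] (hs : HoldsInput e k ε s) (hn : 0 < n)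
    (hcl : ∀ i, s.nats aCluster i = 0) :
    Does q n m centerCmd s fun s' => ∃ y : Fin n, s'.nats aCenter 0 = y ∧
      s'.reals rScale 0 = topSum q e k (e y) ∧ ∀ z, topSum q e k (e y) ≤ topSum q e k z := by
  refine (Does.forEach (fun j s' => 0 < j → ∃ y : Fin n, s'.nats aCenter 0 = y ∧
      s'.reals rScale 0 = topSum q e k (e y) ∧ ∀ z : Fin n, (z : ℕ) < j →
        topSum q e k (e y) ≤ topSum q e k (e z)) hs.points (by decide) (by decide)
        (by simp) ?_).mono fun s' _ _ h => ?_
  · intro j hj s₁ h1 r1 hz h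
    have hs₁ : HoldsInput e k ε s₁ := hs.of_eq (h1 0 (by decide)) (h1 1 (by decide))
      (h1 3 (by decide)) (r1 0 (by decide)) (r1 1 (by decide))
    refine Does.seq ((does_rankCmd hs₁ (z := ⟨j, hj⟩) hz (cl := fun _ => 0) fun u => by
      rw [h1 8 (by decide), hcl]).mono fun s₂ h2 r2 hr => ?_)
    have hs₂ : HoldsInput e k ε s₂ := hs₁.of_eq (h2 0 (by decide)) (h2 1 (by decide))
      (h2 3 (by decide)) (r2 0 (by decide)) (r2 1 (by decide))
    refine Does.seq ((does_topSumCmd hs₂ (z := ⟨j, hj⟩) (by rw [h2 6 (by decide), hz])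
      hr).mono fun s₃ h3 r3 ht => ?_)
    have hz₃ : s₃.nats iZ 0 = j := by rw [h3 6 (by decide), h2 6 (by decide), hz]
    have hc₃ : s₃.nats aCenter 0 = s₁.nats aCenter 0 := by
      rw [h3 7 (by decide), h2 7 (by decide)]
    have hM₃ : s₃.reals rScale 0 = s₁.reals rScale 0 := by
      rw [r3 2 (by decide), r2 2 (by decide)]
    refine Does.branch (fun hb => Does.seq (Does.setReal (Does.setNat ?_)))
      (fun hb => Does.skip ?_) <;>
    simp only [Test.Holds, NatExpr.eval, RealExpr.eval, hz₃, ht, hM₃] at hb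
    · rw [not_and] at hb
      intro _
      refine ⟨⟨j, hj⟩, ?_, ?_, fun z hzj => ?_⟩
      · rw [Memory.setNat_nats_ne _ _ _ (by decide)]
        simp [NatExpr.eval, hz₃]
      · simp [NatExpr.eval, RealExpr.eval, ht]
      · rcases Nat.lt_succ_iff_lt_or_eq.1 hzj with h' | h'
        · obtain ⟨y, -, hy, hy'⟩ := h (by omega)
          rw [hy] at hb
          exact (not_le.1 (hb (by omega))).le.trans (hy' z h')
        · rw [show z = ⟨j, hj⟩ from Fin.ext h']
    · obtain ⟨hj0, hle⟩ := not_not.1 hb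
      obtain ⟨y, hy, hyM, hy'⟩ := h (by omega)
      intro _
      refine ⟨y, ?_, ?_, fun z hzj => ?_⟩
      · rw [Memory.setNat_nats_ne _ _ _ (by decide), hc₃, hy]
      · rw [Memory.setNat_reals, hM₃, hyM]
      · rcases Nat.lt_succ_iff_lt_or_eq.1 hzj with h' | h'
        · exact hy' z h'
        · rw [show z = ⟨j, hj⟩ from Fin.ext h', ← hyM]
          exact hle
  · obtain ⟨y, h1, h2, h3⟩ := h hn
    exact ⟨y, h1, h2, fun z => by simpa using h3 (e.symm z) (e.symm z).2⟩

end

/-! ### Clusters -/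

section

variable {X : Type} [PseudoMetricSpace X] {n k m K : ℕ} {e : Fin n ≃ X} {q ε : ℝ} {s : Memory}

/-- The accuracy parameter of the algorithm. All estimates lose a factor of about
`1 + 10 * K * accuracy K ε` and an additive term that is `10 * K * accuracy K ε` times the scale,
which is at most `16 * K ^ 2` times the optimum. The constant `510` makes three such losses,
`30 * (16 * K ^ 2 + 1) * K * accuracy K ε` in total, at most `ε / (1 + ε)`, because
`30 * (16 * K ^ 2 + 1) ≤ 510 * K ^ 2`. -/
def accuracy (K : ℕ) (ε : ℝ) : ℝ := ε / (1 + ε) / (510 * K ^ 3 : ℕ)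

/-- The factor in front of `y ^ q` in the estimate of `(x + y) ^ q` by almost `x ^ q` and a multiple
of `y ^ q`. -/
def blowup (q θ : ℝ) : ℝ := (1 + 1 / θ) ^ q

/-- A point is far if its distance to the center, to the power `q`, is more than `farFactor` times
the average over the `k` farthest points. -/
def farFactor (q θ : ℝ) : ℝ := 2 * blowup q θ / θ

/-- The radius of a cluster, to the power `q`, relative to the same average. -/
def closeFactor (q : ℝ) (K : ℕ) (θ : ℝ) : ℝ := θ / (4 * K * blowup q θ)

/-- Compute the parameters of the algorithm from `ε`. -/
def constCmd (K : ℕ) : Cmd :=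
  .seq (.setReal rConst (.lit 0) (.div (.div (.get 0 (.lit 0))
    (.add (.ofNat (.lit 1)) (.get 0 (.lit 0)))) (.ofNat (.lit (510 * K ^ 3))))) <|
  .seq (.setReal rConst (.lit 1) (.pow (.add (.ofNat (.lit 1))
    (.div (.ofNat (.lit 1)) (.get rConst (.lit 0)))))) <|
  .seq (.setReal rConst (.lit 2) (.div (.mul (.ofNat (.lit 2)) (.get rConst (.lit 1)))
    (.get rConst (.lit 0)))) <|
  .setReal rConst (.lit 3) (.div (.get rConst (.lit 0))
    (.mul (.mul (.ofNat (.lit 4)) (.ofNat (.lit K))) (.get rConst (.lit 1))))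

theorem does_constCmd (hs : HoldsInput e k ε s) (hε : 0 < ε) :
    Does q n m (constCmd K) s fun s' =>
      s'.reals rConst 2 = farFactor q (accuracy K ε) ∧
        s'.reals rConst 3 = closeFactor q K (accuracy K ε) := by
  have hpos : 0 ≤ 1 + 1 / accuracy K ε := by
    unfold accuracy
    positivity
  have hmax : max (1 + 1 / accuracy K ε) 0 = 1 + 1 / accuracy K ε := max_eq_left hpos
  refine Does.seq (Does.setReal (Does.seq (Does.setReal (Does.seq (Does.setReal (Does.setReal
    ?_))))))
  have h0 : (s.setReal 4 0 (accuracy K ε)).reals 4 0 = accuracy K ε := by simp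
  simp only [NatExpr.eval, RealExpr.eval, hs.eps]
  rw [show ε / (((1 : ℕ) : ℝ) + ε) / ((510 * K ^ 3 : ℕ) : ℝ) = accuracy K ε by
    simp [accuracy]]
  simp only [Memory.setReal_reals_same, Function.update_self, Nat.cast_one, hmax]
  constructor
  · simp [farFactor, blowup]
  · simp [closeFactor, blowup]

/-- The point `u` is far from the center `z`. The points that are not far form the core. -/
def IsFar (q : ℝ) (k : ℕ) (C M : ℝ) (z u : X) : Prop := ¬ (k * dist z u ^ q ≤ C * M)

/-- The points `u` and `v` are close enough for `v` to lead a cluster that contains `u`. -/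
def IsClose (q : ℝ) (k : ℕ) (ξ M : ℝ) (u v : X) : Prop := k * dist u v ^ q ≤ ξ * M

/-- `cl` divides the points into `m` clusters: the cluster `0` consists of the far points, the
other clusters are balls around points of the core that are not close to each other. -/
structure IsClustering (q : ℝ) (k : ℕ) (C ξ M : ℝ) (z : X) (cl : X → ℕ) (m : ℕ) : Prop where
  eq_zero_iff : ∀ u, cl u = 0 ↔ IsFar q k C M z u
  lt : ∀ u, cl u < m
  leaders : ∃ l : ℕ → X, (∀ u, cl u ≠ 0 → IsClose q k ξ M u (l (cl u))) ∧
    ∀ j, 1 ≤ j → j < m → ¬ IsFar q k C M z (l j) ∧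
      ∀ i, 1 ≤ i → i < j → ¬ IsClose q k ξ M (l j) (l i)

/-- Give the point in the register `iU` the number of its cluster. If it belongs to none of the
present ones, this is the number of clusters. -/
def assignCmd : Cmd :=
  .seq (.setNat aCluster (reg iU) (reg aClusters)) <|
  .seq (.forEach iV (.branch (.conj (.conj (.natLe (.lit 1) (reg iV))
      (.natLe (.add (reg iV) (.lit 1)) (reg aClusters)))
    (.realLe (.mul (.ofNat (reg 1))
        (.pow (.get 1 (.add (.get aRow (reg iU)) (.get aLeader (reg iV))))))
      (.mul (.get rConst (.lit 3)) (.get rScale (.lit 0)))))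
    (.setNat aCluster (reg iU) (reg iV)) .skip)) <|
  .branch (.realLe (.mul (.ofNat (reg 1)) (.pow (distExpr aCenter iU)))
      (.mul (.get rConst (.lit 2)) (.get rScale (.lit 0))))
    .skip (.setNat aCluster (reg iU) (.lit 0))

theorem does_assignCmd (hs : HoldsInput e k ε s) {z u : Fin n} (hz : s.nats aCenter 0 = z)
    (hu : s.nats iU 0 = u) {C ξ M : ℝ} (hC : s.reals rConst 2 = C) (hξ : s.reals rConst 3 = ξ)
    (hM : s.reals rScale 0 = M) {N : ℕ} (hN : s.nats aClusters 0 = N) (hNn : N ≤ n) :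
    Does q n m assignCmd s fun s' => ∃ c,
      s'.nats aCluster = Function.update (s.nats aCluster) u c ∧
      ((IsFar q k C M (e z) (e u) ∧ c = 0) ∨
        ¬ IsFar q k C M (e z) (e u) ∧ ((c = N ∧ ∀ i, 1 ≤ i → i < N → ∀ v : Fin n,
            s.nats aLeader i = v → ¬ IsClose q k ξ M (e u) (e v)) ∨
          (1 ≤ c ∧ c < N ∧ ∀ v : Fin n, s.nats aLeader c = v →
            IsClose q k ξ M (e u) (e v)))) := by
  refine Does.seq (Does.setNat ?_)
  simp only [NatExpr.eval, hu, hN]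
  have hs₁ : HoldsInput e k ε (s.setNat aCluster u N) := hs.of_eq
    (Memory.setNat_nats_ne _ _ _ (by decide)) (Memory.setNat_nats_ne _ _ _ (by decide))
    (Memory.setNat_nats_ne _ _ _ (by decide)) rfl rfl
  refine Does.seq ((Does.forEach (fun j s' => ∃ c,
    s'.nats aCluster = Function.update (s.nats aCluster) u c ∧
      ((c = N ∧ ∀ i, 1 ≤ i → i < N → i < j → ∀ v : Fin n,
          s.nats aLeader i = v → ¬ IsClose q k ξ M (e u) (e v)) ∨
        (1 ≤ c ∧ c < N ∧ ∀ v : Fin n, s.nats aLeader c = v →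
          IsClose q k ξ M (e u) (e v)))) hs₁.points (by decide) (by decide) ?_ ?_).mono
      fun s₂ h2 r2 h => ?_)
  · refine ⟨N, ?_, Or.inl ⟨rfl, by simp⟩⟩
    rw [Memory.setNat_nats_ne _ _ _ (by decide), Memory.setNat_nats_same]
  · rintro j hj s₂ h2 r2 hv ⟨c, hc, h⟩
    have hs₂ : HoldsInput e k ε s₂ := hs₁.of_eq (h2 0 (by decide)) (h2 1 (by decide))
      (h2 3 (by decide)) (r2 0 (by decide)) (r2 1 (by decide))
    have hu₂ : s₂.nats iU 0 = u := by
      rw [h2 4 (by decide), Memory.setNat_nats_ne _ _ _ (by decide), hu]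
    have hN₂ : s₂.nats aClusters 0 = N := by
      rw [h2 10 (by decide), Memory.setNat_nats_ne _ _ _ (by decide), hN]
    have hl₂ : s₂.nats aLeader = s.nats aLeader := by
      rw [h2 11 (by decide), Memory.setNat_nats_ne _ _ _ (by decide)]
    have hc₂ : s₂.reals rConst 3 = ξ := by rw [r2 4 (by decide), Memory.setNat_reals, hξ]
    have hM₂ : s₂.reals rScale 0 = M := by rw [r2 2 (by decide), Memory.setNat_reals, hM]
    have htest : ∀ v : Fin n, s.nats aLeader j = v →
        ((Test.realLe (.mul (.ofNat (reg 1))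
          (.pow (.get 1 (.add (.get aRow (reg iU)) (.get aLeader (reg iV))))))
          (.mul (.get rConst (.lit 3)) (.get rScale (.lit 0)))).Holds q s₂ ↔
        IsClose q k ξ M (e u) (e v)) := by
      intro v hv'
      simp only [Test.Holds, RealExpr.eval, NatExpr.eval, hs₂.size, hu₂, hl₂, hv, hv', hs₂.row,
        hs₂.entry, max_eq_left dist_nonneg, hc₂, hM₂, IsClose]
    have hnat : (Test.conj (.natLe (.lit 1) (reg iV))
        (.natLe (.add (reg iV) (.lit 1)) (reg aClusters))).Holds q s₂ ↔ 1 ≤ j ∧ j < N := by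
      simp only [Test.Holds, NatExpr.eval, hv, hN₂, Nat.add_one_le_iff]
    refine Does.branch (fun hb => Does.setNat ?_) (fun hb => Does.skip ?_)
    · obtain ⟨h1, h2⟩ := hnat.1 hb.1
      refine ⟨j, ?_, Or.inr ⟨h1, h2, fun v hv' => (htest v hv').1 hb.2⟩⟩
      rw [Memory.setNat_nats_ne _ _ _ (by decide), Memory.setNat_nats_same, hc]
      simp [NatExpr.eval, hu₂, hv]
    · refine ⟨c, by rw [Memory.setNat_nats_ne _ _ _ (by decide), hc], h.imp_left ?_⟩
      rintro ⟨hcN, h'⟩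
      refine ⟨hcN, fun i hi hiN hij v hv' => ?_⟩
      rcases Nat.lt_succ_iff_lt_or_eq.1 hij with hij' | rfl
      · exact h' i hi hiN hij' v hv'
      · exact fun hcl => hb ⟨hnat.2 ⟨hi, hiN⟩, (htest v hv').2 hcl⟩
  · obtain ⟨c, hc, h⟩ := h
    have hs₂ : HoldsInput e k ε s₂ := hs₁.of_eq (h2 0 (by decide)) (h2 1 (by decide))
      (h2 3 (by decide)) (r2 0 (by decide)) (r2 1 (by decide))
    have hu₂ : s₂.nats iU 0 = u := by
      rw [h2 4 (by decide), Memory.setNat_nats_ne _ _ _ (by decide), hu]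
    have hz₂ : s₂.nats aCenter 0 = z := by
      rw [h2 7 (by decide), Memory.setNat_nats_ne _ _ _ (by decide), hz]
    have hc₂ : s₂.reals rConst 2 = C := by rw [r2 4 (by decide), Memory.setNat_reals, hC]
    have hM₂ : s₂.reals rScale 0 = M := by rw [r2 2 (by decide), Memory.setNat_reals, hM]
    refine Does.branch (fun hb => Does.skip ⟨c, hc, Or.inr ⟨?_, ?_⟩⟩)
      (fun hb => Does.setNat ⟨0, ?_, Or.inl ⟨?_, rfl⟩⟩)
    · simp only [Test.Holds, RealExpr.eval, NatExpr.eval, hs₂.size, hc₂, hM₂,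
        hs₂.eval_dist hz₂ hu₂, max_eq_left dist_nonneg] at hb
      rw [IsFar, not_not]
      exact hb
    · exact h.imp_left fun h => ⟨h.1, fun i hi hiN => h.2 i hi hiN (by omega)⟩
    · rw [Memory.setNat_nats_same, hc]
      simp [NatExpr.eval, hu₂]
    · simp only [Test.Holds, RealExpr.eval, NatExpr.eval, hs₂.size, hc₂, hM₂,
        hs₂.eval_dist hz₂ hu₂, max_eq_left dist_nonneg] at hb
      exact hb

/-- Divide the points into clusters. A point of the core that is close to no leader becomes the
leader of a new cluster. -/
def clusterCmd : Cmd :=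
  .seq (.setNat aClusters (.lit 0) (.lit 1)) <|
  .forEach iU <| .seq assignCmd <|
    .branch (.natLe (reg aClusters) (.get aCluster (reg iU)))
      (.seq (.setNat aLeader (reg aClusters) (reg iU))
        (.setNat aClusters (.lit 0) (.add (reg aClusters) (.lit 1)))) .skip

theorem does_clusterCmd (hs : HoldsInput e k ε s) {z : Fin n} (hz : s.nats aCenter 0 = z)
    (hq : 0 < q) {C ξ M : ℝ} (hC : s.reals rConst 2 = C) (hξ : s.reals rConst 3 = ξ)
    (hM : s.reals rScale 0 = M) (hξ0 : 0 ≤ ξ) (hM0 : 0 ≤ M) :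
    Does q n m clusterCmd s fun s' => ∃ cl : X → ℕ, ∃ N : ℕ, s'.nats aClusters 0 = N ∧
      (∀ u, s'.nats aCluster (e.symm u) = cl u) ∧ IsClustering q k C ξ M (e z) cl N := by
  refine Does.seq (Does.setNat ?_)
  simp only [NatExpr.eval]
  have hs₁ : HoldsInput e k ε (s.setNat aClusters 0 1) := hs.of_eq
    (Memory.setNat_nats_ne _ _ _ (by decide)) (Memory.setNat_nats_ne _ _ _ (by decide))
    (Memory.setNat_nats_ne _ _ _ (by decide)) rfl rfl
  refine (Does.forEach (fun j s' => ∃ N, s'.nats aClusters 0 = N ∧ 1 ≤ N ∧ N ≤ j + 1 ∧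
    (∀ i, 1 ≤ i → i < N → ∃ v : Fin n, s'.nats aLeader i = v ∧ ¬ IsFar q k C M (e z) (e v) ∧
      ∀ i', 1 ≤ i' → i' < i → ∀ v' : Fin n, s'.nats aLeader i' = v' →
        ¬ IsClose q k ξ M (e v) (e v')) ∧
    (∀ u : Fin n, (u : ℕ) < j → (s'.nats aCluster u = 0 ↔ IsFar q k C M (e z) (e u)) ∧
      s'.nats aCluster u < N ∧ (s'.nats aCluster u ≠ 0 → ∃ v : Fin n,
        s'.nats aLeader (s'.nats aCluster u) = v ∧ IsClose q k ξ M (e u) (e v))))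
    hs₁.points (by decide) (by decide) ?_ ?_).mono fun s₂ h2 r2 h => ?_
  · refine ⟨1, ?_, le_rfl, le_rfl, fun i h1 h2 => by omega, fun u hu => by omega⟩
    rw [Memory.setNat_nats_ne _ _ _ (by decide)]
    simp
  · rintro j hj s₂ h2 r2 hu ⟨N, hN, hN1, hNj, hlead, hpts⟩
    have hs₂ : HoldsInput e k ε s₂ := hs₁.of_eq (h2 0 (by decide)) (h2 1 (by decide))
      (h2 3 (by decide)) (r2 0 (by decide)) (r2 1 (by decide))
    have hz₂ : s₂.nats aCenter 0 = z := by
      rw [h2 7 (by decide), Memory.setNat_nats_ne _ _ _ (by decide), hz]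
    have hc₂ : s₂.reals rConst 2 = C := by rw [r2 4 (by decide), Memory.setNat_reals, hC]
    have hx₂ : s₂.reals rConst 3 = ξ := by rw [r2 4 (by decide), Memory.setNat_reals, hξ]
    have hM₂ : s₂.reals rScale 0 = M := by rw [r2 2 (by decide), Memory.setNat_reals, hM]
    refine Does.seq ((does_assignCmd hs₂ hz₂ (u := ⟨j, hj⟩) hu hc₂ hx₂ hM₂ hN
      (by omega)).mono fun s₃ h3 r3 h => ?_)
    obtain ⟨c, hc, h⟩ := h
    have hN₃ : s₃.nats aClusters 0 = N := by rw [h3 10 (by decide), hN]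
    have hu₃ : s₃.nats iU 0 = j := by rw [h3 4 (by decide), hu]
    have hl₃ : s₃.nats aLeader = s₂.nats aLeader := h3 11 (by decide)
    have hcj : s₃.nats aCluster j = c := by simp [hc]
    have hcne : ∀ u : Fin n, (u : ℕ) < j → s₃.nats aCluster u = s₂.nats aCluster u := by
      intro u hu
      rw [hc, Function.update_of_ne hu.ne]
    refine Does.branch (fun hb => Does.seq (Does.setNat (Does.setNat ?_)))
      (fun hb => Does.skip ?_) <;> simp only [Test.Holds, NatExpr.eval, hN₃, hu₃, hcj] at hb
    · simp only [NatExpr.eval, hN₃, hu₃]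
      obtain ⟨hnf, rfl, hnc⟩ : ¬ IsFar q k C M (e z) (e ⟨j, hj⟩) ∧ c = N ∧
          ∀ i, 1 ≤ i → i < N → ∀ v : Fin n, s₂.nats aLeader i = v →
            ¬ IsClose q k ξ M (e ⟨j, hj⟩) (e v) := by
        rcases h with h | ⟨h1, h | h⟩
        · omega
        · exact ⟨h1, h⟩
        · omega
      have e1 : ∀ i < c, ((((s₃.setNat aLeader c j).setNat aClusters 0
          ((s₃.setNat aLeader c j).nats aClusters 0 + 1)).setNat iU 0 (j + 1)).nats aLeader) i =
          s₂.nats aLeader i := by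
        intro i hi
        rw [Memory.setNat_nats_ne _ _ _ (by decide), Memory.setNat_nats_ne _ _ _ (by decide),
          Memory.setNat_nats_same, Function.update_of_ne hi.ne, hl₃]
      have e2 : ((((s₃.setNat aLeader c j).setNat aClusters 0
          ((s₃.setNat aLeader c j).nats aClusters 0 + 1)).setNat iU 0 (j + 1)).nats aLeader) c =
          j := by
        rw [Memory.setNat_nats_ne _ _ _ (by decide), Memory.setNat_nats_ne _ _ _ (by decide),
          Memory.setNat_nats_same, Function.update_self]
      have e3 : (((s₃.setNat aLeader c j).setNat aClusters 0
          ((s₃.setNat aLeader c j).nats aClusters 0 + 1)).setNat iU 0 (j + 1)).nats aCluster =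
          s₃.nats aCluster := by
        rw [Memory.setNat_nats_ne _ _ _ (by decide), Memory.setNat_nats_ne _ _ _ (by decide),
          Memory.setNat_nats_ne _ _ _ (by decide)]
      refine ⟨c + 1, ?_, by omega, by omega, fun i hi hic => ?_, fun u hu => ?_⟩
      · rw [Memory.setNat_nats_ne _ _ _ (by decide), Memory.setNat_nats_same,
          Memory.setNat_nats_ne _ _ _ (by decide)]
        simp [hN₃]
      · rcases Nat.lt_succ_iff_lt_or_eq.1 hic with h' | rfl
        · obtain ⟨v, hv, hv1, hv2⟩ := hlead i hi h'
          refine ⟨v, by rw [e1 i h', hv], hv1, fun i' hi' hii v' hv' => ?_⟩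
          rw [e1 i' (by omega)] at hv'
          exact hv2 i' hi' hii v' hv'
        · refine ⟨⟨j, hj⟩, e2, hnf, fun i' hi' hii v' hv' => ?_⟩
          rw [e1 i' hii] at hv'
          exact hnc i' hi' hii v' hv'
      · rw [e3]
        rcases Nat.lt_succ_iff_lt_or_eq.1 hu with h' | h'
        · obtain ⟨p1, p2, p3⟩ := hpts u h'
          rw [hcne u h']
          refine ⟨p1, by omega, fun h0 => ?_⟩
          obtain ⟨v, hv, hv'⟩ := p3 h0
          exact ⟨v, by rw [e1 _ p2, hv], hv'⟩
        · obtain rfl : u = ⟨j, hj⟩ := Fin.ext h'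
          rw [hcj]
          refine ⟨⟨fun h0 => by omega, fun h0 => absurd h0 hnf⟩, by omega, fun _ =>
            ⟨⟨j, hj⟩, e2, ?_⟩⟩
          rw [IsClose, dist_self, Real.zero_rpow hq.ne', mul_zero]
          positivity
    · refine ⟨N, ?_, hN1, by omega, fun i hi hiN => ?_, fun u hu => ?_⟩
      · rw [Memory.setNat_nats_ne _ _ _ (by decide), hN₃]
      · obtain ⟨v, hv, hv1, hv2⟩ := hlead i hi hiN
        refine ⟨v, ?_, hv1, fun i' hi' hii v' hv' => ?_⟩
        · rw [Memory.setNat_nats_ne _ _ _ (by decide), hl₃, hv]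
        · rw [Memory.setNat_nats_ne _ _ _ (by decide), hl₃] at hv'
          exact hv2 i' hi' hii v' hv'
      · rw [Memory.setNat_nats_ne _ _ _ (by decide), Memory.setNat_nats_ne _ _ _ (by decide),
          hl₃]
        rcases Nat.lt_succ_iff_lt_or_eq.1 hu with h' | h'
        · rw [hcne u h']
          exact hpts u h'
        · obtain rfl : u = ⟨j, hj⟩ := Fin.ext h'
          rw [hcj]
          rcases h with ⟨hf, h0⟩ | ⟨hf, h | ⟨hc1, hcN, hcl⟩⟩
          · exact ⟨⟨fun _ => hf, fun _ => h0⟩, by omega, fun h => absurd h0 h⟩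
          · omega
          · obtain ⟨v, hv, -⟩ := hlead c hc1 hcN
            exact ⟨⟨fun h => by omega, fun h => absurd h hf⟩, hcN, fun _ => ⟨v, hv, hcl v hv⟩⟩
  · obtain ⟨N, hN, hN1, hNn, hlead, hpts⟩ := h
    refine ⟨fun u => s₂.nats aCluster (e.symm u), N, hN, fun u => rfl,
      ⟨fun u => ?_, fun u => ?_, ?_⟩⟩
    · simpa using (hpts (e.symm u) (e.symm u).2).1
    · exact (hpts (e.symm u) (e.symm u).2).2.1
    · choose l hl1 hl2 hl3 using hlead
      classical
      refine ⟨fun i => if h : 1 ≤ i ∧ i < N then e (l i h.1 h.2) else e z, fun u hu => ?_,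
        fun j hj hjN => ?_⟩
      · obtain ⟨-, p2, p3⟩ := hpts (e.symm u) (e.symm u).2
        obtain ⟨v, hv, hv'⟩ := p3 hu
        have h : 1 ≤ s₂.nats aCluster (e.symm u) ∧ s₂.nats aCluster (e.symm u) < N :=
          ⟨Nat.one_le_iff_ne_zero.2 hu, p2⟩
        simp only [dif_pos h]
        obtain rfl : v = l _ h.1 h.2 := Fin.ext (by rw [← hv, ← hl1])
        simpa using hv'
      · have h : 1 ≤ j ∧ j < N := ⟨hj, hjN⟩
        simp only [dif_pos h]
        refine ⟨hl2 _ _ _, fun i hi hij => ?_⟩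
        have h' : 1 ≤ i ∧ i < N := ⟨hi, hij.trans hjN⟩
        simp only [dif_pos h']
        exact hl3 j hj hjN i hi hij _ (hl1 i hi (hij.trans hjN))

end

/-! ### Sets of points in the memory -/

section

variable {X : Type} {n k m K : ℕ} {e : Fin n ≃ X} {q ε : ℝ} {s : Memory}

open Classical in
/-- The array `a` holds the indicator function of the set `T`. -/
def Marks (e : Fin n ≃ X) (s : Memory) (a : ℕ) (T : Finset X) : Prop :=
  ∀ u : Fin n, s.nats a u = if e u ∈ T then 1 else 0

theorem Marks.one_le_iff {a : ℕ} {T : Finset X} (h : Marks e s a T) (u : Fin n) :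
    1 ≤ s.nats a u ↔ e u ∈ T := by
  rw [h u]
  split_ifs <;> simp_all

theorem Marks.of_eq {a : ℕ} {T : Finset X} {s' : Memory} (h : Marks e s a T)
    (h' : s'.nats a = s.nats a) : Marks e s' a T := fun u => by rw [h', h u]

theorem Marks.outputSet_eq {T : Finset X} (h : Marks e s 2 T) : outputSet e s = T := by
  classical
  ext x
  obtain ⟨u, rfl⟩ := e.surjective x
  have := h.one_le_iff u
  simp [outputSet, ← this, Nat.one_le_iff_ne_zero]

/-- Mark in the array `a` the points for which the test `b` holds. -/
def markCmd (a : ℕ) (b : Test) : Cmd :=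
  .forEach iU (.branch b (.setNat a (reg iU) (.lit 1)) (.setNat a (reg iU) (.lit 0)))

theorem does_markCmd {a : ℕ} {b : Test} {T : Finset X} (hn : s.nats 0 0 = n) (ha : a ≠ iU)
    (ha0 : a ≠ 0) (hb : ∀ u : Fin n, ∀ s', (∀ c, c ≠ a → c ≠ iU → s'.nats c = s.nats c) →
      s'.reals = s.reals → s'.nats iU 0 = (u : ℕ) → (b.Holds q s' ↔ e u ∈ T)) :
    Does q n m (markCmd a b) s fun s' => Marks e s' a T := by
  classical
  refine (Does.fill (a := a) (fun u => if e u ∈ T then 1 else 0) hn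
    (by simp [Cmd.natWrites, ha.symm]) (by simp [Cmd.natWrites, ha0.symm]) ha
    fun u s₁ h1 r1 hu => ?_).mono fun s' _ _ h u => ?_
  · have := hb u s₁ (fun c hc hc' => h1 c (by simp [Cmd.natWrites, hc, hc']))
      (funext fun c => r1 c (by simp [Cmd.realWrites])) hu
    refine Does.branch (fun h => Does.setNat ?_) (fun h => Does.setNat ?_)
    · rw [if_pos (this.1 h)]
      simp [NatExpr.eval, hu]
    · rw [if_neg (fun h' => h (this.2 h'))]
      simp [NatExpr.eval, hu]
  · rw [h u]

/-- Mark in the array `aRight` the points that are chosen, but not in `aLeft`. -/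
def rightCmd : Cmd :=
  .forEach iU (.setNat aRight (reg iU) (.sub (.get aChosen (reg iU)) (.get aLeft (reg iU))))

open Classical in
theorem does_rightCmd {T L : Finset X} (hn : s.nats 0 0 = n) (hT : Marks e s aChosen T)
    (hL : Marks e s aLeft L) :
    Does q n m rightCmd s fun s' => Marks e s' aRight (T \ L) := by
  refine (Does.fill (a := aRight) (fun u => if e u ∈ T \ L then 1 else 0) hn (by decide)
    (by decide) (by decide) fun u s₁ h1 r1 hu => Does.setNat ?_).mono fun s' _ _ h u => h u
  simp only [NatExpr.eval, hu, Memory.setNat_nats_same, h1 15 (by decide), h1 16 (by decide),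
    hT u, hL u, Finset.mem_sdiff]
  congr 1
  by_cases h : e u ∈ T <;> by_cases h' : e u ∈ L <;> simp [h, h']

/-- Copy the array `aChosen` to the output. -/
def outputCmd : Cmd := .forEach iU (.setNat 2 (reg iU) (.get aChosen (reg iU)))

theorem does_outputCmd {T : Finset X} (hn : s.nats 0 0 = n) (hT : Marks e s aChosen T) :
    Does q n m outputCmd s fun s' => Marks e s' 2 T := by
  classical
  refine (Does.fill (a := 2) (fun u => if e u ∈ T then 1 else 0) hn (by decide)
    (by decide) (by decide) fun u s₁ h1 r1 hu => Does.setNat ?_).mono fun s' _ _ h u => ?_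
  · simp only [NatExpr.eval, hu, Memory.setNat_nats_same, h1 15 (by decide), hT u]
  · rw [h u]

/-- Count the marked points. -/
def countCmd (a : ℕ) : Cmd :=
  sumNatCmd iU aCounter (.setNat aCounter (.lit 0) (.add (reg aCounter) (.get a (reg iU))))

theorem sum_equiv_ite [Fintype X] {M : Type*} [AddCommMonoid M] (e : Fin n ≃ X) (T : Finset X)
    [DecidablePred (· ∈ T)] (f : X → M) :
    (∑ u : Fin n, if e u ∈ T then f (e u) else 0) = ∑ x ∈ T, f x := by
  classical
  rw [Equiv.sum_comp e fun x => if x ∈ T then f x else 0]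
  rw [← Finset.sum_filter]
  refine Finset.sum_congr ?_ fun _ _ => rfl
  ext
  simp

theorem does_countCmd [Fintype X] {a : ℕ} {T : Finset X} (ha : a ≠ iU) (ha' : a ≠ aCounter)
    (hn : s.nats 0 0 = n) (hT : Marks e s a T) :
    Does q n m (countCmd a) s fun s' => s'.nats aCounter 0 = T.card := by
  classical
  refine (Does.sumNat (fun u => if e u ∈ T then 1 else 0) hn (by simp [Cmd.natWrites])
    (by simp [Cmd.natWrites]) (by decide) fun u s₁ h1 r1 hu => Does.setNat ?_).mono
      fun s' _ _ h => ?_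
  · simp [NatExpr.eval, hu, h1 a (by simp [Cmd.natWrites, ha, ha']), hT u]
  · rw [h, sum_equiv_ite e T fun _ => 1, Finset.card_eq_sum_ones]

variable [PseudoMetricSpace X]

/-- The sum of the `q`-th powers of the distances between the points of `A` and those of `B`. -/
def crossSum (q : ℝ) (A B : Finset X) : ℝ := ∑ u ∈ A, ∑ v ∈ B, dist u v ^ q

/-- Compute `crossSum` for the sets marked in the arrays `a` and `b`. -/
def crossSumCmd (a b : ℕ) : Cmd :=
  sumRealCmd iU rAcc <| .forEach iV <|
    .branch (.conj (.natLe (.lit 1) (.get a (reg iU))) (.natLe (.lit 1) (.get b (reg iV))))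
      (.setReal rAcc (.lit 0) (.add (.get rAcc (.lit 0)) (.pow (distExpr iU iV)))) .skip

theorem does_crossSumCmd [Fintype X] (hs : HoldsInput e k ε s) {a b : ℕ} {A B : Finset X}
    (ha : a ≠ iU) (ha' : a ≠ iV) (hb : b ≠ iU) (hb' : b ≠ iV)
    (hA : Marks e s a A) (hB : Marks e s b B) :
    Does q n m (crossSumCmd a b) s fun s' => s'.reals rAcc 0 = crossSum q A B := by
  classical
  refine (Does.sumReal (fun u => if e u ∈ A then ∑ v : Fin n, (if e v ∈ B then
    dist (e u) (e v) ^ q else 0) else 0) hs.points (by simp [Cmd.natWrites])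
    (by simp [Cmd.natWrites]) fun u s₁ h1 r1 hu => ?_).mono fun s' _ _ h => ?_
  · have hs₁ : HoldsInput e k ε s₁ := hs.of_eq (h1 0 (by simp [Cmd.natWrites]))
      (h1 1 (by simp [Cmd.natWrites])) (h1 3 (by simp [Cmd.natWrites]))
      (r1 0 (by simp [Cmd.realWrites])) (r1 1 (by simp [Cmd.realWrites]))
    have hA₁ := hA.of_eq (h1 a (by simp [Cmd.natWrites, ha, ha']))
    have hB₁ := hB.of_eq (h1 b (by simp [Cmd.natWrites, hb, hb']))
    refine (Does.addReal (a := rAcc) (fun v =>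
      if e u ∈ A ∧ e v ∈ B then dist (e u) (e v) ^ q else 0)
      hs₁.points (by simp [Cmd.natWrites]) (by simp [Cmd.natWrites])
      fun v s₂ h2 r2 hv => ?_).mono fun s' _ _ h => ?_
    · have hs₂ : HoldsInput e k ε s₂ := hs₁.of_eq (h2 0 (by simp [Cmd.natWrites]))
        (h2 1 (by simp [Cmd.natWrites])) (h2 3 (by simp [Cmd.natWrites]))
        (r2 0 (by simp [Cmd.realWrites])) (r2 1 (by simp [Cmd.realWrites]))
      have hA₂ := hA₁.of_eq (h2 a (by simp [Cmd.natWrites, ha']))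
      have hB₂ := hB₁.of_eq (h2 b (by simp [Cmd.natWrites, hb']))
      have hu₂ : s₂.nats iU 0 = u := by rw [h2 4 (by simp [Cmd.natWrites]), hu]
      refine Does.branch (fun h => Does.setReal ?_) (fun h => Does.skip ?_) <;>
      simp only [Test.Holds, NatExpr.eval, hu₂, hv, hA₂.one_le_iff, hB₂.one_le_iff] at h
      · rw [if_pos h, Memory.setReal_reals_same]
        simp only [NatExpr.eval, Function.update_self]
        rw [RealExpr.eval, hs₂.eval_pow hu₂ hv]
        simp [RealExpr.eval, NatExpr.eval]
      · rw [if_neg h, add_zero]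
    · rw [h]
      congr 1
      by_cases hu : e u ∈ A <;> simp [hu]
  · rw [h, crossSum, sum_equiv_ite e A fun x => ∑ v : Fin n, (if e v ∈ B then
      dist x (e v) ^ q else 0)]
    exact Finset.sum_congr rfl fun x _ => sum_equiv_ite e B fun y => dist x y ^ q

/-! ### The evaluation of a solution -/

open Classical in
/-- The cut of the partition of `T` into `L` and the rest. -/
def cut (q : ℝ) (T L : Finset X) : ℝ := crossSum q L (T \ L)

/-- Mark the left side of a partition of the chosen set by the test `b`. If its size satisfies the
test `h`, replace the value by the cut if that is smaller. -/
def tryCutCmd (b h : Test) : Cmd :=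
  .seq (markCmd aLeft b) <| .seq rightCmd <| .seq (countCmd aLeft) <|
    .branch h (.seq (crossSumCmd aLeft aRight)
      (.branch (.realLe (.get rValue (.lit 0)) (.get rAcc (.lit 0))) .skip
        (.setReal rValue (.lit 0) (.get rAcc (.lit 0))))) .skip

theorem does_tryCutCmd [Fintype X] (hs : HoldsInput e k ε s) {b h : Test} {T L : Finset X}
    {h₀ : ℕ} (hT : Marks e s aChosen T)
    (hb : ∀ u : Fin n, ∀ s', (∀ c, c ≠ aLeft → c ≠ iU → s'.nats c = s.nats c) →
      s'.reals = s.reals → s'.nats iU 0 = (u : ℕ) → (b.Holds q s' ↔ e u ∈ L))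
    (hh : ∀ s' : Memory, s'.nats 1 = s.nats 1 → (h.Holds q s' ↔ s'.nats aCounter 0 = h₀)) :
    Does q n m (tryCutCmd b h) s fun s' => s'.reals rValue 0 =
      if L.card = h₀ then min (s.reals rValue 0) (cut q T L) else s.reals rValue 0 := by
  classical
  refine Does.seq ((does_markCmd hs.points (by decide) (by decide) hb).mono
    fun s₁ h1 r1 hL => ?_)
  simp only [markCmd, Cmd.natWrites, Cmd.realWrites] at h1 r1
  have hs₁ : HoldsInput e k ε s₁ := hs.of_eq (h1 0 (by decide)) (h1 1 (by decide))
    (h1 3 (by decide)) (r1 0 (by decide)) (r1 1 (by decide))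
  have hT₁ := hT.of_eq (h1 15 (by decide))
  refine Does.seq ((does_rightCmd hs₁.points hT₁ hL).mono fun s₂ h2 r2 hR => ?_)
  have hs₂ : HoldsInput e k ε s₂ := hs₁.of_eq (h2 0 (by decide)) (h2 1 (by decide))
    (h2 3 (by decide)) (r2 0 (by decide)) (r2 1 (by decide))
  have hL₂ := hL.of_eq (h2 16 (by decide))
  refine Does.seq ((does_countCmd (by decide) (by decide) hs₂.points hL₂).mono
    fun s₃ h3 r3 hc => ?_)
  have hs₃ : HoldsInput e k ε s₃ := hs₂.of_eq (h3 0 (by decide)) (h3 1 (by decide))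
    (h3 3 (by decide)) (r3 0 (by decide)) (r3 1 (by decide))
  have hh₃ := hh s₃ (by rw [h3 1 (by decide), h2 1 (by decide), h1 1 (by decide)])
  rw [hc] at hh₃
  have hv₃ : s₃.reals rValue 0 = s.reals rValue 0 := by
    rw [r3 5 (by decide), r2 5 (by decide), r1 5 (by decide)]
  refine Does.branch (fun hb => ?_) (fun hb => Does.skip ?_)
  · rw [if_pos (hh₃.1 hb)]
    refine Does.seq ((does_crossSumCmd hs₃ (by decide) (by decide) (by decide) (by decide)
      (hL₂.of_eq (h3 16 (by decide))) (hR.of_eq (h3 17 (by decide)))).mono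
      fun s₄ h4 r4 hx => ?_)
    have hv₄ : s₄.reals rValue 0 = s.reals rValue 0 := by rw [r4 5 (by decide), hv₃]
    refine Does.branch (fun hb => Does.skip ?_) (fun hb => Does.setReal ?_) <;>
    simp only [Test.Holds, RealExpr.eval, NatExpr.eval, hx, hv₄] at hb
    · rw [hv₄]
      exact (min_eq_left hb).symm
    · rw [Memory.setReal_reals_same]
      simp only [NatExpr.eval, RealExpr.eval, Function.update_self, hx]
      exact (min_eq_right (not_le.1 hb).le).symm
  · rw [if_neg (fun h' => hb (hh₃.2 h')), hv₃]

/-- The set that contains of each cluster `i` the first `f i` points. -/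
def select [Fintype X] (e : Fin n ≃ X) (z : X) (cl : X → ℕ) (f : ℕ → ℕ) : Finset X :=
  Finset.univ.filter fun u => rank e z cl u < f (cl u)

/-- The number `v` is at most every cut of `T` with `h` points on the left whose left side is in
`F`. It is itself a cut with `h` points on the left, or the value with which the search for the
smallest cut starts: the sum over all pairs of points, which is at least every cut. -/
def IsCutValue (q : ℝ) (h : ℕ) (T : Finset X) (F : Set (Finset X)) (v : ℝ) : Prop :=
  (∀ L ∈ F, L ⊆ T → L.card = h → v ≤ cut q T L) ∧
    (v = crossSum q T T ∨ ∃ L ⊆ T, L.card = h ∧ v = cut q T L)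

open Classical in
/-- The number `v` is the value of the solution `T` that the algorithm computes. For
`remoteBipartition`, it considers only the partitions that separate in each cluster of `T` the
first points from the others. -/
def IsValue [Fintype X] (q : ℝ) (e : Fin n ≃ X) (k : ℕ) (z : X) (cl : X → ℕ) :
    Problem → Finset X → ℝ → Prop
  | .remoteClique, T, v => v = crossSum q T T
  | .remoteStar, T, v => IsCutValue q 1 T Set.univ v
  | .remoteBipartition, T, v => IsCutValue q (k / 2) T
      {L | ∃ f : ℕ → ℕ, (∀ i, f i ≤ n) ∧ L = T ∩ select e z cl f} v

/-- Compute the value of the chosen set. In the case of `remoteBipartition`, the size `c` of the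
left side is tested by `2 * c ≤ k ≤ 2 * c + 1`, because the machine cannot divide natural
numbers. -/
def evalCmd (P : Problem) : Cmd :=
  .seq (crossSumCmd aChosen aChosen) <|
  .seq (.setReal rValue (.lit 0) (.get rAcc (.lit 0))) <|
  match P with
  | .remoteClique => .skip
  | .remoteStar => .forEach iZ <| tryCutCmd
      (.conj (.natLe (.lit 1) (.get aChosen (reg iU)))
        (.conj (.natLe (reg iU) (reg iZ)) (.natLe (reg iZ) (reg iU))))
      (.conj (.natLe (.lit 1) (reg aCounter)) (.natLe (reg aCounter) (.lit 1)))
  | .remoteBipartition => .odometer aSubquota 21 22 <| tryCutCmd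
      (.conj (.natLe (.lit 1) (.get aChosen (reg iU)))
        (.natLe (.add (.get aRank (reg iU)) (.lit 1)) (.get aSubquota (.get aCluster (reg iU)))))
      (.conj (.natLe (.add (reg aCounter) (reg aCounter)) (reg 1))
        (.natLe (reg 1) (.add (.add (reg aCounter) (reg aCounter)) (.lit 1))))

/-- The memory holds what the search for a solution uses: the input, the ranks, the clusters and
their number. -/
structure HoldsClusters [Fintype X] (e : Fin n ≃ X) (k : ℕ) (ε : ℝ) (z : X) (cl : X → ℕ) (m : ℕ)
    (s : Memory) : Prop extends HoldsInput e k ε s where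
  cluster : ∀ u : Fin n, s.nats aCluster u = cl (e u)
  rank : ∀ u : Fin n, s.nats aRank u = rank e z cl (e u)
  digits : s.nats aDigits 0 = m
  lt : ∀ u, cl u < m

theorem HoldsClusters.of_eq [Fintype X] {z : X} {cl : X → ℕ} {s' : Memory}
    (h : HoldsClusters e k ε z cl m s)
    (h' : ∀ a ∈ [0, 1, aRow, aCluster, aRank, aDigits], s'.nats a = s.nats a)
    (r' : ∀ a ∈ [0, 1], s'.reals a = s.reals a) : HoldsClusters e k ε z cl m s' :=
  ⟨h.toHoldsInput.of_eq (h' 0 (by decide)) (h' 1 (by decide)) (h' 3 (by decide))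
    (r' 0 (by decide)) (r' 1 (by decide)), fun u => by rw [h' 8 (by decide), h.cluster],
    fun u => by rw [h' 9 (by decide), h.rank], by rw [h' 12 (by decide), h.digits], h.lt⟩

theorem IsCutValue.min_cut {h : ℕ} {T L : Finset X} {F : Set (Finset X)} {v : ℝ} (hL : L ⊆ T)
    (hv : IsCutValue q h T F v) :
    IsCutValue q h T (insert L F) (if L.card = h then min v (cut q T L) else v) := by
  split_ifs with hc
  · refine ⟨fun L' hL' hT hc' => ?_, ?_⟩
    · rcases hL' with rfl | hL'
      · exact min_le_right _ _
      · exact (min_le_left _ _).trans (hv.1 L' hL' hT hc')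
    · rcases min_choice v (cut q T L) with h' | h' <;> rw [h']
      · exact hv.2
      · exact Or.inr ⟨L, hL, hc, rfl⟩
  · refine ⟨fun L' hL' hT hc' => ?_, hv.2⟩
    rcases hL' with rfl | hL'
    · exact absurd hc' hc
    · exact hv.1 L' hL' hT hc'

theorem IsCutValue.mono {h : ℕ} {T : Finset X} {F F' : Set (Finset X)} {v : ℝ}
    (hv : IsCutValue q h T F v) (hF : ∀ L ∈ F', L ⊆ T → L.card = h → L ∈ F) :
    IsCutValue q h T F' v :=
  ⟨fun L hL hT hc => hv.1 L (hF L hL hT hc) hT hc, hv.2⟩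

theorem does_evalCmd [Fintype X] {z : X} {cl : X → ℕ} (hs : HoldsClusters e k ε z cl m s)
    (P : Problem) {T : Finset X} (hT : Marks e s aChosen T) :
    Does q n m (evalCmd P) s fun s' => IsValue q e k z cl P T (s'.reals rValue 0) := by
  classical
  refine Does.seq ((does_crossSumCmd hs.toHoldsInput (by decide) (by decide) (by decide)
    (by decide) hT hT).mono fun s₁ h1 r1 hx => Does.seq (Does.setReal ?_))
  simp only [NatExpr.eval, RealExpr.eval, hx]
  have hs₁ : HoldsClusters e k ε z cl m (s₁.setReal rValue 0 (crossSum q T T)) := by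
    refine hs.of_eq (fun a ha => ?_) (fun a ha => ?_) <;> fin_cases ha
    · exact h1 0 (by decide)
    · exact h1 1 (by decide)
    · exact h1 3 (by decide)
    · exact h1 8 (by decide)
    · exact h1 9 (by decide)
    · exact h1 12 (by decide)
    · exact (Memory.setReal_reals_ne _ _ _ (by decide)).trans (r1 0 (by decide))
    · exact (Memory.setReal_reals_ne _ _ _ (by decide)).trans (r1 1 (by decide))
  have hT₁ : Marks e (s₁.setReal rValue 0 (crossSum q T T)) aChosen T :=
    hT.of_eq (h1 15 (by decide))
  have hx₁ : (s₁.setReal rValue 0 (crossSum q T T)).reals rValue 0 = crossSum q T T := by simp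
  generalize s₁.setReal rValue 0 (crossSum q T T) = s₁ at hs₁ hT₁ hx₁
  cases P with
  | remoteClique => exact Does.skip hx₁
  | remoteStar =>
    refine (Does.forEach (fun j s' => IsCutValue q 1 T
      {L | ∃ v : Fin n, (v : ℕ) < j ∧ L = T ∩ {e v}} (s'.reals rValue 0)) hs₁.points (by decide)
      (by decide) ⟨by simp, Or.inl hx₁⟩ fun j hj s₂ h2 r2 hz h => ?_).mono fun s' _ _ h => ?_
    · have hs₂ : HoldsInput e k ε s₂ := hs₁.toHoldsInput.of_eq (h2 0 (by decide))
        (h2 1 (by decide)) (h2 3 (by decide)) (r2 0 (by decide)) (r2 1 (by decide))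
      have hT₂ := hT₁.of_eq (h2 15 (by decide))
      refine (does_tryCutCmd hs₂ (L := T ∩ {e ⟨j, hj⟩}) (h₀ := 1) hT₂ (fun u s' h3 r3 hu => ?_)
        fun s' h3 => ?_).mono fun s' _ _ h' => ?_
      · have hz' : s'.nats iZ 0 = j := by rw [h3 6 (by decide) (by decide), hz]
        have hT' := hT₂.of_eq (h3 15 (by decide) (by decide))
        simp [Test.Holds, NatExpr.eval, hu, hz', hT'.one_le_iff, ← le_antisymm_iff, Fin.ext_iff]
      · simp only [Test.Holds, NatExpr.eval]
        omega
      · rw [Memory.setNat_reals, h']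
        refine (h.min_cut Finset.inter_subset_left).mono ?_
        rintro L ⟨v, hv, rfl⟩ - -
        rcases Nat.lt_succ_iff_lt_or_eq.1 hv with hv | hv
        · exact Or.inr ⟨v, hv, rfl⟩
        · exact Or.inl (by rw [show v = ⟨j, hj⟩ from Fin.ext hv])
    · refine h.mono fun L _ hLT hL => ?_
      obtain ⟨x, rfl⟩ := Finset.card_eq_one.1 hL
      refine ⟨e.symm x, (e.symm x).2, ?_⟩
      rw [Equiv.apply_symm_apply, Finset.inter_eq_right.2 hLT]
  | remoteBipartition =>
    refine (Does.odometer (fun t s' => IsCutValue q (k / 2) T {L | ∃ t' < t, ∃ f : ℕ → ℕ,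
      (∀ i < m, f i = t' / (n + 1) ^ i % (n + 1)) ∧ L = T ∩ select e z cl f}
      (s'.reals rValue 0)) hs₁.points hs₁.digits (by decide) (by decide)
      (fun t s₂ s₃ h23 h => by rw [h23.2]; exact h) ⟨by simp, Or.inl hx₁⟩
      fun t ht s₂ h2 r2 hd h => ?_).mono fun s' _ _ h => ?_
    · have hs₂ : HoldsClusters e k ε z cl m s₂ := by
        refine hs₁.of_eq (fun a ha => ?_) (fun a ha => ?_) <;> fin_cases ha
        · exact h2 0 (by decide)
        · exact h2 1 (by decide)
        · exact h2 3 (by decide)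
        · exact h2 8 (by decide)
        · exact h2 9 (by decide)
        · exact h2 12 (by decide)
        · exact r2 0 (by decide)
        · exact r2 1 (by decide)
      have hT₂ := hT₁.of_eq (h2 15 (by decide))
      refine (does_tryCutCmd hs₂.toHoldsInput (L := T ∩ select e z cl (s₂.nats aSubquota))
        (h₀ := k / 2) hT₂ (fun u s' h3 r3 hu => ?_) fun s' h3 => ?_).mono fun s' _ _ h' => ?_
      · have hT' := hT₂.of_eq (h3 15 (by decide) (by decide))
        simp [Test.Holds, NatExpr.eval, hu, hT'.one_le_iff, h3 9 (by decide) (by decide),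
          h3 14 (by decide) (by decide), h3 8 (by decide) (by decide), hs₂.cluster, hs₂.rank,
          select]
      · simp only [Test.Holds, NatExpr.eval, h3, hs₂.size]
        omega
      · rw [h']
        refine (h.min_cut Finset.inter_subset_left).mono ?_
        rintro L ⟨t', ht', f, hf, rfl⟩ - -
        rcases Nat.lt_succ_iff_lt_or_eq.1 ht' with ht' | rfl
        · exact Or.inr ⟨t', ht', f, hf, rfl⟩
        · refine Or.inl ?_
          congr 1
          ext u
          simp only [select, Finset.mem_filter, Finset.mem_univ, true_and]
          rw [hf _ (hs₁.lt u), hd _ (hs₁.lt u)]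
    · refine h.mono ?_
      rintro L ⟨f, hf, rfl⟩ - -
      obtain ⟨t, ht, h⟩ := exists_digits (n + 1) m f fun i _ => Nat.lt_succ_of_le (hf i)
      exact ⟨t, ht, f, fun i hi => (h i hi).symm, rfl⟩

end

/-! ### The search for a solution -/

section

variable {X : Type} [PseudoMetricSpace X] {n k m K : ℕ} {e : Fin n ≃ X} {q ε : ℝ} {s : Memory}

theorem evalCmd_natWrites (P : Problem) :
    (evalCmd P).natWrites ⊆ [4, 5, 6, 14, 16, 17, 18, 21, 22] := by
  cases P <;> decide

theorem evalCmd_realWrites (P : Problem) : (evalCmd P).realWrites ⊆ [3, 5] := by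
  cases P <;> decide

/-- Choose the first points of the clusters according to the quotas. If their number is `k`,
evaluate the solution, and output it if it is better than those before. -/
def candidateCmd (P : Problem) : Cmd :=
  .seq (markCmd aChosen (.natLe (.add (.get aRank (reg iU)) (.lit 1))
    (.get aQuota (.get aCluster (reg iU))))) <|
  .seq (countCmd aChosen) <|
  .branch (.conj (.natLe (reg aCounter) (reg 1)) (.natLe (reg 1) (reg aCounter)))
    (.seq (evalCmd P) <| .branch (.realLe (.get rValue (.lit 0)) (.get rBest (.lit 0))) .skip <|
      .seq (.setReal rBest (.lit 0) (.get rValue (.lit 0))) outputCmd)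
    .skip

theorem candidateCmd_natWrites (P : Problem) :
    (candidateCmd P).natWrites ⊆ [2, 4, 5, 6, 14, 15, 16, 17, 18, 21, 22] := by
  cases P <;> decide

theorem candidateCmd_realWrites (P : Problem) : (candidateCmd P).realWrites ⊆ [3, 5, 6] := by
  cases P <;> decide

/-- Try all quotas for the numbers of points of the clusters. The value of the best solution starts
at `-1`, below the value of every solution. -/
def searchCmd (P : Problem) : Cmd :=
  .seq (.setReal rBest (.lit 0) (.sub (.ofNat (.lit 0)) (.ofNat (.lit 1)))) <|
  .odometer aQuota 19 20 (candidateCmd P)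

theorem crossSum_nonneg (q : ℝ) (A B : Finset X) : 0 ≤ crossSum q A B :=
  Finset.sum_nonneg fun _ _ => Finset.sum_nonneg fun _ _ => Real.rpow_nonneg dist_nonneg _

theorem IsCutValue.nonneg {h : ℕ} {T : Finset X} {F : Set (Finset X)} {v : ℝ}
    (hv : IsCutValue q h T F v) : 0 ≤ v := by
  rcases hv.2 with h | ⟨L, -, -, h⟩ <;> rw [h] <;> exact crossSum_nonneg _ _ _

theorem IsValue.nonneg [Fintype X] {z : X} {cl : X → ℕ} {P : Problem} {T : Finset X} {v : ℝ}
    (hv : IsValue q e k z cl P T v) : 0 ≤ v := by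
  cases P with
  | remoteClique => exact hv.ge.trans' (crossSum_nonneg _ _ _)
  | remoteStar => exact IsCutValue.nonneg hv
  | remoteBipartition => exact IsCutValue.nonneg hv

/-- The memory `s` holds in its output array a solution that is, in terms of the computed values, at
least as good as all those that consist of the first points of the clusters, provided that there are
any of these. -/
def HoldsBest [Fintype X] (q : ℝ) (e : Fin n ≃ X) (k : ℕ) (z : X) (cl : X → ℕ) (P : Problem)
    (s : Memory) : Prop :=
  (∃ f : ℕ → ℕ, (∀ i, f i ≤ n) ∧ (select e z cl f).card = k) →
    ∃ T : Finset X, ∃ v, Marks e s 2 T ∧ T.card = k ∧ IsValue q e k z cl P T v ∧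
      ∀ f : ℕ → ℕ, (∀ i, f i ≤ n) → (select e z cl f).card = k →
        ∃ v' ≤ v, IsValue q e k z cl P (select e z cl f) v'

theorem does_searchCmd [Fintype X] {z : X} {cl : X → ℕ} (hs : HoldsClusters e k ε z cl m s)
    (P : Problem) : Does q n m (searchCmd P) s (HoldsBest q e k z cl P) := by
  classical
  have hnw := evalCmd_natWrites P
  have hrw := evalCmd_realWrites P
  have hbw : ∀ a, a ∉ [2, 4, 5, 6, 14, 15, 16, 17, 18, 21, 22] →
      a ∉ (candidateCmd P).natWrites := fun a ha h => ha (candidateCmd_natWrites P h)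
  have hbr : ∀ a, a ∉ [3, 5, 6] → a ∉ (candidateCmd P).realWrites :=
    fun a ha h => ha (candidateCmd_realWrites P h)
  refine Does.seq (Does.setReal ?_)
  simp only [NatExpr.eval, RealExpr.eval]
  refine (Does.odometer (s := s.setReal rBest 0 (((0 : ℕ) : ℝ) - ((1 : ℕ) : ℝ)))
    (fun t s' =>
    (∀ t' < t, ∀ f : ℕ → ℕ, (∀ i < m, f i = t' / (n + 1) ^ i % (n + 1)) →
      (select e z cl f).card = k →
        ∃ v ≤ s'.reals rBest 0, IsValue q e k z cl P (select e z cl f) v) ∧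
    (s'.reals rBest 0 < 0 ∨ ∃ T : Finset X, Marks e s' 2 T ∧ T.card = k ∧
      IsValue q e k z cl P T (s'.reals rBest 0))) hs.points hs.digits (by decide)
      (fun b hb => ?_) (fun t s₂ s₃ h23 h => ?_) 
      ⟨fun t' ht' => absurd ht' (Nat.not_lt_zero _), Or.inl ?_⟩
      fun t ht s₂ h2 r2 hd h => ?_).mono fun s' _ _ h => ?_
  · refine hbw b ?_
    revert b
    decide
  · rw [h23.2]
    exact ⟨h.1, h.2.imp_right fun ⟨T, hT, hT'⟩ => ⟨T, hT.of_eq (h23.1 2 (by decide)), hT'⟩⟩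
  · simp
  · have hs₂ : HoldsClusters e k ε z cl m s₂ := by
      refine hs.of_eq (fun a ha => ?_) (fun a ha => ?_)
      · rw [h2 a, Memory.setReal_nats]
        have h' : a ∉ [aQuota, 19, 20] := by revert a; decide
        have h := hbw a (by clear h'; revert a; decide)
        simp only [List.mem_cons, List.not_mem_nil, or_false, not_or] at h' ⊢
        exact ⟨h'.1, h'.2.1, h'.2.2, h⟩
      · rw [r2 a (hbr a (by revert a; decide)), Memory.setReal_reals_ne]
        revert a
        decide
    refine Does.seq ((does_markCmd (e := e) (T := select e z cl (s₂.nats aQuota)) hs₂.points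
      (by decide) (by decide) fun u s' h3 r3 hu => ?_).mono fun s₃ h3 r3 hT => ?_)
    · simp [Test.Holds, NatExpr.eval, hu, h3 9 (by decide) (by decide),
        h3 13 (by decide) (by decide), h3 8 (by decide) (by decide), hs₂.cluster, hs₂.rank,
        select]
    simp only [markCmd, Cmd.natWrites, Cmd.realWrites] at h3 r3
    have hsel : ∀ f : ℕ → ℕ, (∀ i < m, f i = t / (n + 1) ^ i % (n + 1)) →
        select e z cl f = select e z cl (s₂.nats aQuota) := by
      intro f hf
      ext u
      simp only [select, Finset.mem_filter, Finset.mem_univ, true_and]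
      rw [hf _ (hs.lt u), hd _ (hs.lt u)]
    have hs₃ : HoldsClusters e k ε z cl m s₃ := by
      refine hs₂.of_eq (fun a ha => h3 a ?_) (fun a ha => r3 a ?_) <;> revert a <;> decide
    refine Does.seq ((does_countCmd (by decide) (by decide) hs₃.points hT).mono
      fun s₄ h4 r4 hc => ?_)
    have hs₄ : HoldsClusters e k ε z cl m s₄ := by
      refine hs₃.of_eq (fun a ha => h4 a ?_) (fun a ha => r4 a ?_) <;> revert a <;> decide
    have hT₄ := hT.of_eq (h4 15 (by decide))
    have hB₄ : s₄.reals rBest 0 = s₂.reals rBest 0 := by rw [r4 6 (by decide), r3 6 (by decide)]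
    have hO₄ : s₄.nats 2 = s₂.nats 2 := by rw [h4 2 (by decide), h3 2 (by decide)]
    refine Does.branch (fun hb => Does.seq ((does_evalCmd hs₄ P hT₄).mono
      fun s₅ h5 r5 hv => ?_)) (fun hb => Does.skip ?_) <;>
    simp only [Test.Holds, NatExpr.eval, hc, hs₄.size, ← le_antisymm_iff] at hb
    · have h5' : ∀ a, a ∉ [4, 5, 6, 14, 16, 17, 18, 21, 22] → s₅.nats a = s₄.nats a :=
        fun a ha => h5 a fun h => ha (hnw h)
      have r5' : ∀ a, a ∉ [3, 5] → s₅.reals a = s₄.reals a := fun a ha => r5 a fun h => ha (hrw h)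
      have hB₅ : s₅.reals rBest 0 = s₂.reals rBest 0 := by rw [r5' 6 (by decide), hB₄]
      refine Does.branch (fun hb' => Does.skip ⟨fun t' ht' f hf hcard => ?_, ?_⟩)
        (fun hb' => Does.seq (Does.setReal ((does_outputCmd (e := e)
          (T := select e z cl (s₂.nats aQuota)) ?_ ?_).mono fun s₆ h6 r6 hO =>
            ⟨fun t' ht' f hf hcard => ?_, Or.inr ?_⟩))) <;>
      simp only [Test.Holds, RealExpr.eval, NatExpr.eval, hB₅, not_le] at hb'
      · rw [hB₅]
        rcases Nat.lt_succ_iff_lt_or_eq.1 ht' with ht' | rfl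
        · exact h.1 t' ht' f hf hcard
        · exact ⟨_, hb', by rw [hsel f hf]; exact hv⟩
      · rw [hB₅]
        exact h.2.imp_right fun ⟨T, hT, hT'⟩ =>
          ⟨T, hT.of_eq (by rw [h5' 2 (by decide), hO₄]), hT'⟩
      · rw [Memory.setReal_nats, h5' 0 (by decide), hs₄.points]
      · exact hT₄.of_eq (h5' 15 (by decide))
      all_goals rw [r6 6 (by decide)]
      all_goals simp only [Memory.setReal_reals_same, NatExpr.eval, RealExpr.eval,
        Function.update_self]
      · rcases Nat.lt_succ_iff_lt_or_eq.1 ht' with ht' | rfl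
        · obtain ⟨v, hv', hv''⟩ := h.1 t' ht' f hf hcard
          exact ⟨v, hv'.trans hb'.le, hv''⟩
        · exact ⟨_, le_rfl, by rw [hsel f hf]; exact hv⟩
      · exact ⟨_, hO, hb, hv⟩
    · rw [hB₄]
      refine ⟨fun t' ht' f hf hcard => ?_, h.2.imp_right fun ⟨T, hT, hT'⟩ =>
        ⟨T, hT.of_eq hO₄, hT'⟩⟩
      rcases Nat.lt_succ_iff_lt_or_eq.1 ht' with ht' | rfl
      · exact h.1 t' ht' f hf hcard
      · exact absurd (by rw [← hsel f hf, hcard]) hb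
  · have hall : ∀ f : ℕ → ℕ, (∀ i, f i ≤ n) → (select e z cl f).card = k →
        ∃ v ≤ s'.reals rBest 0, IsValue q e k z cl P (select e z cl f) v := by
      intro f hf hcard
      obtain ⟨t, ht, h'⟩ := exists_digits (n + 1) m f fun i _ => Nat.lt_succ_of_le (hf i)
      exact h.1 t ht f (fun i hi => (h' i hi).symm) hcard
    rintro ⟨f, hf, hcard⟩
    rcases h.2 with h' | ⟨T, hT, hTk, hv⟩
    · obtain ⟨v, hv, hv'⟩ := hall f hf hcard
      exact absurd (hv'.nonneg.trans hv) (not_le.2 h')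
    · exact ⟨T, _, hT, hTk, hv, hall⟩

/-! ### The complete program -/

/-- Compute the center, the clusters and the ranks. -/
def prepareCmd (K : ℕ) : Cmd :=
  .seq rowsCmd <| .seq (constCmd K) <| .seq centerCmd <| .seq clusterCmd <|
  .seq (.setNat iZ (.lit 0) (reg aCenter)) <| .seq rankCmd <|
  .setNat aDigits (.lit 0) (reg aClusters)

theorem topSum_nonneg [Fintype X] (z : X) : 0 ≤ topSum q e k z :=
  Finset.sum_nonneg fun _ _ => by
    split_ifs
    · exact Real.rpow_nonneg dist_nonneg _
    · exact le_rfl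

theorem does_prepareCmd [Fintype X] (e : Fin n ≃ X) (k K : ℕ) (hn : 0 < n) (hq : 0 < q)
    (hε : 0 < ε) :
    Does q n m (prepareCmd K) (inputMemory e k ε) fun s' => ∃ (z : X) (cl : X → ℕ) (N : ℕ),
      HoldsClusters e k ε z cl N s' ∧ IsClustering q k (farFactor q (accuracy K ε))
        (closeFactor q K (accuracy K ε)) (topSum q e k z) z cl N ∧
      ∀ z', topSum q e k z ≤ topSum q e k z' := by
  have hθ : 0 ≤ accuracy K ε := by unfold accuracy; positivity
  have hξ : 0 ≤ closeFactor q K (accuracy K ε) := by unfold closeFactor blowup; positivity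
  refine Does.seq ((does_rowsCmd ε).mono fun s₁ h1 r1 hs₁ => ?_)
  refine Does.seq ((does_constCmd hs₁ hε).mono fun s₂ h2 r2 hc => ?_)
  simp only [constCmd, Cmd.natWrites, Cmd.realWrites] at h2 r2
  have hs₂ : HoldsInput e k ε s₂ := hs₁.of_eq (h2 0 (by decide)) (h2 1 (by decide))
    (h2 3 (by decide)) (r2 0 (by decide)) (r2 1 (by decide))
  refine Does.seq ((does_centerCmd hs₂ hn fun i => ?_).mono fun s₃ h3 r3 hy => ?_)
  · rw [h2 8 (by decide), h1 8 (by decide)]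
    simp [inputMemory]
  obtain ⟨y, hy, hM, hmin⟩ := hy
  have hs₃ : HoldsInput e k ε s₃ := hs₂.of_eq (h3 0 (by decide)) (h3 1 (by decide))
    (h3 3 (by decide)) (r3 0 (by decide)) (r3 1 (by decide))
  refine Does.seq ((does_clusterCmd hs₃ hy hq (by rw [r3 4 (by decide), hc.1])
    (by rw [r3 4 (by decide), hc.2]) hM hξ (topSum_nonneg _)).mono fun s₄ h4 r4 hcl => ?_)
  obtain ⟨cl, N, hN, hcl, hC⟩ := hcl
  have hs₄ : HoldsInput e k ε s₄ := hs₃.of_eq (h4 0 (by decide)) (h4 1 (by decide))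
    (h4 3 (by decide)) (r4 0 (by decide)) (r4 1 (by decide))
  refine Does.seq (Does.setNat ?_)
  simp only [NatExpr.eval, h4 7 (by decide), hy]
  have hs₅ : HoldsInput e k ε (s₄.setNat iZ 0 y) := hs₄.of_eq
    (Memory.setNat_nats_ne _ _ _ (by decide)) (Memory.setNat_nats_ne _ _ _ (by decide))
    (Memory.setNat_nats_ne _ _ _ (by decide)) rfl rfl
  refine Does.seq ((does_rankCmd hs₅ (z := y) (cl := cl) (by simp) fun u => ?_).mono
    fun s₆ h6 r6 hr => Does.setNat ⟨e y, cl, N, ?_, hC, hmin⟩)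
  · rw [Memory.setNat_nats_ne _ _ _ (by decide), hcl]
  have hs₆ : HoldsInput e k ε s₆ := hs₅.of_eq (h6 0 (by decide)) (h6 1 (by decide))
    (h6 3 (by decide)) (r6 0 (by decide)) (r6 1 (by decide))
  refine ⟨hs₆.of_eq (Memory.setNat_nats_ne _ _ _ (by decide))
    (Memory.setNat_nats_ne _ _ _ (by decide)) (Memory.setNat_nats_ne _ _ _ (by decide)) rfl rfl,
    fun u => ?_, fun u => ?_, ?_, hC.lt⟩
  · rw [Memory.setNat_nats_ne _ _ _ (by decide), h6 8 (by decide),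
      Memory.setNat_nats_ne _ _ _ (by decide), ← hcl]
    simp
  · rw [Memory.setNat_nats_ne _ _ _ (by decide), ← hr]
    simp
  · simp only [NatExpr.eval, h6 10 (by decide), Memory.setNat_nats_same, Function.update_self]
    rw [Memory.setNat_nats_ne _ _ _ (by decide), hN]

/-- The program of the approximation scheme. -/
def schemeProgram (K : ℕ) (P : Problem) : Program :=
  .seq (prepareCmd K).compile (searchCmd P).compile

theorem halts_schemeProgram [Fintype X] (e : Fin n ≃ X) (k K : ℕ) (P : Problem) (hn : 0 < n)
    (hq : 0 < q) (hε : 0 < ε) :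
    ∃ (z : X) (cl : X → ℕ) (N : ℕ),
      IsClustering q k (farFactor q (accuracy K ε)) (closeFactor q K (accuracy K ε))
        (topSum q e k z) z cl N ∧
      (∀ z', topSum q e k z ≤ topSum q e k z') ∧
      Halts q (schemeProgram K P) (inputMemory e k ε)
        ((prepareCmd K).cost n 0 + (searchCmd P).cost n N) (HoldsBest q e k z cl P) := by
  obtain ⟨t, s, hr, ht, -, z, cl, N, hs, hC, hmin⟩ := does_prepareCmd (m := 0) e k K hn hq hε
  obtain ⟨t', s', hr', ht', -, hb⟩ := does_searchCmd (q := q) hs P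
  exact ⟨z, cl, N, hC, hmin, _, _, hr.seq hr', add_le_add ht ht', hb⟩

end

/-! ### Powers of distances -/

section

variable {X : Type} [PseudoMetricSpace X] {n k K : ℕ} {e : Fin n ≃ X} {q θ : ℝ}

theorem blowup_nonneg (hθ : 0 < θ) : 0 ≤ blowup q θ := by
  unfold blowup
  positivity

theorem one_le_blowup (hq : 1 ≤ q) (hθ : 0 < θ) : 1 ≤ blowup q θ := by
  unfold blowup
  refine Real.one_le_rpow ?_ (by linarith)
  have : 0 < 1 / θ := by positivity
  linarith

/-- If `y` is small compared with `x`, then `(x + y) ^ q` is close to `x ^ q`; otherwise it is at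
most a multiple of `y ^ q`. -/
theorem add_rpow_le_blowup (hq : 1 ≤ q) (hK : (2 : ℝ) ^ q ≤ K) (hθ : 0 < θ) (hθ1 : θ ≤ 1)
    {x y : ℝ} (hx : 0 ≤ x) (hy : 0 ≤ y) :
    (x + y) ^ q ≤ (1 + K * θ) * x ^ q + blowup q θ * y ^ q := by
  have hq0 : 0 ≤ q := by linarith
  have hxq : 0 ≤ x ^ q := Real.rpow_nonneg hx q
  have hyq : 0 ≤ y ^ q := Real.rpow_nonneg hy q
  have hb := blowup_nonneg (q := q) hθ
  rcases le_or_gt y (θ * x) with h | h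
  · have h1 : (1 + θ) ^ q ≤ 1 + K * θ := by
      have := (convexOn_rpow hq).2 (Set.mem_Ici.2 (zero_le_one (α := ℝ)))
        (Set.mem_Ici.2 (zero_le_two (α := ℝ))) (by linarith : 0 ≤ 1 - θ) hθ.le (by ring)
      simp only [smul_eq_mul, mul_one, Real.one_rpow] at this
      rw [show 1 - θ + θ * 2 = 1 + θ by ring] at this
      nlinarith
    calc (x + y) ^ q ≤ ((1 + θ) * x) ^ q := Real.rpow_le_rpow (by positivity) (by linarith) hq0
      _ = (1 + θ) ^ q * x ^ q := Real.mul_rpow (by positivity) hx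
      _ ≤ (1 + K * θ) * x ^ q := by gcongr
      _ ≤ _ := by linarith [mul_nonneg hb hyq]
  · have h2 : x ≤ 1 / θ * y := by
      rw [one_div, ← div_eq_inv_mul, le_div_iff₀ hθ]
      linarith
    calc (x + y) ^ q ≤ ((1 + 1 / θ) * y) ^ q :=
          Real.rpow_le_rpow (by positivity) (by linarith) hq0
      _ = blowup q θ * y ^ q := Real.mul_rpow (by positivity) hy
      _ ≤ _ := by
        have : 0 ≤ (1 + K * θ) * x ^ q := by positivity
        linarith

theorem add_rpow_le (hq : 0 ≤ q) (hK : (2 : ℝ) ^ q ≤ K) {x y : ℝ} (hx : 0 ≤ x) (hy : 0 ≤ y) :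
    (x + y) ^ q ≤ K * (x ^ q + y ^ q) := by
  have hxq : 0 ≤ x ^ q := Real.rpow_nonneg hx q
  have hyq : 0 ≤ y ^ q := Real.rpow_nonneg hy q
  wlog h : x ≤ y generalizing x y
  · rw [add_comm, add_comm (x ^ q)]
    exact this hy hx hyq hxq (not_le.1 h).le
  calc (x + y) ^ q ≤ (2 * y) ^ q := Real.rpow_le_rpow (by positivity) (by linarith) hq
    _ = 2 ^ q * y ^ q := Real.mul_rpow (by norm_num) hy
    _ ≤ K * y ^ q := by gcongr
    _ ≤ _ := by
      gcongr
      linarith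

theorem dist_rpow_triangle (hq : 0 ≤ q) (hK : (2 : ℝ) ^ q ≤ K) (u v w : X) :
    dist u w ^ q ≤ K * (dist u v ^ q + dist v w ^ q) :=
  (Real.rpow_le_rpow dist_nonneg (dist_triangle u v w) hq).trans
    (add_rpow_le hq hK dist_nonneg dist_nonneg)

theorem dist_rpow_nonneg (q : ℝ) (u v : X) : 0 ≤ dist u v ^ q := Real.rpow_nonneg dist_nonneg q

theorem dist_rpow_self (hq : 0 < q) (u : X) : dist u u ^ q = 0 := by
  rw [dist_self, Real.zero_rpow hq.ne']

theorem two_le_of_rpow_le (hq : 1 ≤ q) (hK : (2 : ℝ) ^ q ≤ K) : (2 : ℝ) ≤ K :=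
  hK.trans' (by simpa using Real.rpow_le_rpow_of_exponent_le (x := 2) (by norm_num) hq)

/-! ### The scale of the problem -/

theorem crossSum_comm (q : ℝ) (A B : Finset X) : crossSum q A B = crossSum q B A := by
  unfold crossSum
  rw [Finset.sum_comm]
  simp only [dist_comm]

theorem crossSum_self_insert [DecidableEq X] (hq : 0 < q) {S : Finset X} {x : X} (hx : x ∉ S) :
    crossSum q (insert x S) (insert x S) = crossSum q S S + 2 * ∑ u ∈ S, dist x u ^ q := by
  have : ∀ u, ∑ v ∈ insert x S, dist u v ^ q = dist u x ^ q + ∑ v ∈ S, dist u v ^ q :=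
    fun u => Finset.sum_insert hx
  simp only [crossSum, this, Finset.sum_insert hx, dist_rpow_self hq, Finset.sum_add_distrib,
    fun u => dist_comm u x]
  ring

/-- Exchanging a point of a set `S` of largest total distance for a point `x` outside does not
increase the total distance. Averaged over the points of `S`, this bounds the distances of `x`
from `S`. -/
theorem sum_dist_le_of_isMax (hq : 0 < q) (hk : 2 ≤ k) {S : Finset X} (hS : S.card = k)
    (hmax : ∀ T : Finset X, T.card = k → crossSum q T T ≤ crossSum q S S) {x : X} (hx : x ∉ S) :
    k * ∑ u ∈ S, dist x u ^ q ≤ 2 * crossSum q S S := by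
  classical
  have h1 : ∀ w ∈ S, ∑ u ∈ S, dist x u ^ q ≤ ∑ u ∈ S, dist w u ^ q + dist x w ^ q := by
    intro w hw
    have hwS := Finset.insert_erase hw
    have hx' : x ∉ S.erase w := fun h => hx (Finset.mem_of_mem_erase h)
    have h := hmax (insert x (S.erase w)) (by
      rw [Finset.card_insert_of_notMem hx', Finset.card_erase_of_mem hw, hS]
      omega)
    conv_rhs at h => rw [← hwS]
    rw [crossSum_self_insert hq hx', crossSum_self_insert hq (Finset.notMem_erase w S)] at h
    rw [← Finset.add_sum_erase S _ hw, ← Finset.add_sum_erase S (fun u => dist w u ^ q) hw,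
      dist_rpow_self hq]
    linarith
  have h2 := Finset.sum_le_sum h1
  rw [Finset.sum_const, nsmul_eq_mul, hS, Finset.sum_add_distrib] at h2
  have hk' : (2 : ℝ) ≤ k := by exact_mod_cast hk
  have h3 : 0 ≤ ∑ u ∈ S, dist x u ^ q := Finset.sum_nonneg fun u _ => dist_rpow_nonneg q x u
  unfold crossSum
  nlinarith

/-- Some point of a set `S` of largest total distance is such that no `k` points are much farther
from it, on average, than the points of `S` from each other. -/
theorem exists_center (hq : 1 ≤ q) (hK : (2 : ℝ) ^ q ≤ K) (hk : 2 ≤ k) {S : Finset X}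
    (hS : S.card = k) (hmax : ∀ T : Finset X, T.card = k → crossSum q T T ≤ crossSum q S S) :
    ∃ z, ∀ T : Finset X, T.card = k →
      k * ∑ x ∈ T, dist z x ^ q ≤ 4 * K * crossSum q S S := by
  classical
  have hq0 : 0 < q := by linarith
  have hk0 : (0 : ℝ) < k := by exact_mod_cast (by omega : 0 < k)
  have hK2 := two_le_of_rpow_le hq hK
  obtain ⟨z, hzS, hz⟩ : ∃ z ∈ S, k * ∑ u ∈ S, dist z u ^ q ≤ crossSum q S S := by
    have : S.Nonempty := Finset.card_pos.1 (by omega)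
    refine Finset.exists_le_of_sum_le this (f := fun z => k * ∑ u ∈ S, dist z u ^ q)
      (g := fun _ => crossSum q S S) ?_
    rw [← Finset.mul_sum, Finset.sum_const, hS, nsmul_eq_mul]
    rfl
  have hG := crossSum_nonneg q S S
  refine ⟨z, fun T hT => ?_⟩
  -- a point outside `S` is reached from `z` by way of the points of `S`
  have hx : ∀ x ∈ T \ S, k * (k * dist z x ^ q) ≤ 3 * K * crossSum q S S := by
    intro x hx
    have h1 := sum_dist_le_of_isMax hq0 hk hS hmax (Finset.mem_sdiff.1 hx).2
    have h2 : k * dist z x ^ q ≤ K * (∑ u ∈ S, dist z u ^ q + ∑ u ∈ S, dist x u ^ q) := by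
      rw [← Finset.sum_add_distrib, Finset.mul_sum, ← nsmul_eq_mul, ← hS, ← Finset.sum_const]
      refine Finset.sum_le_sum fun u _ => ?_
      rw [dist_comm x u]
      exact dist_rpow_triangle hq0.le hK z u x
    calc k * (k * dist z x ^ q) ≤ k * (K * (∑ u ∈ S, dist z u ^ q + ∑ u ∈ S, dist x u ^ q)) := by
          gcongr
      _ = K * (k * ∑ u ∈ S, dist z u ^ q + k * ∑ u ∈ S, dist x u ^ q) := by ring
      _ ≤ K * (crossSum q S S + 2 * crossSum q S S) := by gcongr
      _ = _ := by ring
  have h1 : k * ∑ x ∈ T \ S, dist z x ^ q ≤ 3 * K * crossSum q S S := by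
    have h2 := Finset.sum_le_sum hx
    rw [← Finset.mul_sum, ← Finset.mul_sum, Finset.sum_const, nsmul_eq_mul] at h2
    have h3 : ((T \ S).card : ℝ) ≤ k := by
      exact_mod_cast (Finset.card_le_card Finset.sdiff_subset).trans hT.le
    refine le_of_mul_le_mul_left (h2.trans ?_) hk0
    gcongr
  have h2 : k * ∑ x ∈ T ∩ S, dist z x ^ q ≤ crossSum q S S := by
    refine le_trans (mul_le_mul_of_nonneg_left ?_ hk0.le) hz
    exact Finset.sum_le_sum_of_subset_of_nonneg Finset.inter_subset_right
      fun u _ _ => dist_rpow_nonneg q z u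
  rw [← Finset.sum_inter_add_sum_sdiff T S, mul_add]
  nlinarith

/-- The distances inside `A`, estimated by detours through all points of `B`. -/
theorem card_mul_crossSum_self_le (hq : 0 ≤ q) (hK : (2 : ℝ) ^ q ≤ K) (A B : Finset X) :
    B.card * crossSum q A A ≤ 2 * K * A.card * crossSum q A B := by
  have h1 : ∀ u ∈ A, ∀ v ∈ A, B.card * dist u v ^ q ≤
      K * (∑ w ∈ B, dist u w ^ q + ∑ w ∈ B, dist v w ^ q) := by
    intro u _ v _
    rw [← Finset.sum_add_distrib, Finset.mul_sum, ← nsmul_eq_mul, ← Finset.sum_const]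
    refine Finset.sum_le_sum fun w _ => ?_
    rw [dist_comm v w]
    exact dist_rpow_triangle hq hK u w v
  have h2 := Finset.sum_le_sum fun u hu => Finset.sum_le_sum (h1 u hu)
  simp only [← Finset.mul_sum, Finset.sum_add_distrib, Finset.sum_const, nsmul_eq_mul] at h2
  unfold crossSum
  linarith

theorem cut_nonneg (q : ℝ) (T L : Finset X) : 0 ≤ cut q T L := crossSum_nonneg _ _ _

theorem crossSum_self_eq [DecidableEq X] {T L : Finset X} (hL : L ⊆ T) :
    crossSum q T T = crossSum q L L + 2 * crossSum q L (T \ L) +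
      crossSum q (T \ L) (T \ L) := by
  have h : ∀ f : X → ℝ, ∑ u ∈ T, f u = ∑ u ∈ L, f u + ∑ u ∈ T \ L, f u := fun f => by
    rw [add_comm, Finset.sum_sdiff hL]
  have h' := crossSum_comm q (T \ L) L
  simp only [crossSum, h, Finset.sum_add_distrib] at h' ⊢
  rw [h']
  ring

/-- A lower bound for balanced and unbalanced cuts in terms of the sum of all distances. -/
theorem card_mul_crossSum_le_cut (hq : 1 ≤ q) (hK : (2 : ℝ) ^ q ≤ K) {h : ℕ} {T L : Finset X}
    (hT : T.card = k) (hLT : L ⊆ T) (hL : L.card = h) (hhk : 2 * h ≤ k) :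
    h * crossSum q T T ≤ 4 * K * k * cut q T L := by
  classical
  have hK2 := two_le_of_rpow_le hq hK
  have hX := cut_nonneg q T L
  have hcard : (((T \ L).card : ℕ) : ℝ) = k - h := by
    rw [Finset.card_sdiff_of_subset hLT, hT, hL, Nat.cast_sub (by omega)]
  have hhk' : 2 * (h : ℝ) ≤ k := by exact_mod_cast hhk
  have h1 := card_mul_crossSum_self_le (by linarith) hK L (T \ L)
  have h2 := card_mul_crossSum_self_le (by linarith) hK (T \ L) L
  rw [crossSum_comm q (T \ L) L] at h2
  rw [hcard, hL] at h1 h2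
  have h3 := crossSum_self_eq (q := q) hLT
  have h4 : cut q T L = crossSum q L (T \ L) := by unfold cut; congr!
  rw [← h4] at h1 h2 h3
  have h5 := crossSum_nonneg q L L
  have h6 : (0 : ℝ) ≤ h := by positivity
  rw [h3]
  have h7 : h * crossSum q L L ≤ 2 * K * h * cut q T L := by
    refine le_trans ?_ h1
    gcongr
    linarith
  have h8 : 0 ≤ (k - 2 * h : ℝ) * cut q T L := mul_nonneg (by linarith) hX
  have h9 : 0 ≤ (K - 2 : ℝ) * (k * cut q T L) := mul_nonneg (by linarith) (by positivity)
  nlinarith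

/-! ### Ranks -/

/-- In a finite linear order, there are exactly `c` elements with fewer than `c` predecessors. -/
theorem card_filter_rank_lt {α : Type*} (A : Finset α) (r : α → α → Prop) [DecidableRel r]
    (irrefl : ∀ u, ¬ r u u) (trans : ∀ u v w, r u v → r v w → r u w)
    (total : ∀ u v, r u v ∨ u = v ∨ r v u) {c : ℕ} (hc : c ≤ A.card) :
    (A.filter fun u => (A.filter fun y => r y u).card < c).card = c := by
  classical
  set ρ : α → ℕ := fun u => (A.filter fun y => r y u).card with hρ
  have hlt : ∀ u ∈ A, ∀ v ∈ A, r u v → ρ u < ρ v := by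
    intro u hu v _ huv
    refine Finset.card_lt_card ⟨fun y hy => ?_, fun h => ?_⟩
    · rw [Finset.mem_filter] at hy ⊢
      exact ⟨hy.1, trans _ _ _ hy.2 huv⟩
    · exact irrefl u (Finset.mem_filter.1 (h (Finset.mem_filter.2 ⟨hu, huv⟩))).2
  have hinj : Set.InjOn ρ A := by
    intro u hu v hv huv
    rcases total u v with h | h | h
    · exact absurd huv (hlt u hu v hv h).ne
    · exact h
    · exact absurd huv (hlt v hv u hu h).ne'
  have himage : A.image ρ = Finset.range A.card := by
    refine Finset.eq_of_subset_of_card_le (fun i hi => ?_) ?_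
    · obtain ⟨u, hu, rfl⟩ := Finset.mem_image.1 hi
      rw [Finset.mem_range]
      refine Finset.card_lt_card ⟨Finset.filter_subset _ _, fun h => ?_⟩
      exact irrefl u (Finset.mem_filter.1 (h hu)).2
    · rw [Finset.card_range, Finset.card_image_of_injOn hinj]
  have h1 : (A.filter fun u => ρ u < c).image ρ = Finset.range c := by
    ext i
    simp only [Finset.mem_image, Finset.mem_filter, Finset.mem_range]
    constructor
    · rintro ⟨u, ⟨-, h⟩, rfl⟩
      exact h
    · intro hi
      have : i ∈ A.image ρ := by rw [himage, Finset.mem_range]; omega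
      obtain ⟨u, hu, rfl⟩ := Finset.mem_image.1 this
      exact ⟨u, ⟨hu, hi⟩, rfl⟩
  rw [← Finset.card_image_of_injOn (hinj.mono (Finset.coe_subset.2 (Finset.filter_subset _ _))),
    h1, Finset.card_range]

theorem Before.irrefl (z u : X) : ¬ Before e z u u := fun h => h.2 ⟨le_rfl, le_rfl⟩

theorem Before.trans {z u v w : X} (h : Before e z u v) (h' : Before e z v w) :
    Before e z u w := by
  refine ⟨h'.1.trans h.1, fun ⟨h1, h2⟩ => ?_⟩
  have h3 : dist z u ≤ dist z v := h1.trans h'.1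
  have h4 : dist z v ≤ dist z w := h.1.trans h1
  have h5 := fun h6 => h.2 ⟨h3, h6⟩
  have h6 := fun h7 => h'.2 ⟨h4, h7⟩
  exact absurd h2 (not_le.2 ((not_le.1 h5).trans (not_le.1 h6)))

theorem Before.total (z u v : X) : Before e z u v ∨ u = v ∨ Before e z v u := by
  by_cases h : u = v
  · exact Or.inr (Or.inl h)
  have hne : e.symm u ≠ e.symm v := fun h' => h (e.symm.injective h')
  rcases lt_trichotomy (dist z u) (dist z v) with h1 | h1 | h1
  · exact Or.inr (Or.inr ⟨h1.le, fun h2 => absurd h2.1 (not_le.2 h1)⟩)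
  · rcases lt_or_gt_of_ne hne with h2 | h2
    · exact Or.inl ⟨h1.ge, fun h3 => absurd h3.2 (not_le.2 h2)⟩
    · exact Or.inr (Or.inr ⟨h1.le, fun h3 => absurd h3.2 (not_le.2 h2)⟩)
  · exact Or.inl ⟨h1.le, fun h2 => absurd h2.1 (not_le.2 h1)⟩

open Classical in
/-- The number of points of the cluster `i` in the set `S`. -/
def clusterCount {X : Type} (cl : X → ℕ) (S : Finset X) (i : ℕ) : ℕ :=
  (S.filter fun u => cl u = i).card

theorem clusterCount_mono {X : Type} (cl : X → ℕ) {S T : Finset X} (h : S ⊆ T) (i : ℕ) :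
    clusterCount cl S i ≤ clusterCount cl T i :=
  Finset.card_le_card (Finset.filter_subset_filter _ h)

theorem clusterCount_sdiff {X : Type} [DecidableEq X] (cl : X → ℕ) (A B : Finset X) (i : ℕ) :
    clusterCount cl (A \ B) i + clusterCount cl (A ∩ B) i = clusterCount cl A i := by
  classical
  unfold clusterCount
  rw [← Finset.card_union_of_disjoint, ← Finset.filter_union, Finset.sdiff_union_inter]
  exact Finset.disjoint_filter_filter (Finset.disjoint_sdiff_inter A B)

theorem image_eq_of_injOn {X : Type} [DecidableEq X] {σ : X → X} {A B : Finset X}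
    (hinj : Set.InjOn σ A) (hσ : ∀ u ∈ A, σ u ∈ B) (hcard : B.card ≤ A.card) : A.image σ = B :=
  Finset.eq_of_subset_of_card_le (Finset.image_subset_iff.2 hσ)
    (by rwa [Finset.card_image_of_injOn hinj])

theorem card_eq_sum_clusterCount {X : Type} [Fintype X] (cl : X → ℕ) (S : Finset X) :
    S.card = ∑ i ∈ Finset.univ.image cl, clusterCount cl S i := by
  classical
  exact Finset.card_eq_sum_card_fiberwise fun u _ => Finset.mem_image_of_mem _ (Finset.mem_univ u)

theorem card_eq_of_clusterCount {X : Type} [Fintype X] {cl : X → ℕ} {A B : Finset X}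
    (h : ∀ i, clusterCount cl A i = clusterCount cl B i) : A.card = B.card := by
  rw [card_eq_sum_clusterCount cl, card_eq_sum_clusterCount cl B]
  exact Finset.sum_congr rfl fun i _ => h i

variable [Fintype X]

theorem mem_select {z : X} {cl : X → ℕ} {f : ℕ → ℕ} {u : X} :
    u ∈ select e z cl f ↔ rank e z cl u < f (cl u) := by
  simp [select]

theorem clusterCount_select (z : X) (cl : X → ℕ) (f : ℕ → ℕ) (i : ℕ)
    (hf : f i ≤ clusterCount cl Finset.univ i) :
    clusterCount cl (select e z cl f) i = f i := by
  classical
  have := card_filter_rank_lt (Finset.univ.filter fun u => cl u = i) (Before e z)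
    (Before.irrefl z) (fun _ _ _ => Before.trans) (Before.total z) (c := f i)
    (by unfold clusterCount at hf; convert hf)
  rw [← this, clusterCount]
  congr 1
  ext u
  simp only [mem_select, Finset.mem_filter, Finset.mem_univ, true_and, Finset.filter_filter]
  have hrank : rank e z cl u = (Finset.univ.filter fun y => cl y = cl u ∧ Before e z y u).card := by
    unfold rank
    congr!
  rw [hrank]
  constructor
  · rintro ⟨h, rfl⟩
    exact ⟨rfl, h⟩
  · rintro ⟨rfl, h⟩
    exact ⟨h, rfl⟩

theorem rank_lt_of_before {z : X} {cl : X → ℕ} {u v : X} (hcl : cl u = cl v)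
    (h : Before e z u v) : rank e z cl u < rank e z cl v := by
  classical
  unfold rank
  refine Finset.card_lt_card ⟨fun y hy => ?_, fun h' => ?_⟩
  · simp only [Finset.mem_filter] at hy ⊢
    exact ⟨hy.1, hy.2.1.trans hcl, hy.2.2.trans h⟩
  · have h1 := h' (Finset.mem_filter.2 ⟨Finset.mem_univ u, hcl, h⟩)
    exact Before.irrefl z u (Finset.mem_filter.1 h1).2.2

theorem rank_lt_card (z : X) (cl : X → ℕ) (u : X) : rank e z cl u < Fintype.card X := by
  classical
  unfold rank
  rw [← Finset.card_univ]
  refine Finset.card_lt_card ⟨Finset.filter_subset _ _, fun h => ?_⟩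
  exact Before.irrefl z u (Finset.mem_filter.1 (h (Finset.mem_univ u))).2.2

theorem eq_of_rank_eq {z : X} {cl : X → ℕ} {u v : X} (hcl : cl u = cl v)
    (h : rank e z cl u = rank e z cl v) : u = v := by
  rcases Before.total (e := e) z u v with h' | h' | h'
  · exact absurd h (rank_lt_of_before hcl h').ne
  · exact h'
  · exact absurd h (rank_lt_of_before hcl.symm h').ne'

theorem dist_le_of_rank_lt {z : X} {cl : X → ℕ} {u v : X} (hcl : cl u = cl v)
    (h : rank e z cl u < rank e z cl v) : dist z v ≤ dist z u := by
  rcases Before.total (e := e) z u v with h' | rfl | h'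
  · exact h'.1
  · exact le_rfl
  · exact absurd (rank_lt_of_before hcl.symm h') h.le.not_gt

/-! ### Matchings between sets with the same numbers of points in each cluster -/

theorem exists_bijection {X : Type} (cl : X → ℕ) {A B : Finset X}
    (h : ∀ i, clusterCount cl A i = clusterCount cl B i) :
    ∃ σ : X → X, Set.InjOn σ A ∧ (∀ u ∈ A, σ u ∈ B) ∧ ∀ u ∈ A, cl (σ u) = cl u := by
  classical
  have h' : ∀ i, Nonempty ({a : A // cl a = i} ≃ {b : B // cl b = i}) := by
    intro i
    rw [← Fintype.card_eq]
    have hc : ∀ S : Finset X, Fintype.card {a : S // cl a = i} = clusterCount cl S i := by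
      intro S
      rw [Fintype.card_subtype, clusterCount]
      have : S.filter (fun u => cl u = i) = (Finset.univ.filter
          fun a : S => cl a = i).map (Function.Embedding.subtype _) := by
        ext u
        simp [and_comm]
      rw [this, Finset.card_map]
    rw [hc, hc, h]
  let g : A ≃ B := Equiv.ofFiberEquiv (f := fun a : A => cl a) (g := fun b : B => cl b)
    fun i => (h' i).some
  have hg : ∀ a : A, cl (g a) = cl a := fun a =>
    Equiv.ofFiberEquiv_map (f := fun a : A => cl a) (g := fun b : B => cl b) _ a
  refine ⟨fun u => if hu : u ∈ A then g ⟨u, hu⟩ else u, fun u hu v hv huv => ?_,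
    fun u hu => ?_, fun u hu => ?_⟩
  · simp only [dif_pos (show u ∈ A from hu), dif_pos (show v ∈ A from hv)] at huv
    exact congrArg Subtype.val (g.injective (Subtype.ext huv))
  · simp only [dif_pos hu]
    exact (g ⟨u, hu⟩).2
  · simp only [dif_pos hu]
    exact hg ⟨u, hu⟩

/-- The points of a set can be moved injectively to the first points of the clusters without
decreasing the distance from the center. -/
theorem exists_matching {z : X} {cl : X → ℕ} {f : ℕ → ℕ} {S : Finset X}
    (h : ∀ i, clusterCount cl S i = clusterCount cl (select e z cl f) i) :
    ∃ σ : X → X, Set.InjOn σ S ∧ (∀ u ∈ S, σ u ∈ select e z cl f) ∧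
      (∀ u ∈ S, cl (σ u) = cl u) ∧ ∀ u ∈ S, dist z u ≤ dist z (σ u) := by
  classical
  set T := select e z cl f with hT
  -- common points stay; the others move to points that come earlier in their clusters
  obtain ⟨τ, hτ, hτT, hτc⟩ := exists_bijection cl (A := S \ T) (B := T \ S) fun i => by
    have h1 := clusterCount_sdiff cl S T i
    have h2 := clusterCount_sdiff cl T S i
    rw [Finset.inter_comm T S] at h2
    have := h i
    omega
  have hmem : ∀ u ∈ S, u ∉ T → τ u ∈ T ∧ τ u ∉ S ∧ cl (τ u) = cl u := fun u hu hu' => by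
    have h1 : u ∈ S \ T := Finset.mem_sdiff.2 ⟨hu, hu'⟩
    exact ⟨(Finset.mem_sdiff.1 (hτT u h1)).1, (Finset.mem_sdiff.1 (hτT u h1)).2, hτc u h1⟩
  refine ⟨fun u => if u ∈ T then u else τ u, ?_, ?_, ?_, ?_⟩
  · intro u hu v hv huv
    have hu : u ∈ S := hu
    have hv : v ∈ S := hv
    simp only at huv
    split_ifs at huv with h1 h2 h2
    · exact huv
    · exact absurd (huv ▸ hu) (hmem v hv h2).2.1
    · exact absurd (huv ▸ hv) (hmem u hu h1).2.1
    · exact hτ (by simpa using ⟨hu, h1⟩) (by simpa using ⟨hv, h2⟩) huv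
  · intro u hu
    simp only
    split_ifs with h1
    · exact h1
    · exact (hmem u hu h1).1
  · intro u hu
    simp only
    split_ifs with h1
    · rfl
    · exact (hmem u hu h1).2.2
  · intro u hu
    simp only
    split_ifs with h1
    · exact le_rfl
    · obtain ⟨h2, -, h3⟩ := hmem u hu h1
      simp only [hT, mem_select, not_lt] at h1 h2
      rw [h3] at h2
      exact dist_le_of_rank_lt h3 (h2.trans_le h1)

theorem topSum_eq (z : X) :
    topSum q e k z = ∑ u ∈ select e z (fun _ => 0) (fun _ => k), dist z u ^ q := by
  rw [topSum, select, Finset.sum_filter]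

theorem card_select_const (hk : k ≤ Fintype.card X) (z : X) :
    (select e z (fun _ => 0) (fun _ => k)).card = k := by
  have := clusterCount_select (e := e) z (fun _ => 0) (fun _ => k) 0
    (by simpa [clusterCount] using hk)
  simpa [clusterCount] using this

theorem sum_dist_le_topSum (hq : 0 ≤ q) {T : Finset X} (hT : T.card = k) (z : X) :
    ∑ u ∈ T, dist z u ^ q ≤ topSum q e k z := by
  classical
  have hk : k ≤ Fintype.card X := hT ▸ Finset.card_le_univ T
  obtain ⟨σ, hσ, hσT, -, hd⟩ := exists_matching (e := e) (z := z) (cl := fun _ => 0)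
    (f := fun _ => k) (S := T) fun i => by
      rcases eq_or_ne i 0 with rfl | hi
      · simp [clusterCount, hT, card_select_const hk]
      · simp [clusterCount, hi.symm]
  rw [topSum_eq, ← image_eq_of_injOn hσ hσT (by rw [card_select_const hk, hT]),
    Finset.sum_image hσ]
  exact Finset.sum_le_sum fun u hu => Real.rpow_le_rpow dist_nonneg (hd u hu) hq

end

/-! ### A simplified distance function -/

section

variable {X : Type} [PseudoMetricSpace X] {n k K h : ℕ} {e : Fin n ≃ X} {q θ M : ℝ} {z : X}

/-- The standing assumptions of the estimates: `K` and `θ` are suitable for powers with exponent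
`q`, and `M` bounds the sum of the distances of any `k` points from the center `z`. -/
structure IsScale (q θ : ℝ) (K k : ℕ) (M : ℝ) (z : X) : Prop where
  one_le : 1 ≤ q
  rpow_le : (2 : ℝ) ^ q ≤ K
  pos : 0 < θ
  le_half : K * θ ≤ 1 / 2
  card_pos : 0 < k
  nonneg : 0 ≤ M
  sum_le : ∀ T : Finset X, T.card = k → ∑ u ∈ T, dist z u ^ q ≤ M

theorem IsScale.two_le (hs : IsScale q θ K k M z) : (2 : ℝ) ≤ K :=
  two_le_of_rpow_le hs.one_le hs.rpow_le

theorem IsScale.le_one (hs : IsScale q θ K k M z) : θ ≤ 1 := by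
  have := hs.two_le
  have := hs.le_half
  have := hs.pos
  nlinarith

theorem IsScale.cast_card_pos (hs : IsScale q θ K k M z) : (0 : ℝ) < k := by
  exact_mod_cast hs.card_pos

theorem IsScale.one_le_blowup (hs : IsScale q θ K k M z) : 1 ≤ blowup q θ :=
  Dispersion.one_le_blowup hs.one_le hs.pos

theorem IsScale.blowup_eq (hs : IsScale q θ K k M z) : blowup q θ = θ / 2 * farFactor q θ := by
  have := hs.pos.ne'
  unfold farFactor
  field_simp

theorem IsScale.two_le_mul_farFactor (hs : IsScale q θ K k M z) : 2 ≤ θ * farFactor q θ := by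
  have := hs.one_le_blowup
  rw [hs.blowup_eq] at this
  linarith

open Classical in
/-- A simplification of `dist a u ^ q`: if one of the points is far, it is the only one that
matters. -/
def model (q θ : ℝ) (k : ℕ) (M : ℝ) (z a u : X) : ℝ :=
  if IsFar q k (farFactor q θ) M z a then dist z a ^ q
  else if IsFar q k (farFactor q θ) M z u then dist z u ^ q else dist a u ^ q

open Classical in
/-- A bound for the error of `model`. -/
def modelError (q θ : ℝ) (k : ℕ) (M : ℝ) (z a u : X) : ℝ :=
  if IsFar q k (farFactor q θ) M z a then blowup q θ * dist z u ^ q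
  else if IsFar q k (farFactor q θ) M z u then blowup q θ * dist z a ^ q else 0

theorem IsScale.add_rpow_le (hs : IsScale q θ K k M z) {u v a b c d : X}
    (h : dist u v ≤ dist a b + dist c d) :
    dist u v ^ q ≤ (1 + K * θ) * dist a b ^ q + blowup q θ * dist c d ^ q :=
  (Real.rpow_le_rpow dist_nonneg h (by linarith [hs.one_le])).trans
    (add_rpow_le_blowup hs.one_le hs.rpow_le hs.pos hs.le_one dist_nonneg dist_nonneg)

theorem IsScale.le_add_mul (hs : IsScale q θ K k M z) {x : ℝ} (hx : 0 ≤ x) :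
    x ≤ (1 + K * θ) * x := by
  have := hs.pos
  have : 0 ≤ K * θ * x := by positivity
  linarith

theorem IsScale.dist_le_model (hs : IsScale q θ K k M z) (a u : X) :
    dist a u ^ q ≤ (1 + K * θ) * model q θ k M z a u + modelError q θ k M z a u := by
  unfold model modelError
  split_ifs
  · exact hs.add_rpow_le (dist_triangle_left a u z)
  · refine hs.add_rpow_le ?_
    rw [add_comm]
    exact dist_triangle_left a u z
  · rw [add_zero]
    exact hs.le_add_mul (dist_rpow_nonneg _ _ _)

theorem IsScale.model_le_dist (hs : IsScale q θ K k M z) (a u : X) :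
    model q θ k M z a u ≤ (1 + K * θ) * dist a u ^ q + modelError q θ k M z a u := by
  unfold model modelError
  split_ifs
  · refine hs.add_rpow_le ?_
    rw [add_comm, dist_comm a u]
    exact dist_triangle z u a
  · refine hs.add_rpow_le ?_
    rw [add_comm]
    exact dist_triangle z a u
  · rw [add_zero]
    exact hs.le_add_mul (dist_rpow_nonneg _ _ _)

/-- The bound that `IsScale.sum_modelError_le` requires, for the distances. -/
theorem IsScale.dist_center_le_dist (hs : IsScale q θ K k M z) (a u : X) :
    dist z a ^ q ≤ K * (dist a u ^ q + dist z u ^ q) := by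
  rw [add_comm, dist_comm a u]
  exact dist_rpow_triangle (by linarith [hs.one_le]) hs.rpow_le z u a

/-- The bound that `IsScale.sum_modelError_le` requires, for the simplified distances. -/
theorem IsScale.dist_center_le_model (hs : IsScale q θ K k M z) (a u : X) :
    dist z a ^ q ≤ K * (model q θ k M z a u + dist z u ^ q) := by
  have hK := hs.two_le
  have ha := dist_rpow_nonneg q z a
  have hu := dist_rpow_nonneg q z u
  unfold model
  split_ifs with h1 h2
  · nlinarith
  · have h3 : k * dist z a ^ q ≤ k * dist z u ^ q := (not_not.1 h1).trans (not_le.1 h2).le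
    have := le_of_mul_le_mul_left h3 hs.cast_card_pos
    nlinarith
  · exact hs.dist_center_le_dist a u

theorem IsScale.sum_le_of_subset (hs : IsScale q θ K k M z) {T U : Finset X} (hT : T.card = k)
    (hU : U ⊆ T) : ∑ u ∈ U, dist z u ^ q ≤ M :=
  (Finset.sum_le_sum_of_subset_of_nonneg hU fun u _ _ => dist_rpow_nonneg q z u).trans
    (hs.sum_le T hT)

open Classical in
/-- There are only few far points among any `k` points. -/
theorem IsScale.card_far_le (hs : IsScale q θ K k M z) {T U : Finset X} (hT : T.card = k)
    (hU : U ⊆ T) :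
    ((U.filter fun u => IsFar q k (farFactor q θ) M z u).card : ℝ) * (farFactor q θ * M) ≤
      k * M := by
  have hU' : U.filter (fun u => IsFar q k (farFactor q θ) M z u) ⊆ T :=
    (Finset.filter_subset _ _).trans hU
  refine le_trans ?_ (mul_le_mul_of_nonneg_left (hs.sum_le_of_subset hT hU') hs.cast_card_pos.le)
  rw [Finset.mul_sum, ← nsmul_eq_mul, ← Finset.sum_const]
  exact Finset.sum_le_sum fun u hu => (not_le.1 (Finset.mem_filter.1 hu).2).le

/-- The total error of the simplification in the distances from `a` to at least half of the points
of a `k`-set. Here `D` is the distance from `a` or its simplification. If `a` is far, the errors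
`blowup q θ * dist z u ^ q` are small on average compared with its distance from the center;
otherwise, only the few far points contribute. -/
theorem IsScale.sum_modelError_le (hs : IsScale q θ K k M z) {T U : Finset X} (hT : T.card = k)
    (hU : U ⊆ T) (hkU : k ≤ 2 * U.card) {a : X} {D : X → ℝ}
    (haD : ∀ u, dist z a ^ q ≤ K * (D u + dist z u ^ q)) :
    ∑ u ∈ U, modelError q θ k M z a u ≤ K * θ * (∑ u ∈ U, D u + M) := by
  classical
  have hra := dist_rpow_nonneg q z a
  have hθ := hs.pos
  have hE : 0 ≤ blowup q θ := zero_le_one.trans hs.one_le_blowup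
  have hrow : k * dist z a ^ q ≤ 2 * K * (∑ u ∈ U, D u + M) := by
    have h1 : U.card * dist z a ^ q ≤ K * (∑ u ∈ U, D u + ∑ u ∈ U, dist z u ^ q) := by
      rw [← Finset.sum_add_distrib, Finset.mul_sum, ← nsmul_eq_mul, ← Finset.sum_const]
      exact Finset.sum_le_sum fun u _ => haD u
    have h2 : (k : ℝ) ≤ 2 * U.card := by exact_mod_cast hkU
    calc k * dist z a ^ q ≤ 2 * U.card * dist z a ^ q := by gcongr
      _ = 2 * (U.card * dist z a ^ q) := by ring
      _ ≤ 2 * (K * (∑ u ∈ U, D u + ∑ u ∈ U, dist z u ^ q)) := by gcongr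
      _ ≤ 2 * (K * (∑ u ∈ U, D u + M)) := by
        have := hs.sum_le_of_subset hT hU
        gcongr
      _ = _ := by ring
  have hgoal : θ / 2 * (k * dist z a ^ q) ≤ K * θ * (∑ u ∈ U, D u + M) := by
    calc θ / 2 * (k * dist z a ^ q) ≤ θ / 2 * (2 * K * (∑ u ∈ U, D u + M)) := by gcongr
      _ = _ := by ring
  refine le_trans ?_ hgoal
  by_cases ha : IsFar q k (farFactor q θ) M z a
  · calc ∑ u ∈ U, modelError q θ k M z a u = blowup q θ * ∑ u ∈ U, dist z u ^ q := by
          simp only [modelError, if_pos ha, Finset.mul_sum]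
      _ ≤ blowup q θ * M := by
        have := hs.sum_le_of_subset hT hU
        gcongr
      _ = θ / 2 * (farFactor q θ * M) := by rw [hs.blowup_eq]; ring
      _ ≤ _ := by
        have := (not_le.1 ha).le
        gcongr
  · simp only [modelError, if_neg ha]
    rw [← Finset.sum_filter, Finset.sum_const, nsmul_eq_mul]
    have hfar := hs.card_far_le hT hU
    -- if `M = 0`, there is no bound for the number of far points, but then `a` is at the center
    rcases hs.nonneg.eq_or_lt with hM | hM
    · have h0 : k * dist z a ^ q ≤ farFactor q θ * M := not_not.1 ha
      rw [← hM, mul_zero] at h0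
      have h1 : dist z a ^ q = 0 :=
        le_antisymm (nonpos_of_mul_nonpos_right h0 hs.cast_card_pos) hra
      simp [h1]
    · rw [← mul_assoc] at hfar
      have h1 := le_of_mul_le_mul_right hfar hM
      rw [hs.blowup_eq]
      calc _ = θ / 2 * (((U.filter fun u => IsFar q k (farFactor q θ) M z u).card : ℝ) *
            farFactor q θ * dist z a ^ q) := by ring
        _ ≤ _ := by gcongr

theorem IsScale.sum_dist_le_sum_model (hs : IsScale q θ K k M z) {T U : Finset X}
    (hT : T.card = k) (hU : U ⊆ T) (hkU : k ≤ 2 * U.card) (a : X) :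
    ∑ u ∈ U, dist a u ^ q ≤
      (1 + 2 * (K * θ)) * ∑ u ∈ U, model q θ k M z a u + K * θ * M := by
  have h1 := hs.sum_modelError_le hT hU hkU (hs.dist_center_le_model a)
  have h2 := Finset.sum_le_sum fun u (_ : u ∈ U) => hs.dist_le_model a u
  rw [Finset.sum_add_distrib, ← Finset.mul_sum] at h2
  linarith

theorem IsScale.sum_model_le_sum_dist (hs : IsScale q θ K k M z) {T U : Finset X}
    (hT : T.card = k) (hU : U ⊆ T) (hkU : k ≤ 2 * U.card) (a : X) :
    ∑ u ∈ U, model q θ k M z a u ≤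
      (1 + 2 * (K * θ)) * ∑ u ∈ U, dist a u ^ q + K * θ * M := by
  have h1 := hs.sum_modelError_le hT hU hkU (hs.dist_center_le_dist a)
  have h2 := Finset.sum_le_sum fun u (_ : u ∈ U) => hs.model_le_dist a u
  rw [Finset.sum_add_distrib, ← Finset.mul_sum] at h2
  linarith

/-! ### Moving points inside their clusters -/

/-- The far points may move away from the center, the other points may move within a small
distance. -/
def CanMove (q θ : ℝ) (K k : ℕ) (M : ℝ) (z u v : X) : Prop :=
  (IsFar q k (farFactor q θ) M z u ∧ IsFar q k (farFactor q θ) M z v ∧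
      dist z u ^ q ≤ dist z v ^ q) ∨
    (¬ IsFar q k (farFactor q θ) M z u ∧ ¬ IsFar q k (farFactor q θ) M z v ∧
      k * dist u v ^ q ≤ 2 * K * (closeFactor q K θ * M))

theorem IsScale.dist_le_of_close (hs : IsScale q θ K k M z) {a u a' u' : X}
    (ha : k * dist a a' ^ q ≤ 2 * K * (closeFactor q K θ * M))
    (hu : k * dist u u' ^ q ≤ 2 * K * (closeFactor q K θ * M)) :
    k * dist a u ^ q ≤ (1 + K * θ) * (k * dist a' u' ^ q) + K * θ * M := by
  have hE := hs.one_le_blowup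
  have hK := hs.two_le
  have hk := hs.cast_card_pos
  have hθ := hs.pos
  have hq : 0 ≤ q := by linarith [hs.one_le]
  have h1 : dist a u ≤ dist a' u' + (dist a a' + dist u u') := by
    have := dist_triangle4 a a' u' u
    rw [dist_comm u' u] at this
    linarith
  have h2 : dist a u ^ q ≤ (1 + K * θ) * dist a' u' ^ q +
      blowup q θ * (K * (dist a a' ^ q + dist u u' ^ q)) := by
    refine (Real.rpow_le_rpow dist_nonneg h1 hq).trans ((add_rpow_le_blowup hs.one_le hs.rpow_le
      hs.pos hs.le_one dist_nonneg (by positivity)).trans ?_)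
    have := Dispersion.add_rpow_le hq hs.rpow_le (dist_nonneg (x := a) (y := a'))
      (dist_nonneg (x := u) (y := u'))
    gcongr
  calc k * dist a u ^ q ≤ k * ((1 + K * θ) * dist a' u' ^ q +
        blowup q θ * (K * (dist a a' ^ q + dist u u' ^ q))) := by gcongr
    _ = (1 + K * θ) * (k * dist a' u' ^ q) +
        blowup q θ * K * (k * dist a a' ^ q + k * dist u u' ^ q) := by ring
    _ ≤ (1 + K * θ) * (k * dist a' u' ^ q) + blowup q θ * K *
        (2 * K * (closeFactor q K θ * M) + 2 * K * (closeFactor q K θ * M)) := by gcongr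
    _ = _ := by
      unfold closeFactor
      have : (K : ℝ) ≠ 0 := by positivity
      have : blowup q θ ≠ 0 := by positivity
      field_simp
      ring

theorem IsScale.model_le_model (hs : IsScale q θ K k M z) {a u a' u' : X}
    (ha : CanMove q θ K k M z a a') (hu : CanMove q θ K k M z u u') :
    k * model q θ k M z a u ≤ (1 + K * θ) * (k * model q θ k M z a' u') + K * θ * M := by
  have hk := hs.cast_card_pos
  have hθ := hs.pos
  have hM := hs.nonneg
  have key : ∀ x y : ℝ, 0 ≤ y → x ≤ y → k * x ≤ (1 + K * θ) * (k * y) + K * θ * M := by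
    intro x y hy hxy
    have h1 := hs.le_add_mul (mul_nonneg hk.le hy)
    have h2 : k * x ≤ k * y := by gcongr
    have h3 : 0 ≤ K * θ * M := by positivity
    linarith
  unfold model
  rcases ha with ⟨h1, h2, h3⟩ | ⟨h1, h2, h3⟩
  · rw [if_pos h1, if_pos h2]
    exact key _ _ (dist_rpow_nonneg _ _ _) h3
  · rw [if_neg h1, if_neg h2]
    rcases hu with ⟨h4, h5, h6⟩ | ⟨h4, h5, h6⟩
    · rw [if_pos h4, if_pos h5]
      exact key _ _ (dist_rpow_nonneg _ _ _) h6
    · rw [if_neg h4, if_neg h5]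
      exact hs.dist_le_of_close h3 h6

theorem IsScale.cast_mul_nonneg (hs : IsScale q θ K k M z) : 0 ≤ K * θ := by
  have := hs.pos
  positivity

/-- The constants in the comparison of distances by way of the simplified distances. -/
theorem le_of_chain {η x y₁ y₂ y₃ c b : ℝ} (hη : 0 ≤ η) (hη' : η ≤ 1 / 2) (hb : 0 ≤ b)
    (hc' : c ≤ 3) (h₁ : x ≤ (1 + 2 * η) * y₁ + η * b) (h₂ : y₁ ≤ (1 + η) * y₂ + c * (η * b))
    (h₃ : y₂ ≤ (1 + 2 * η) * y₃ + η * b) (h₄ : 0 ≤ y₃) :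
    x ≤ (1 + 10 * η) * y₃ + 10 * η * b := by
  have h5 : 0 ≤ η * b := by positivity
  have h6 : y₁ ≤ (1 + η) * ((1 + 2 * η) * y₃ + η * b) + c * (η * b) := by
    refine h₂.trans ?_
    gcongr
  have h7 : x ≤ (1 + 2 * η) * ((1 + η) * ((1 + 2 * η) * y₃ + η * b) + c * (η * b)) + η * b := by
    refine h₁.trans ?_
    gcongr
  have h8 : (1 + 2 * η) * ((1 + η) + c) + 1 ≤ 10 := by nlinarith
  have h9 : (1 + 2 * η) ^ 2 * (1 + η) ≤ 1 + 10 * η := by nlinarith [mul_nonneg hη hη]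
  nlinarith [mul_le_mul_of_nonneg_right h8 h5, mul_le_mul_of_nonneg_right h9 h₄]

/-- Moving points does not decrease the sums of distances from a point to at least half of the
points by much. -/
theorem IsScale.sum_dist_le_of_canMove (hs : IsScale q θ K k M z) {σ : X → X} {S U : Finset X}
    (hS : S.card = k) (hσ : Set.InjOn σ S) (hmove : ∀ u ∈ S, CanMove q θ K k M z u (σ u))
    (hU : U ⊆ S) (hkU : k ≤ 2 * U.card) {a : X} (ha : a ∈ S) :
    ∑ u ∈ U, dist a u ^ q ≤
      (1 + 10 * (K * θ)) * ∑ u ∈ U, dist (σ a) (σ u) ^ q + 10 * (K * θ) * M := by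
  classical
  have hσU : Set.InjOn σ U := hσ.mono (Finset.coe_subset.2 hU)
  have hk := hs.cast_card_pos
  have hM := hs.nonneg
  have hη := hs.cast_mul_nonneg
  have h1 := hs.sum_dist_le_sum_model hS hU hkU a
  have h3 := hs.sum_model_le_sum_dist (T := S.image σ) (U := U.image σ)
    ((Finset.card_image_of_injOn hσ).trans hS) (Finset.image_subset_image hU)
    (by rwa [Finset.card_image_of_injOn hσU]) (σ a)
  rw [Finset.sum_image hσU, Finset.sum_image hσU] at h3
  have h2 : k * ∑ u ∈ U, model q θ k M z a u ≤
      k * ((1 + K * θ) * ∑ u ∈ U, model q θ k M z (σ a) (σ u) + 1 * (K * θ * M)) := by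
    have h4 := Finset.sum_le_sum fun u (hu : u ∈ U) =>
      hs.model_le_model (hmove a ha) (hmove u (hU hu))
    rw [Finset.sum_add_distrib, ← Finset.mul_sum, ← Finset.mul_sum, ← Finset.mul_sum,
      Finset.sum_const, nsmul_eq_mul] at h4
    have h5 : (U.card : ℝ) ≤ k := by exact_mod_cast (Finset.card_le_card hU).trans hS.le
    have h6 : U.card * (K * θ * M) ≤ k * (K * θ * M) := by gcongr
    linarith
  exact le_of_chain hη hs.le_half hM (by norm_num) h1 (le_of_mul_le_mul_left h2 hk) h3
    (Finset.sum_nonneg fun u _ => dist_rpow_nonneg _ _ _)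

theorem crossSum_image [DecidableEq X] {σ τ : X → X} {A B : Finset X} (hσ : Set.InjOn σ A)
    (hτ : Set.InjOn τ B) :
    crossSum q (A.image σ) (B.image τ) = ∑ u ∈ A, ∑ v ∈ B, dist (σ u) (τ v) ^ q := by
  unfold crossSum
  rw [Finset.sum_image hσ]
  exact Finset.sum_congr rfl fun u _ => Finset.sum_image hτ

theorem IsScale.crossSum_le_of_canMove [DecidableEq X] (hs : IsScale q θ K k M z) {σ : X → X}
    {S A U : Finset X} (hS : S.card = k) (hσ : Set.InjOn σ S)
    (hmove : ∀ u ∈ S, CanMove q θ K k M z u (σ u)) (hA : A ⊆ S) (hU : U ⊆ S)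
    (hkU : k ≤ 2 * U.card) :
    crossSum q A U ≤ (1 + 10 * (K * θ)) * crossSum q (A.image σ) (U.image σ) +
      10 * (K * θ) * (A.card * M) := by
  rw [crossSum_image (hσ.mono (Finset.coe_subset.2 hA)) (hσ.mono (Finset.coe_subset.2 hU))]
  have := Finset.sum_le_sum fun a (ha : a ∈ A) =>
    hs.sum_dist_le_of_canMove hS hσ hmove hU hkU (hA ha)
  rw [Finset.sum_add_distrib, ← Finset.mul_sum, Finset.sum_const, nsmul_eq_mul] at this
  refine this.trans_eq ?_
  ring

end

/-! ### Exchanging the parts of a cut -/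

section

variable {X : Type} [PseudoMetricSpace X] {n k K h : ℕ} {e : Fin n ≃ X} {q θ M : ℝ} {z : X}

theorem sum_sum_image_eq {X : Type} {σ τ : X → X} {A B A' B' : Finset X} (hσ : Set.InjOn σ A)
    (hσA : ∀ u ∈ A, σ u ∈ A') (hA : A'.card ≤ A.card) (hτ : Set.InjOn τ B)
    (hτB : ∀ u ∈ B, τ u ∈ B') (hB : B'.card ≤ B.card) (D : X → X → ℝ) :
    ∑ u ∈ A', ∑ v ∈ B', D u v = ∑ u ∈ A, ∑ v ∈ B, D (σ u) (τ v) := by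
  classical
  rw [← image_eq_of_injOn hσ hσA hA, ← image_eq_of_injOn hτ hτB hB, Finset.sum_image hσ]
  exact Finset.sum_congr rfl fun u _ => Finset.sum_image hτ

open Classical in
/-- The distance from the center to a far point, zero for the other points. -/
def farDist (q θ : ℝ) (k : ℕ) (M : ℝ) (z u : X) : ℝ :=
  if IsFar q k (farFactor q θ) M z u then dist z u ^ q else 0

open Classical in
/-- The distance of two points that are not far, zero if one of the points is far. -/
def coreDist (q θ : ℝ) (k : ℕ) (M : ℝ) (z u v : X) : ℝ :=
  if IsFar q k (farFactor q θ) M z u ∨ IsFar q k (farFactor q θ) M z v then 0 else dist u v ^ q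

theorem farDist_nonneg (u : X) : 0 ≤ farDist q θ k M z u := by
  unfold farDist
  split_ifs
  exacts [dist_rpow_nonneg _ _ _, le_rfl]

theorem model_le_farDist (u v : X) : model q θ k M z u v ≤
    farDist q θ k M z u + farDist q θ k M z v + coreDist q θ k M z u v := by
  have h1 := farDist_nonneg (q := q) (θ := θ) (k := k) (M := M) (z := z) v
  by_cases hu : IsFar q k (farFactor q θ) M z u
  · simp only [model, farDist, coreDist, hu, if_true, true_or] at h1 ⊢
    linarith
  · by_cases hv : IsFar q k (farFactor q θ) M z v
    · simp [model, farDist, coreDist, hu, hv]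
    · simp [model, farDist, coreDist, hu, hv]

open Classical in
theorem farDist_le_model (u v : X) :
    farDist q θ k M z u + farDist q θ k M z v + coreDist q θ k M z u v ≤ model q θ k M z u v +
      if IsFar q k (farFactor q θ) M z u then farDist q θ k M z v else 0 := by
  by_cases hu : IsFar q k (farFactor q θ) M z u
  · simp [model, farDist, coreDist, hu]
  · by_cases hv : IsFar q k (farFactor q θ) M z v
    · simp [model, farDist, coreDist, hu, hv]
    · simp [model, farDist, coreDist, hu, hv]

theorem sum_farDist_sdiff [DecidableEq X] {T L : Finset X} (hL : L ⊆ T) :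
    ∑ u ∈ L, farDist q θ k M z u + ∑ u ∈ T \ L, farDist q θ k M z u =
      ∑ u ∈ T, farDist q θ k M z u := by
  rw [add_comm, Finset.sum_sdiff hL]

theorem IsScale.coreDist_le_coreDist (hs : IsScale q θ K k M z) {u v u' v' : X}
    (hu : IsFar q k (farFactor q θ) M z u' ↔ IsFar q k (farFactor q θ) M z u)
    (hv : IsFar q k (farFactor q θ) M z v' ↔ IsFar q k (farFactor q θ) M z v)
    (huu : ¬ IsFar q k (farFactor q θ) M z u →
      k * dist u' u ^ q ≤ 2 * K * (closeFactor q K θ * M))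
    (hvv : ¬ IsFar q k (farFactor q θ) M z v →
      k * dist v' v ^ q ≤ 2 * K * (closeFactor q K θ * M)) :
    k * coreDist q θ k M z u' v' ≤
      (1 + K * θ) * (k * coreDist q θ k M z u v) + K * θ * M := by
  have := mul_nonneg hs.cast_mul_nonneg hs.nonneg
  unfold coreDist
  rw [hu, hv]
  split_ifs with h1
  · simpa using this
  · rw [not_or] at h1
    exact hs.dist_le_of_close (huu h1.1) (hvv h1.2)

/-- The far points of a `k`-set contribute little even if they are counted as often as there are far
points in a part `L` of the set: there are so few of them that the number of far points, times the
scale, is small compared with `h * M`. -/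
theorem IsScale.card_far_mul_sum_farDist_le (hs : IsScale q θ K k M z) {T L : Finset X}
    (hT : T.card = k) (hL : L ⊆ T) (hh : 1 ≤ h) (hk : k ≤ 2 * h + 1) {j : ℕ}
    (hj : ∀ [DecidablePred fun u => IsFar q k (farFactor q θ) M z u],
      (L.filter fun u => IsFar q k (farFactor q θ) M z u).card = j) :
    (j * (1 + K * θ) + 1) * ∑ u ∈ T, farDist q θ k M z u ≤ 2 * (K * θ * (h * M)) := by
  classical
  have hM := hs.nonneg
  set H := ∑ u ∈ T, farDist q θ k M z u with hH
  set F := T.filter fun u => IsFar q k (farFactor q θ) M z u with hF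
  have hHF : H = ∑ u ∈ F, dist z u ^ q := by
    rw [hH, hF, Finset.sum_filter]
    rfl
  have hHM : H ≤ M := hHF ▸ hs.sum_le_of_subset hT (Finset.filter_subset _ _)
  have hH0 : 0 ≤ H := Finset.sum_nonneg fun u _ => farDist_nonneg u
  have hjF : j ≤ F.card := hj ▸ Finset.card_le_card (Finset.filter_subset_filter _ hL)
  have hη := hs.cast_mul_nonneg
  have hη' := hs.le_half
  have h1 : (j * (1 + K * θ) + 1) * H ≤ 5 / 2 * (F.card * M) := by
    rcases Nat.eq_zero_or_pos F.card with h0 | h0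
    · rw [hHF, Finset.card_eq_zero.1 h0]
      simp
    · have h2 : (1 : ℝ) ≤ F.card := by exact_mod_cast h0
      have h3 : (j : ℝ) ≤ F.card := by exact_mod_cast hjF
      have h4 : j * (1 + K * θ) + 1 ≤ 5 / 2 * (F.card : ℝ) := by
        have : j * (1 + K * θ) ≤ (F.card : ℝ) * (1 + 1 / 2) := by gcongr
        linarith
      calc _ ≤ 5 / 2 * (F.card : ℝ) * M := by gcongr
        _ = _ := by ring
  have h2 := hs.card_far_le hT (Finset.Subset.refl T)
  have h3 : (k : ℝ) ≤ 3 * h := by exact_mod_cast (by omega : k ≤ 3 * h)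
  have h4 := hs.two_le_mul_farFactor
  have hθ := hs.pos
  have h5 : 2 * (F.card * M) ≤ θ * (k * M) := by
    calc 2 * (F.card * M) ≤ θ * farFactor q θ * (F.card * M) := by gcongr
      _ = θ * (F.card * (farFactor q θ * M)) := by ring
      _ ≤ θ * (k * M) := by gcongr
  have h6 : θ * (k * M) ≤ θ * (3 * h * M) := by gcongr
  have h7 : 2 * (θ * (h * M)) ≤ K * (θ * (h * M)) := by
    have := hs.two_le
    gcongr
  have h8 : 0 ≤ K * θ * (h * M) := by positivity
  linarith

/-- Two cuts of the same set with the same numbers of points in each cluster have almost the same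
value in the simplified distances. The pairs of points that are not far are matched inside the
clusters. A far point contributes its distance from the center about `h` times, on whichever side of
the cut it is. -/
theorem IsScale.sum_model_swap_le [DecidableEq X] (hs : IsScale q θ K k M z) {T L L' : Finset X}
    {cl : X → ℕ} (hfar : ∀ u, cl u = 0 ↔ IsFar q k (farFactor q θ) M z u)
    (hclose : ∀ u v, cl u = cl v → cl u ≠ 0 →
      k * dist u v ^ q ≤ 2 * K * (closeFactor q K θ * M))
    (hT : T.card = k) (hL : L ⊆ T) (hL' : L' ⊆ T) (hLh : L.card = h) (hh : 1 ≤ h)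
    (hkh : 2 * h ≤ k) (hk : k ≤ 2 * h + 1)
    (hcount : ∀ i, clusterCount cl L i = clusterCount cl L' i) :
    ∑ u ∈ L', ∑ v ∈ T \ L', model q θ k M z u v ≤
      (1 + K * θ) * ∑ u ∈ L, ∑ v ∈ T \ L, model q θ k M z u v + 3 * (K * θ * (h * M)) := by
  classical
  have hcount' : ∀ i, clusterCount cl (T \ L) i = clusterCount cl (T \ L') i := by
    intro i
    have h1 := clusterCount_sdiff cl T L i
    have h2 := clusterCount_sdiff cl T L' i
    rw [Finset.inter_eq_right.2 hL] at h1
    rw [Finset.inter_eq_right.2 hL'] at h2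
    have := hcount i
    omega
  obtain ⟨σ, hσ, hσL, hσc⟩ := exists_bijection cl hcount
  obtain ⟨τ, hτ, hτR, hτc⟩ := exists_bijection cl hcount'
  have hcardL : L'.card = L.card := by
    rw [← Finset.card_image_of_injOn hσ]
    refine le_antisymm ?_ (Finset.card_le_card (Finset.image_subset_iff.2 hσL))
    obtain ⟨ρ, hρ, hρL, -⟩ := exists_bijection cl fun i => (hcount i).symm
    rw [Finset.card_image_of_injOn hσ, ← Finset.card_image_of_injOn hρ]
    exact Finset.card_le_card (Finset.image_subset_iff.2 hρL)
  have hRcard : (T \ L).card = k - h := by rw [Finset.card_sdiff_of_subset hL, hT, hLh]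
  have hRcard' : (T \ L').card = k - h := by
    rw [Finset.card_sdiff_of_subset hL', hT, hcardL, hLh]
  have hη := hs.cast_mul_nonneg
  have hM := hs.nonneg
  have hk0 := hs.cast_card_pos
  set H := ∑ u ∈ T, farDist q θ k M z u with hH
  have hH0 : 0 ≤ H := Finset.sum_nonneg fun u _ => farDist_nonneg u
  set j := (L.filter fun u => IsFar q k (farFactor q θ) M z u).card with hj
  -- the pairs without far points
  have hcore : ∑ u ∈ L', ∑ v ∈ T \ L', coreDist q θ k M z u v ≤
      (1 + K * θ) * ∑ u ∈ L, ∑ v ∈ T \ L, coreDist q θ k M z u v + K * θ * (h * M) := by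
    rw [sum_sum_image_eq hσ hσL hcardL.le hτ hτR (hRcard'.trans hRcard.symm).le]
    have h1 := Finset.sum_le_sum fun u (hu : u ∈ L) =>
      Finset.sum_le_sum fun v (hv : v ∈ T \ L) =>
      hs.coreDist_le_coreDist (u := u) (v := v) (u' := σ u) (v' := τ v)
        (by rw [← hfar, ← hfar, hσc u hu]) (by rw [← hfar, ← hfar, hτc v hv])
        (fun h => hclose _ _ (hσc u hu) (by rwa [hσc u hu, Ne, hfar]))
        (fun h => hclose _ _ (hτc v hv) (by rwa [hτc v hv, Ne, hfar]))
    simp only [Finset.sum_add_distrib, ← Finset.mul_sum, Finset.sum_const, nsmul_eq_mul] at h1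
    rw [hRcard, hLh] at h1
    have h2 : ((k - h : ℕ) : ℝ) ≤ k := by exact_mod_cast Nat.sub_le k h
    have h3 : h * ((k - h : ℕ) * (K * θ * M)) ≤ h * (k * (K * θ * M)) := by gcongr
    refine le_of_mul_le_mul_left ?_ hk0
    linarith
  -- a far point of `L'` counts `k - h` times, a far point of `T \ L'` at most `h` times
  have hupper : ∑ u ∈ L', ∑ v ∈ T \ L', model q θ k M z u v ≤
      (h + 1) * H + ∑ u ∈ L', ∑ v ∈ T \ L', coreDist q θ k M z u v := by
    have h1 := Finset.sum_le_sum fun u (_ : u ∈ L') => Finset.sum_le_sum fun v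
      (_ : v ∈ T \ L') => model_le_farDist (q := q) (θ := θ) (k := k) (M := M) (z := z) u v
    simp only [Finset.sum_add_distrib, ← Finset.mul_sum, Finset.sum_const, nsmul_eq_mul] at h1
    rw [hRcard', hcardL, hLh] at h1
    have h2 : ((k - h : ℕ) : ℝ) ≤ h + 1 := by exact_mod_cast (by omega : k - h ≤ h + 1)
    have h3 : 0 ≤ ∑ u ∈ L', farDist q θ k M z u := Finset.sum_nonneg fun u _ => farDist_nonneg u
    have h4 : 0 ≤ ∑ u ∈ T \ L', farDist q θ k M z u :=
      Finset.sum_nonneg fun u _ => farDist_nonneg u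
    have h5 : ((k - h : ℕ) : ℝ) * ∑ u ∈ L', farDist q θ k M z u ≤
        (h + 1) * ∑ u ∈ L', farDist q θ k M z u := by gcongr
    rw [hH, ← sum_farDist_sdiff hL']
    linarith
  -- a far point of `L` counts `k - h` times, a far point of `T \ L` at least `h - j` times
  have hlower : h * H + ∑ u ∈ L, ∑ v ∈ T \ L, coreDist q θ k M z u v ≤
      ∑ u ∈ L, ∑ v ∈ T \ L, model q θ k M z u v + j * H := by
    have h1 := Finset.sum_le_sum fun u (_ : u ∈ L) => Finset.sum_le_sum fun v
      (_ : v ∈ T \ L) => farDist_le_model (q := q) (θ := θ) (k := k) (M := M) (z := z) u v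
    simp only [Finset.sum_add_distrib, ← Finset.mul_sum, Finset.sum_const, nsmul_eq_mul] at h1
    have h6 : ∑ u ∈ L, ∑ v ∈ T \ L, (if IsFar q k (farFactor q θ) M z u then
        farDist q θ k M z v else 0) = j * ∑ v ∈ T \ L, farDist q θ k M z v := by
      rw [hj, ← nsmul_eq_mul, ← Finset.sum_const, Finset.sum_filter]
      refine Finset.sum_congr rfl fun u _ => ?_
      split_ifs <;> simp
    rw [h6, hRcard, hLh] at h1
    have h2 : (h : ℝ) ≤ (k - h : ℕ) := by exact_mod_cast (by omega : h ≤ k - h)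
    have h3 : 0 ≤ ∑ u ∈ L, farDist q θ k M z u := Finset.sum_nonneg fun u _ => farDist_nonneg u
    have h5 : h * ∑ u ∈ L, farDist q θ k M z u ≤
        ((k - h : ℕ) : ℝ) * ∑ u ∈ L, farDist q θ k M z u := by gcongr
    have h7 : 0 ≤ j * ∑ u ∈ L, farDist q θ k M z u := by positivity
    rw [hH, ← sum_farDist_sdiff hL]
    linarith
  have hfew := hs.card_far_mul_sum_farDist_le (h := h) (j := j) hT hL hh hk (by
    rw [hj]
    intro _
    congr!)
  rw [← hH] at hfew
  have h8 := mul_le_mul_of_nonneg_left hlower (by linarith : 0 ≤ 1 + K * θ)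
  have h9 : 0 ≤ K * θ * (h * H) := by positivity
  linarith

/-- Two cuts of the same set with the same numbers of points in each cluster have almost the same
value. -/
theorem IsScale.cut_swap_le (hs : IsScale q θ K k M z) {T L L' : Finset X}
    {cl : X → ℕ} (hfar : ∀ u, cl u = 0 ↔ IsFar q k (farFactor q θ) M z u)
    (hclose : ∀ u v, cl u = cl v → cl u ≠ 0 →
      k * dist u v ^ q ≤ 2 * K * (closeFactor q K θ * M))
    (hT : T.card = k) (hL : L ⊆ T) (hL' : L' ⊆ T) (hLh : L.card = h) (hLh' : L'.card = h)
    (hh : 1 ≤ h) (hkh : 2 * h ≤ k) (hk : k ≤ 2 * h + 1)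
    (hcount : ∀ i, clusterCount cl L i = clusterCount cl L' i) :
    cut q T L' ≤ (1 + 10 * (K * θ)) * cut q T L + 10 * (K * θ) * (h * M) := by
  classical
  have hcut : ∀ A : Finset X, cut q T A = ∑ u ∈ A, ∑ v ∈ T \ A, dist u v ^ q := by
    intro A
    unfold cut crossSum
    congr!
  have hM := hs.nonneg
  have hmain := hs.sum_model_swap_le hfar hclose hT hL hL' hLh hh hkh hk hcount
  have hcard : ∀ A ⊆ T, A.card = h → k ≤ 2 * (T \ A).card := by
    intro A hA hAh
    rw [Finset.card_sdiff_of_subset hA, hT, hAh]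
    omega
  have h1 := Finset.sum_le_sum fun a (_ : a ∈ L') =>
    hs.sum_dist_le_sum_model hT Finset.sdiff_subset (hcard L' hL' hLh') a
  have h2 := Finset.sum_le_sum fun a (_ : a ∈ L) =>
    hs.sum_model_le_sum_dist hT Finset.sdiff_subset (hcard L hL hLh) a
  simp only [Finset.sum_add_distrib, ← Finset.mul_sum, Finset.sum_const, nsmul_eq_mul] at h1 h2
  rw [hcut, hcut]
  rw [hLh'] at h1
  rw [hLh] at h2
  refine le_of_chain hs.cast_mul_nonneg hs.le_half (by positivity) le_rfl (h1.trans_eq (by ring))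
    hmain (h2.trans_eq (by ring)) ?_
  exact Finset.sum_nonneg fun u _ => Finset.sum_nonneg fun v _ => dist_rpow_nonneg _ _ _

end

/-! ### The number of clusters in doubling spaces -/

section

variable {X : Type} [PseudoMetricSpace X] {q : ℝ}

/-- A cover of a ball by balls of half its radius. The exponent `D + 1` instead of `D` avoids the
question whether the infimum in `doublingDim` is attained. -/
theorem exists_cover_half [Finite X] {D : ℝ} (hD : doublingDim X ≤ D) {r : ℝ} (hr : 0 < r)
    (u : X) : ∃ s : Finset X, s.card ≤ ⌊(2 : ℝ) ^ (D + 1)⌋₊ ∧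
      Metric.closedBall u r ⊆ ⋃ v ∈ s, Metric.closedBall v (r / 2) := by
  have := Fintype.ofFinite X
  have hne : {D : ℝ | 0 ≤ D ∧ ∀ (u : X) (r : ℝ), 0 < r →
      ∃ s : Finset X, (s.card : ℝ) ≤ 2 ^ D ∧
        Metric.closedBall u r ⊆ ⋃ v ∈ s, Metric.closedBall v (r / 2)}.Nonempty := by
    refine ⟨Fintype.card X, Nat.cast_nonneg _, fun u r hr => ⟨Finset.univ, ?_, fun v _ => ?_⟩⟩
    · rw [Real.rpow_natCast, Finset.card_univ]
      exact_mod_cast Nat.lt_two_pow_self.le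
    · exact Set.mem_iUnion₂.2 ⟨v, Finset.mem_univ v, Metric.mem_closedBall_self (by positivity)⟩
  obtain ⟨D', ⟨-, hD'⟩, hlt⟩ := exists_lt_of_csInf_lt hne (hD.trans_lt (lt_add_one D))
  obtain ⟨s, hs, hcover⟩ := hD' u r hr
  exact ⟨s, Nat.le_floor (hs.trans (Real.rpow_le_rpow_of_exponent_le (by norm_num) hlt.le)),
    hcover⟩

theorem exists_cover_iterate {N : ℕ} (hN : ∀ (u : X) (r : ℝ), 0 < r →
      ∃ s : Finset X, s.card ≤ N ∧ Metric.closedBall u r ⊆ ⋃ v ∈ s, Metric.closedBall v (r / 2))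
    (j : ℕ) : ∀ (u : X) (r : ℝ), 0 < r → ∃ s : Finset X, s.card ≤ N ^ j ∧
      Metric.closedBall u r ⊆ ⋃ v ∈ s, Metric.closedBall v (r / 2 ^ j) := by
  classical
  induction j with
  | zero =>
    intro u r _
    exact ⟨{u}, by simp, by simp⟩
  | succ j ih =>
    intro u r hr
    obtain ⟨s, hs, hcover⟩ := hN u r hr
    choose t ht hcover' using fun v => ih v (r / 2) (by positivity)
    refine ⟨s.biUnion t, ?_, fun x hx => ?_⟩
    · rw [pow_succ']
      exact (Finset.card_biUnion_le_card_mul s t _ fun v _ => ht v).trans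
        (Nat.mul_le_mul_right _ hs)
    · obtain ⟨v, hv, hxv⟩ := Set.mem_iUnion₂.1 (hcover hx)
      obtain ⟨w, hw, hxw⟩ := Set.mem_iUnion₂.1 (hcover' v hxv)
      refine Set.mem_iUnion₂.2 ⟨w, Finset.mem_biUnion.2 ⟨v, hv, hw⟩, ?_⟩
      rwa [pow_succ', ← div_div]

/-- A bound for the number of separated points in a ball. -/
theorem card_le_of_separated {u : X} {r ρ : ℝ} {s : Finset X} {ι : Finset ℕ} {l : ℕ → X}
    (hs : Metric.closedBall u r ⊆ ⋃ v ∈ s, Metric.closedBall v ρ)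
    (hl : ∀ i ∈ ι, l i ∈ Metric.closedBall u r)
    (hsep : ∀ i ∈ ι, ∀ j ∈ ι, i < j → 2 * ρ < dist (l j) (l i)) : ι.card ≤ s.card := by
  have h1 : ∀ i : ℕ, ∃ v : X, i ∈ ι → v ∈ s ∧ dist (l i) v ≤ ρ := by
    intro i
    by_cases hi : i ∈ ι
    · obtain ⟨v, hv, hiv⟩ := Set.mem_iUnion₂.1 (hs (hl i hi))
      exact ⟨v, fun _ => ⟨hv, hiv⟩⟩
    · exact ⟨u, fun h => absurd h hi⟩
  choose c hc using h1
  have h2 : ∀ i ∈ ι, ∀ j ∈ ι, i < j → c i ≠ c j := by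
    intro i hi j hj hij h
    have h3 := dist_triangle_right (l j) (l i) (c j)
    have h4 := (hc j hj).2
    have h5 := (hc i hi).2
    rw [h] at h5
    linarith [hsep i hi j hj hij]
  refine Finset.card_le_card_of_injOn c (fun i hi => (hc i hi).1) fun i hi j hj h => ?_
  rcases lt_trichotomy i j with h3 | h3 | h3
  · exact absurd h (h2 i hi j hj h3)
  · exact h3
  · exact absurd h.symm (h2 j hj i hi h3)

/-- The number of clusters has a bound that depends only on the parameters and on the doubling
dimension: the leaders are in a ball around the center, and their distances from each other are at
least a constant fraction of its radius. -/
theorem exists_clustering_bound (hq : 1 ≤ q) {C ξ : ℝ} (hC : 0 < C) (hξ : 0 < ξ) (D : ℝ) :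
    ∃ m₀ : ℕ, ∀ (X : Type) [PseudoMetricSpace X] [Finite X] (k : ℕ) (M : ℝ) (z : X)
      (cl : X → ℕ) (m : ℕ), 0 < k → 0 ≤ M → doublingDim X ≤ D →
        IsClustering q k C ξ M z cl m → m ≤ m₀ := by
  obtain ⟨j, hj⟩ := pow_unbounded_of_one_lt (2 + 2 * (C / ξ)) one_lt_two
  refine ⟨2 + ⌊(2 : ℝ) ^ (D + 1)⌋₊ ^ j, fun X _ _ k M z cl m hk hM hD hcl => ?_⟩
  have hq0 : 0 < q := by linarith
  have hk0 : (0 : ℝ) < k := by exact_mod_cast hk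
  obtain ⟨l, -, hl⟩ := hcl.leaders
  rcases hM.eq_or_lt with rfl | hM
  · by_contra! hm
    have h1 : ∀ i, 1 ≤ i → i < m → dist z (l i) = 0 := by
      intro i h1 h2
      have h3 := not_not.1 (hl i h1 h2).1
      rw [mul_zero] at h3
      have h4 := le_antisymm (nonpos_of_mul_nonpos_right h3 hk0) (dist_rpow_nonneg q z (l i))
      exact ((Real.rpow_eq_zero dist_nonneg hq0.ne').1 h4)
    have h2 := (hl 2 (by norm_num) (by omega)).2 1 le_rfl (by norm_num)
    refine h2 ?_
    have h3 := dist_triangle_left (l 2) (l 1) z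
    rw [h1 2 (by norm_num) (by omega), h1 1 le_rfl (by omega), add_zero] at h3
    rw [IsClose, le_antisymm h3 dist_nonneg, Real.zero_rpow hq0.ne']
    simp
  · set r := (C * M / k) ^ (1 / q) with hr
    have hr0 : 0 < r := by positivity
    have hrq : r ^ q = C * M / k := by
      rw [hr, ← Real.rpow_mul (by positivity), one_div_mul_cancel hq0.ne', Real.rpow_one]
    obtain ⟨s, hs, hcover⟩ := exists_cover_iterate
      (fun u r hr => exists_cover_half hD hr u) j z r hr0
    have h := card_le_of_separated (ι := Finset.Ico 1 m) (l := l) hcover ?_ ?_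
    · rw [Nat.card_Ico] at h
      omega
    · intro i hi
      rw [Finset.mem_Ico] at hi
      rw [Metric.mem_closedBall, dist_comm]
      refine (Real.rpow_le_rpow_iff dist_nonneg hr0.le hq0).1 ?_
      rw [hrq, le_div_iff₀ hk0, mul_comm]
      exact not_not.1 (hl i hi.1 hi.2).1
    · intro i hi i' hi' hii'
      rw [Finset.mem_Ico] at hi hi'
      have h1 := not_le.1 ((hl i' hi'.1 hi'.2).2 i hi.1 hii')
      refine (Real.rpow_lt_rpow_iff (by positivity) dist_nonneg hq0).1 ?_
      refine lt_of_le_of_lt ?_ ((div_lt_iff₀' hk0).2 h1)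
      have h2 : (0 : ℝ) < 2 ^ j := by positivity
      have h3 : 2 / 2 ^ j ≤ (1 : ℝ) := by
        rw [div_le_one h2]
        have : 0 ≤ C / ξ := by positivity
        linarith
      have h4 : 2 / 2 ^ j * C ≤ ξ := by
        rw [div_mul_eq_mul_div, div_le_iff₀ h2]
        have : C / ξ * ξ = C := by field_simp
        nlinarith
      calc (2 * (r / 2 ^ j)) ^ q = (2 / 2 ^ j * r) ^ q := by ring_nf
        _ = (2 / 2 ^ j) ^ q * (C * M / k) := by
          rw [Real.mul_rpow (by positivity) hr0.le, hrq]
        _ ≤ 2 / 2 ^ j * (C * M / k) := by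
          gcongr
          exact Real.rpow_le_self_of_le_one (by positivity) h3 hq
        _ = 2 / 2 ^ j * C * M / k := by ring
        _ ≤ ξ * M / k := by gcongr

end

/-! ### Diversities as minimal cuts -/

section

variable {X : Type} [PseudoMetricSpace X] {n k K h : ℕ} {e : Fin n ≃ X} {q θ ε M : ℝ} {z : X}

/-- The number `d` is the smallest cut of `T` with `h` points on the left. -/
def IsMinCut (q : ℝ) (h : ℕ) (T : Finset X) (d : ℝ) : Prop :=
  (∀ L ⊆ T, L.card = h → d ≤ cut q T L) ∧ ∃ L ⊆ T, L.card = h ∧ d = cut q T L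

theorem IsMinCut.nonneg {T : Finset X} {d : ℝ} (hd : IsMinCut q h T d) : 0 ≤ d := by
  obtain ⟨-, L, -, -, rfl⟩ := hd
  exact cut_nonneg q T L

theorem isMinCut_iInf {ι : Type} [Finite ι] [Nonempty ι] {T : Finset X} (f : ι → Finset X)
    (g : ι → ℝ) (hf : ∀ L, L ⊆ T ∧ L.card = h ↔ ∃ i, f i = L) (hg : ∀ i, g i = cut q T (f i)) :
    IsMinCut q h T (⨅ i, g i) := by
  constructor
  · intro L hL hLh
    obtain ⟨i, rfl⟩ := (hf L).1 ⟨hL, hLh⟩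
    rw [← hg]
    exact ciInf_le (Set.finite_range g).bddBelow i
  · obtain ⟨i, hi⟩ := exists_eq_ciInf_of_finite (f := g)
    exact ⟨f i, ((hf (f i)).2 ⟨i, rfl⟩).1, ((hf (f i)).2 ⟨i, rfl⟩).2, by rw [← hg, hi]⟩

theorem isMinCut_remoteStar {T : Finset X} (hT : T.Nonempty) :
    IsMinCut q 1 T (diversity q .remoteStar T) := by
  have : Nonempty {z : X // z ∈ T} := hT.coe_sort
  refine isMinCut_iInf (fun z : {z : X // z ∈ T} => {z.1}) _ (fun L => ?_) fun z => ?_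
  · rw [Finset.card_eq_one]
    constructor
    · rintro ⟨h1, z, rfl⟩
      exact ⟨⟨z, Finset.singleton_subset_iff.1 h1⟩, rfl⟩
    · rintro ⟨z, rfl⟩
      exact ⟨Finset.singleton_subset_iff.2 z.2, z.1, rfl⟩
  · rw [cut, crossSum, Finset.sum_singleton]
    refine Finset.sum_congr ?_ fun _ _ => rfl
    ext u
    simp [and_comm]

theorem isMinCut_remoteBipartition (T : Finset X) :
    IsMinCut q (T.card / 2) T (diversity q .remoteBipartition T) := by
  have hne : Nonempty {L : Finset X // L ⊆ T ∧ L.card = T.card / 2} := by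
    obtain ⟨L, hL⟩ := Finset.exists_subset_card_eq (Nat.div_le_self T.card 2)
    exact ⟨L, hL⟩
  have hfin : Finite {L : Finset X // L ⊆ T ∧ L.card = T.card / 2} :=
    (T.powerset.finite_toSet.subset fun L hL => Finset.mem_coe.2
      (Finset.mem_powerset.2 hL.1)).to_subtype
  refine isMinCut_iInf (fun L : {L : Finset X // L ⊆ T ∧ L.card = T.card / 2} => L.1) _
    (fun L => ?_) fun L => rfl
  constructor
  · exact fun hL => ⟨⟨L, hL⟩, rfl⟩
  · rintro ⟨L, rfl⟩
    exact L.2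

theorem cut_le_crossSum {T L : Finset X} (hL : L ⊆ T) : cut q T L ≤ crossSum q T T := by
  classical
  have h1 := crossSum_self_eq (q := q) hL
  have h2 := crossSum_nonneg q L L
  have h3 := crossSum_nonneg q (T \ L) (T \ L)
  have h4 : cut q T L = crossSum q L (T \ L) := by unfold cut; congr!
  have h5 := cut_nonneg q T L
  rw [h4] at h5 ⊢
  linarith

theorem IsMinCut.le_of_isCutValue {T : Finset X} {d v : ℝ} (hd : IsMinCut q h T d)
    {F : Set (Finset X)} (hv : IsCutValue q h T F v) : d ≤ v := by
  rcases hv.2 with rfl | ⟨L, hL, hLh, rfl⟩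
  · obtain ⟨-, L, hL, -, rfl⟩ := hd
    exact cut_le_crossSum hL
  · exact hd.1 L hL hLh

/-- Moving the points of `S` to those of `T` does not decrease the smallest cut by much: the optimal
cut of `T` is pulled back to `S`. -/
theorem IsScale.isMinCut_le (hs : IsScale q θ K k M z) {σ : X → X} {S T : Finset X} {d d' : ℝ}
    (hS : S.card = k) (hT : T.card = k) (hσ : Set.InjOn σ S) (hσT : ∀ u ∈ S, σ u ∈ T)
    (hmove : ∀ u ∈ S, CanMove q θ K k M z u (σ u)) (hhk : 2 * h ≤ k)
    (hd : IsMinCut q h S d) (hd' : IsMinCut q h T d') :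
    d ≤ (1 + 10 * (K * θ)) * d' + 10 * (K * θ) * (h * M) := by
  classical
  obtain ⟨-, L', hL', hLh', rfl⟩ := hd'
  have himage := image_eq_of_injOn hσ hσT (hT.trans hS.symm).le
  set L := S.filter fun u => σ u ∈ L' with hL
  have hLS : L ⊆ S := Finset.filter_subset _ _
  have h1 : L.image σ = L' := by
    ext v
    simp only [hL, Finset.mem_image, Finset.mem_filter]
    constructor
    · rintro ⟨u, ⟨-, hu⟩, rfl⟩
      exact hu
    · intro hv
      obtain ⟨u, hu, rfl⟩ := Finset.mem_image.1 (himage.symm ▸ hL' hv)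
      exact ⟨u, ⟨hu, hv⟩, rfl⟩
  have h2 : (S \ L).image σ = T \ L' := by
    rw [Finset.image_sdiff_of_injOn hσ hLS, himage, h1]
  have hLh : L.card = h := by
    rw [← hLh', ← h1, Finset.card_image_of_injOn (hσ.mono (Finset.coe_subset.2 hLS))]
  have h3 := hs.crossSum_le_of_canMove hS hσ hmove hLS (Finset.sdiff_subset (t := L)) (by
    rw [Finset.card_sdiff_of_subset hLS, hS, hLh]
    omega)
  rw [h1, h2, hLh] at h3
  refine (hd.1 L hLS hLh).trans ?_
  have hcut : ∀ T L : Finset X, cut q T L = crossSum q L (T \ L) := fun T L => by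
    unfold cut
    congr!
  rwa [hcut, hcut]

/-! ### Initial segments of clusters -/

/-- A discrete intermediate value theorem. -/
theorem exists_eq_of_step {g : ℕ → ℕ} (h0 : g 0 = 0) (hstep : ∀ c, g (c + 1) ≤ g c + 1) (n : ℕ) :
    ∀ j ≤ g n, ∃ c ≤ n, g c = j := by
  induction n with
  | zero => exact fun j hj => ⟨0, le_rfl, by omega⟩
  | succ n ih =>
    intro j hj
    rcases Nat.lt_or_ge (g n) j with h1 | h1
    · exact ⟨n + 1, le_rfl, by have := hstep n; omega⟩
    · obtain ⟨c, hc, rfl⟩ := ih j h1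
      exact ⟨c, hc.trans (Nat.le_succ n), rfl⟩

/-- Every subset of `T` has the same numbers of points in the clusters as a subset that separates in
each cluster of `T` the first points from the others. -/
theorem exists_clusterCount_inter_select_eq [Fintype X] [DecidableEq X] (e : Fin n ≃ X) (z : X)
    (cl : X → ℕ) {T L : Finset X} (hL : L ⊆ T) :
    ∃ f : ℕ → ℕ, (∀ i, f i ≤ n) ∧
      ∀ i, clusterCount cl (T ∩ select e z cl f) i = clusterCount cl L i := by
  have h : ∀ i, ∃ c ≤ n, (T.filter fun u => cl u = i ∧ rank e z cl u < c).card =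
      clusterCount cl L i := by
    intro i
    refine exists_eq_of_step (g := fun c => (T.filter fun u => cl u = i ∧
      rank e z cl u < c).card) (by simp) (fun c => ?_) n _ ?_
    · have h1 : (T.filter fun u => cl u = i ∧ rank e z cl u < c + 1) ⊆
          (T.filter fun u => cl u = i ∧ rank e z cl u < c) ∪
            T.filter fun u => cl u = i ∧ rank e z cl u = c := by
        intro u hu
        simp only [Finset.mem_filter, Finset.mem_union] at hu ⊢
        rcases Nat.lt_succ_iff_lt_or_eq.1 hu.2.2 with h1 | h1
        · exact Or.inl ⟨hu.1, hu.2.1, h1⟩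
        · exact Or.inr ⟨hu.1, hu.2.1, h1⟩
      have h2 : (T.filter fun u => cl u = i ∧ rank e z cl u = c).card ≤ 1 := by
        refine Finset.card_le_one.2 fun u hu v hv => ?_
        rw [Finset.mem_filter] at hu hv
        exact eq_of_rank_eq (hu.2.1.trans hv.2.1.symm) (hu.2.2.trans hv.2.2.symm)
      exact (Finset.card_le_card h1).trans ((Finset.card_union_le _ _).trans
        (Nat.add_le_add_left h2 _))
    · refine (clusterCount_mono cl hL i).trans (Finset.card_le_card fun u hu => ?_)
      rw [Finset.mem_filter] at hu ⊢
      refine ⟨hu.1, hu.2, (rank_lt_card z cl u).trans_eq ?_⟩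
      rw [← Fintype.card_congr e, Fintype.card_fin]
  choose f hf hfL using h
  refine ⟨f, hf, fun i => ?_⟩
  rw [← hfL i, clusterCount]
  congr 1
  ext u
  simp only [Finset.mem_filter, Finset.mem_inter, mem_select]
  constructor
  · rintro ⟨⟨h1, h2⟩, rfl⟩
    exact ⟨h1, rfl, h2⟩
  · rintro ⟨h1, rfl, h2⟩
    exact ⟨⟨h1, h2⟩, rfl⟩

/-- The restriction of the search to the partitions by initial segments of the clusters makes the
minimum only slightly larger. -/
theorem IsScale.isCutValue_le (hs : IsScale q θ K k M z) [Fintype X] {T : Finset X} {cl : X → ℕ}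
    (hfar : ∀ u, cl u = 0 ↔ IsFar q k (farFactor q θ) M z u)
    (hclose : ∀ u v, cl u = cl v → cl u ≠ 0 →
      k * dist u v ^ q ≤ 2 * K * (closeFactor q K θ * M))
    (hT : T.card = k) (hk : 2 ≤ k) {d v : ℝ} (hd : IsMinCut q (k / 2) T d)
    (hv : IsValue q e k z cl .remoteBipartition T v) :
    v ≤ (1 + 10 * (K * θ)) * d + 10 * (K * θ) * ((k / 2 : ℕ) * M) := by
  classical
  obtain ⟨-, L, hL, hLh, rfl⟩ := hd
  obtain ⟨f, hf, hfL⟩ := exists_clusterCount_inter_select_eq e z cl hL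
  have hcard : (T ∩ select e z cl f).card = k / 2 := (card_eq_of_clusterCount hfL).trans hLh
  have hv' : v ≤ cut q T (T ∩ select e z cl f) := by
    refine hv.1 _ ⟨f, hf, ?_⟩ Finset.inter_subset_left hcard
    congr!
  exact hv'.trans (hs.cut_swap_le hfar hclose hT hL Finset.inter_subset_left hLh hcard
    (by omega) (by omega) (by omega) fun i => (hfL i).symm)

end

/-! ### The quality of the solution -/

section

variable {X : Type} [PseudoMetricSpace X] {n k K h : ℕ} {e : Fin n ≃ X} {q θ ε M : ℝ} {z : X}

theorem IsClustering.dist_le (hq : 0 ≤ q) (hK : (2 : ℝ) ^ q ≤ K) {C ξ : ℝ} {cl : X → ℕ} {m : ℕ}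
    (hcl : IsClustering q k C ξ M z cl m) (u v : X) (huv : cl u = cl v) (hu : cl u ≠ 0) :
    k * dist u v ^ q ≤ 2 * K * (ξ * M) := by
  obtain ⟨l, hl, -⟩ := hcl.leaders
  have h1 := hl u hu
  have h2 := hl v (huv ▸ hu)
  rw [← huv] at h2
  unfold IsClose at h1 h2
  rw [dist_comm] at h2
  calc k * dist u v ^ q ≤ k * (K * (dist u (l (cl u)) ^ q + dist (l (cl u)) v ^ q)) := by
        have := dist_rpow_triangle hq hK u (l (cl u)) v
        gcongr
    _ = K * (k * dist u (l (cl u)) ^ q + k * dist (l (cl u)) v ^ q) := by ring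
    _ ≤ K * (ξ * M + ξ * M) := by gcongr
    _ = _ := by ring

/-- The scale `M` is at most of the order of the average distance from a point of some `k`-set to
the others. -/
theorem exists_scale_le [Fintype X] (e : Fin n ≃ X) (hq : 1 ≤ q) (hK : (2 : ℝ) ^ q ≤ K)
    (hk : 2 ≤ k) (hkn : k ≤ n) (hM : ∀ z', M ≤ topSum q e k z') :
    ∃ S : Finset X, S.card = k ∧ k * M ≤ 4 * K * crossSum q S S := by
  have hcard : Fintype.card X = n := by rw [← Fintype.card_congr e, Fintype.card_fin]
  have hne : (Finset.powersetCard k (Finset.univ : Finset X)).Nonempty := by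
    rw [Finset.powersetCard_nonempty, Finset.card_univ, hcard]
    exact hkn
  obtain ⟨S, hS, hmax⟩ := Finset.exists_max_image _ (fun S => crossSum q S S) hne
  rw [Finset.mem_powersetCard] at hS
  obtain ⟨z', hz'⟩ := exists_center hq hK hk hS.2 fun T hT =>
    hmax T (Finset.mem_powersetCard.2 ⟨Finset.subset_univ T, hT⟩)
  refine ⟨S, hS.2, le_trans ?_ (hz' _ (card_select_const (e := e) (hkn.trans_eq hcard.symm) z'))⟩
  rw [← topSum_eq]
  exact mul_le_mul_of_nonneg_left (hM z') (Nat.cast_nonneg k)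

/-- The scale `M` is at most of the order of the optimal cuts. -/
theorem scale_le_of_isMinCut (hq : 1 ≤ q) (hK : (2 : ℝ) ^ q ≤ K) (hk : 2 ≤ k)
    {S : Finset X} (hS : S.card = k) (hMS : k * M ≤ 4 * K * crossSum q S S) (hhk : 2 * h ≤ k)
    {d : ℝ} (hd : IsMinCut q h S d) : h * M ≤ 16 * K ^ 2 * d := by
  obtain ⟨-, L, hL, hLh, rfl⟩ := hd
  have h1 := card_mul_crossSum_le_cut hq hK hS hL hLh hhk
  have hk0 : (0 : ℝ) < k := by exact_mod_cast (by omega : 0 < k)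
  refine le_of_mul_le_mul_left ?_ hk0
  calc k * (h * M) = h * (k * M) := by ring
    _ ≤ h * (4 * K * crossSum q S S) := by gcongr
    _ = 4 * K * (h * crossSum q S S) := by ring
    _ ≤ 4 * K * (4 * K * k * cut q S L) := by gcongr
    _ = _ := by ring

theorem accuracy_pos (hK : 0 < K) (hε : 0 < ε) : 0 < accuracy K ε := by
  unfold accuracy
  positivity

theorem mul_accuracy_le (hK : 0 < K) (hε : 0 < ε) :
    K * accuracy K ε * (510 * K ^ 2) ≤ 1 ∧ K * accuracy K ε * (510 * K ^ 2) ≤ ε := by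
  have h1 : K * accuracy K ε * (510 * K ^ 2) = ε / (1 + ε) := by
    unfold accuracy
    push_cast
    field_simp
  rw [h1]
  constructor
  · rw [div_le_one (by linarith)]
    linarith
  · exact div_le_self hε.le (by linarith)

/-- If a function `d` is known up to the factor `1 + 10 * K * θ` and an error that is small
compared with its maximum, then maximizing the estimates nearly maximizes `d`. The predicate `V T
v` says that `v` is an estimate for `d T`. -/
theorem approx_of_estimates {X : Type} {d : Finset X → ℝ} {V : Finset X → ℝ → Prop} {W : ℝ}
    {F : Set (Finset X)} (hK : 1 ≤ K) (hε : 0 < ε)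
    (hd : ∀ S : Finset X, S.card = k → 0 ≤ d S)
    (hW : ∃ S : Finset X, S.card = k ∧ W ≤ 16 * K ^ 2 * d S)
    (hF : ∀ S : Finset X, S.card = k → ∃ T ∈ F, T.card = k ∧
      d S ≤ (1 + 10 * (K * accuracy K ε)) * d T + 10 * (K * accuracy K ε) * W)
    (hV : ∀ (T : Finset X) v, T.card = k → V T v → d T ≤ v)
    (hV' : ∀ (T : Finset X) v, T.card = k → V T v →
      v ≤ (1 + 10 * (K * accuracy K ε)) * d T + 10 * (K * accuracy K ε) * W)
    {T : Finset X} (hT : T.card = k) {v : ℝ} (hv : V T v)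
    (hmax : ∀ T' ∈ F, T'.card = k → ∃ v' ≤ v, V T' v') :
    ∀ S : Finset X, S.card = k → (1 - ε) * d S ≤ d T := by
  intro S₀ hS₀
  obtain ⟨S₁, hS₁, hWS₁⟩ := hW
  -- either the given set or the one that witnesses the scale, whichever is better
  obtain ⟨S, hS, hS₀S, hWS⟩ : ∃ S : Finset X, S.card = k ∧ d S₀ ≤ d S ∧ W ≤ 16 * K ^ 2 * d S := by
    rcases le_total (d S₀) (d S₁) with h | h
    · exact ⟨S₁, hS₁, h, hWS₁⟩
    · exact ⟨S₀, hS₀, le_rfl, hWS₁.trans (by gcongr)⟩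
  obtain ⟨T', hT'F, hT', hST'⟩ := hF S hS
  obtain ⟨v', hv', hV''⟩ := hmax T' hT'F hT'
  have h1 := hV T' v' hT' hV''
  have h2 := hV' T v hT hv
  have hdT := hd T hT
  have hdS := hd S hS
  have hdS₀ := hd S₀ hS₀
  obtain ⟨ha, hb⟩ := mul_accuracy_le (K := K) (by omega) hε
  have hη : 0 ≤ K * accuracy K ε := mul_nonneg (by positivity) (accuracy_pos (by omega) hε).le
  have hK1 : (1 : ℝ) ≤ K ^ 2 := one_le_pow₀ (by exact_mod_cast hK)
  generalize K * accuracy K ε = η at *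
  have hK2 := mul_le_mul_of_nonneg_left hK1 hη
  have h3 : d S ≤ (1 + 10 * η) * ((1 + 10 * η) * d T + 10 * η * W) + 10 * η * W := by
    refine hST'.trans ?_
    gcongr
    exact h1.trans (hv'.trans h2)
  have h4 : (1 + 10 * η) * (1 + 10 * η) ≤ 1 + 30 * η := by nlinarith
  have h5 : (1 + 10 * η) * (10 * η) + 10 * η ≤ 30 * η := by nlinarith
  have h6 : (30 * η) * (16 * K ^ 2) + 30 * η ≤ ε := by nlinarith
  have h7 : d S ≤ (1 + 30 * η) * d T + 30 * η * (16 * K ^ 2 * d S) := by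
    have h8 : ((1 + 10 * η) * (10 * η) + 10 * η) * W ≤
        ((1 + 10 * η) * (10 * η) + 10 * η) * (16 * K ^ 2 * d S) := by gcongr
    have h9 : ((1 + 10 * η) * (10 * η) + 10 * η) * (16 * K ^ 2 * d S) ≤
        30 * η * (16 * K ^ 2 * d S) := by gcongr
    nlinarith [mul_le_mul_of_nonneg_right h4 hdT]
  have h8 : (1 + 30 * η) * ((1 - ε) * d S) ≤ (1 + 30 * η) * d T := by
    have h9 := mul_le_mul_of_nonneg_right h6 hdS
    have h10 : 0 ≤ 30 * η * (ε * d S) := by positivity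
    nlinarith
  have h9 := le_of_mul_le_mul_left h8 (by linarith)
  rcases le_total ε 1 with h | h
  · refine le_trans ?_ h9
    exact mul_le_mul_of_nonneg_left hS₀S (by linarith)
  · exact (mul_nonpos_of_nonpos_of_nonneg (by linarith) hdS₀).trans hdT

/-- The best solution found by the algorithm is nearly optimal. -/
theorem isApproxSolution_of_isValue [Fintype X] (hq : 1 ≤ q) (hK : (2 : ℝ) ^ q ≤ K) (hε : 0 < ε)
    (hk : 2 ≤ k) (hkn : k ≤ n) {cl : X → ℕ} {m : ℕ}
    (hcl : IsClustering q k (farFactor q (accuracy K ε)) (closeFactor q K (accuracy K ε))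
      (topSum q e k z) z cl m)
    (hz : ∀ z', topSum q e k z ≤ topSum q e k z') (P : Problem) {T : Finset X} {v : ℝ}
    (hT : T.card = k) (hv : IsValue q e k z cl P T v)
    (hmax : ∀ f : ℕ → ℕ, (∀ i, f i ≤ n) → (select e z cl f).card = k →
      ∃ v' ≤ v, IsValue q e k z cl P (select e z cl f) v') :
    IsApproxSolution q P k ε T := by
  classical
  have hq0 : 0 ≤ q := by linarith
  have hK2 := two_le_of_rpow_le hq hK
  have hK1 : 1 ≤ K := by exact_mod_cast (one_le_two.trans hK2 : (1 : ℝ) ≤ K)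
  have hcardX : Fintype.card X = n := by rw [← Fintype.card_congr e, Fintype.card_fin]
  set θ := accuracy K ε with hθ
  set M := topSum q e k z with hM
  have hs : IsScale q θ K k M z := by
    refine ⟨hq, hK, accuracy_pos hK1 hε, ?_, by omega, topSum_nonneg z,
      fun T hT => sum_dist_le_topSum hq0 hT z⟩
    have h1 := (mul_accuracy_le hK1 hε).1
    have h2 : (1 : ℝ) ≤ K ^ 2 := one_le_pow₀ (by linarith)
    have h3 : 0 ≤ K * accuracy K ε := mul_nonneg (by positivity) (accuracy_pos hK1 hε).le
    nlinarith
  have hfar := hcl.eq_zero_iff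
  have hclose := hcl.dist_le hq0 hK
  obtain ⟨S, hS, hMS⟩ := exists_scale_le e hq hK hk hkn hz
  -- every `k`-set has a counterpart among the candidates of the search
  have hF : ∀ S : Finset X, S.card = k → ∃ T ∈ {T | ∃ f : ℕ → ℕ, (∀ i, f i ≤ n) ∧
      select e z cl f = T}, T.card = k ∧ ∃ σ : X → X, Set.InjOn σ S ∧ (∀ u ∈ S, σ u ∈ T) ∧
        ∀ u ∈ S, CanMove q θ K k M z u (σ u) := by
    intro S hS
    have hcount : ∀ i, clusterCount cl S i =
        clusterCount cl (select e z cl (clusterCount cl S)) i := fun i =>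
      (clusterCount_select z cl _ i (clusterCount_mono cl (Finset.subset_univ S) i)).symm
    obtain ⟨σ, hσ, hσT, hσc, hσd⟩ := exists_matching hcount
    refine ⟨_, ⟨clusterCount cl S, fun i => ?_, rfl⟩,
      (card_eq_of_clusterCount hcount).symm.trans hS, σ, hσ, hσT, fun u hu => ?_⟩
    · exact (Finset.card_le_univ _).trans_eq hcardX
    · by_cases h : cl u = 0
      · exact Or.inl ⟨(hfar u).1 h, (hfar (σ u)).1 ((hσc u hu).trans h),
          Real.rpow_le_rpow dist_nonneg (hσd u hu) hq0⟩
      · refine Or.inr ⟨fun h' => h ((hfar u).2 h'), fun h' => h ?_,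
          hclose u (σ u) (hσc u hu).symm h⟩
        rw [← hσc u hu]
        exact (hfar (σ u)).2 h'
  have hmax' : ∀ T' ∈ {T | ∃ f : ℕ → ℕ, (∀ i, f i ≤ n) ∧ select e z cl f = T}, T'.card = k →
      ∃ v' ≤ v, IsValue q e k z cl P T' v' := by
    rintro T' ⟨f, hf, rfl⟩ hT'
    exact hmax f hf hT'
  -- the argument for the two problems that ask for a minimal cut
  have hcut : ∀ h : ℕ, 2 * h ≤ k →
      (∀ T : Finset X, T.card = k → IsMinCut q h T (diversity q P T)) →
      (∀ (T : Finset X) v, T.card = k → IsValue q e k z cl P T v → diversity q P T ≤ v) →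
      (∀ (T : Finset X) v, T.card = k → IsValue q e k z cl P T v →
        v ≤ (1 + 10 * (K * θ)) * diversity q P T + 10 * (K * θ) * (h * M)) →
      IsApproxSolution q P k ε T := by
    intro h hhk hmin hV hV'
    refine ⟨hT, approx_of_estimates (V := IsValue q e k z cl P) (W := h * M) hK1 hε
      (fun S hS => (hmin S hS).nonneg)
      ⟨S, hS, scale_le_of_isMinCut hq hK hk hS hMS hhk (hmin S hS)⟩ ?_ hV hV' hT hv hmax'⟩
    intro S hS
    obtain ⟨T', hT'F, hT', σ, hσ, hσT, hmove⟩ := hF S hS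
    exact ⟨T', hT'F, hT', hs.isMinCut_le hS hT' hσ hσT hmove hhk (hmin S hS) (hmin T' hT')⟩
  cases P with
  | remoteClique =>
    have h1 : ∀ S : Finset X, S.card = k → (1 - ε) * crossSum q S S ≤ crossSum q T T := by
      refine approx_of_estimates (V := IsValue q e k z cl .remoteClique) (W := k * M) hK1 hε
        (fun S _ => crossSum_nonneg q S S) ⟨S, hS, hMS.trans ?_⟩ ?_ (fun T v _ hv => hv.ge)
        (fun T v _ hv => ?_) hT hv hmax'
      · have := crossSum_nonneg q S S
        gcongr
        · norm_num
        · exact le_self_pow₀ (by linarith) two_ne_zero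
      · intro S hS
        obtain ⟨T', hT'F, hT', σ, hσ, hσT, hmove⟩ := hF S hS
        have h1 := hs.crossSum_le_of_canMove hS hσ hmove (Finset.Subset.refl S)
          (Finset.Subset.refl S) (by omega)
        rw [image_eq_of_injOn hσ hσT (hT'.trans hS.symm).le, hS] at h1
        exact ⟨T', hT'F, hT', h1⟩
      · rw [show v = crossSum q T T from hv]
        have h1 := crossSum_nonneg q T T
        have h2 := hs.cast_mul_nonneg
        have h3 := hs.nonneg
        have h4 : 0 ≤ 10 * (K * θ) * crossSum q T T := by positivity
        have h5 : 0 ≤ 10 * (K * θ) * (k * M) := by positivity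
        linarith
    refine ⟨hT, fun S hS => ?_⟩
    have := h1 S hS
    unfold crossSum at this
    simp only [diversity]
    linarith
  | remoteStar =>
    have hmin : ∀ T : Finset X, T.card = k → IsMinCut q 1 T (diversity q .remoteStar T) :=
      fun T hT => isMinCut_remoteStar (Finset.card_pos.1 (by omega))
    refine hcut 1 (by omega) hmin (fun T v hT hv => (hmin T hT).le_of_isCutValue hv) ?_
    intro T v hT hv
    have h1 := (hmin T hT).nonneg
    have h2 := hs.cast_mul_nonneg
    have h3 := hs.nonneg
    have h4 : 0 ≤ 10 * (K * θ) * diversity q .remoteStar T := by positivity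
    have h5 : 0 ≤ 10 * (K * θ) * ((1 : ℕ) * M) := by positivity
    obtain ⟨-, L, hL, hLh, hd⟩ := hmin T hT
    have h6 : v ≤ cut q T L := hv.1 L (Set.mem_univ L) hL hLh
    linarith
  | remoteBipartition =>
    have hmin : ∀ T : Finset X, T.card = k →
        IsMinCut q (k / 2) T (diversity q .remoteBipartition T) := by
      rintro T rfl
      exact isMinCut_remoteBipartition T
    exact hcut (k / 2) (by omega) hmin (fun T v hT hv => (hmin T hT).le_of_isCutValue hv)
      fun T v hT hv => hs.isCutValue_le hfar hclose hT hk (hmin T hT) hv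

/-! ### The approximation schemes -/

theorem admitsPTAS (hq : 1 ≤ q) (P : Problem) : AdmitsPTAS q P := by
  obtain ⟨K, hK⟩ := exists_nat_ge ((2 : ℝ) ^ q)
  refine ⟨schemeProgram K P, fun ε hε D => ?_⟩
  have hK2 := two_le_of_rpow_le hq hK
  have hK0 : 0 < K := by exact_mod_cast (zero_lt_two.trans_le hK2 : (0 : ℝ) < K)
  have hθ := accuracy_pos hK0 hε
  have hE : 0 < blowup q (accuracy K ε) := zero_lt_one.trans_le (one_le_blowup hq hθ)
  obtain ⟨m₀, hm₀⟩ := exists_clustering_bound hq (C := farFactor q (accuracy K ε))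
    (ξ := closeFactor q K (accuracy K ε)) (by unfold farFactor; positivity)
    (by unfold closeFactor; positivity) D
  obtain ⟨p₁, hp₁⟩ := Cmd.exists_polynomial 0 (prepareCmd K)
  obtain ⟨p₂, hp₂⟩ := Cmd.exists_polynomial m₀ (searchCmd P)
  refine ⟨p₁ + p₂, fun X _ n k e hk hkn hD => ?_⟩
  have := Fintype.ofEquiv (Fin n) e
  obtain ⟨z, cl, N, hcl, hz, t, s, hrun, ht, hbest⟩ :=
    halts_schemeProgram e k K P (by omega) (zero_lt_one.trans_le hq) hε
  refine ⟨t, s, hrun, ht.trans ?_, ?_⟩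
  · rw [Polynomial.eval_add]
    exact add_le_add (hp₁ n 0 le_rfl)
      (hp₂ n N (hm₀ X k _ z cl N (by omega) (topSum_nonneg z) hD hcl))
  · have hcand : ∃ f : ℕ → ℕ, (∀ i, f i ≤ n) ∧ (select e z cl f).card = k := by
      have hcardX : Fintype.card X = n := by rw [← Fintype.card_congr e, Fintype.card_fin]
      obtain ⟨S, -, hS⟩ := Finset.exists_subset_card_eq (s := (Finset.univ : Finset X)) (n := k)
        (by rwa [Finset.card_univ, hcardX])
      refine ⟨clusterCount cl S, fun i => (Finset.card_le_univ _).trans_eq hcardX, ?_⟩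
      rw [← hS]
      exact card_eq_of_clusterCount fun i =>
        clusterCount_select z cl _ i (clusterCount_mono cl (Finset.subset_univ S) i)
    obtain ⟨T, v, hmarks, hT, hv, hmax⟩ := hbest hcand
    rw [hmarks.outputSet_eq]
    exact isApproxSolution_of_isValue hq hK hε hk hkn hcl hz P hT hv hmax

end

end Dispersion

end

theorem theorem1 (q : ℝ) (hq : 1 ≤ q) :
    Dispersion.AdmitsPTAS q Dispersion.Problem.remoteClique ∧
      Dispersion.AdmitsPTAS q Dispersion.Problem.remoteStar ∧
        Dispersion.AdmitsPTAS q Dispersion.Problem.remoteBipartition :=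
  ⟨Dispersion.admitsPTAS hq _, Dispersion.admitsPTAS hq _, Dispersion.admitsPTAS hq _⟩
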